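/- Let $s>1$, $C>0$, and let $V\in L^1_{\rm loc}(\mathbb R)$ be real-valued with $V(x)\ge C^{-1}|x|^s$ for almost every $x\in\mathbb R$. Let $h=-\partial_x^2+V$ be the self-adjoint operator on $\mathfrak H=L^2(\mathbb R;\mathbb C)$ associated with the closed quadratic form $u\mapsto\int_{\mathbb R}(|u'|^2+V|u|^2)$ on $\{u\in H^1(\mathbb R):\int V|u|^2<\infty\}$. Then $h$ has a spectral decomposition $h=\sum_{n\ge 0}\lambda_n|u_n\rangle\langle u_n|$ with an orthonormal basis $(u_n)_{n\ge0}$ of $\mathfrak H$ and $\lambda_n>0$. Fix any such decomposition. For $t\in\mathbb R$ let $$\mathfrak H^t=\Big\{u=\sum_{n\ge0}\alpha_nu_n\ :\ \sum_{n\ge0}\lambda_n^t|\alpha_n|^2<\infty\Big\}$$ (a space of formal series, identified with their coefficient sequences; write $\langle u_n,u\rangle=\alpha_n$), let $X=\bigcap_{t<1/2-1/s}\mathfrak H^t$, with the $\sigma$-algebra generated by the coefficients (which is its Borel $\sigma$-algebra), and for $K\ge0$ let $\mu_{0,K}$ be the probability measure on $V_K=\mathrm{span}(u_0,\dots,u_K)$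 given by $$d\mu_{0,K}(u)=\bigotimes_{j=0}^K\frac{\lambda_j}{\pi}e^{-\lambda_j|\alpha_j|^2}\,da_j\,db_j,\qquad \alpha_j=\langle u_j,u\rangle=a_j+ib_j .$$ (1) There is a unique probability measure $\mu_0$ on $X$ whose image under the projection $\sum_n\alpha_nu_n\mapsto\sum_{n\le K}\alpha_nu_n$ is $\mu_{0,K}$ for all $K$. It is a centered Gaussian measure: for every $t<1/2-1/s$ and every $c\in\mathfrak H^{-t}$ the random variable $\mathrm{Re}\,\langle c,u\rangle$ has a centered real Gaussian law (possibly of variance $0$) under $\mu_0$. (2) $h$ has a bounded inverse. For every integer $k\ge0$, let $\mathfrak H_k=L^2_{\rm sym}(\mathbb R^k)$ be the space of permutation-symmetric functions, let $\varphi_1\otimes_{\rm sym}\cdots\otimes_{\rm sym}\varphi_k=(k!)^{-1/2}\sum_{\sigma\in S_k}\varphi_{\sigma(1)}\otimes\cdots\otimes\varphi_{\sigma(k)}$, and let $(h^{-1})^{\otimes k}$ be the bounded operator on $\mathfrak H_k$ with $(h^{-1})^{\otimes k}(\varphi_1\otimes_{\rm sym}\cdots\otimes_{\rm sym}\varphi_k)=h^{-1}\varphi_1\otimes_{\rm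 sym}\cdots\otimes_{\rm sym}h^{-1}\varphi_k$ for all $\varphi_i\in\mathfrak H$. The $k$-particle density matrix of $\mu_0$ is well defined and $$\gamma_0^{(k)}:=\int|u^{\otimes k}\rangle\langle u^{\otimes k}|\,d\mu_0(u)=k!\,(h^{-1})^{\otimes k},$$ where the integral is understood weakly: $\gamma_0^{(k)}$ is the unique bounded operator on $\mathfrak H_k$ such that $\langle\Phi,\gamma_0^{(k)}\Psi\rangle=\int\langle\Phi,u^{\otimes k}\rangle\langle u^{\otimes k},\Psi\rangle\,d\mu_0(u)$, with integrable integrand, for all $\Phi,\Psi$ that are symmetric tensor products of elements of $\mathfrak H\cap\mathfrak H^{-t}$, $t<1/2-1/s$. (3) $\gamma_0^{(k)}$ belongs to the Schatten class $\mathfrak S^p(\mathfrak H_k)$ (it is compact and its singular values are in $\ell^p$) for all $1/s+1/2<p\le\infty$. -/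

import Mathlib

open MeasureTheory ProbabilityTheory Filter Topology
open scoped ENNReal NNReal ComplexConjugate InnerProductSpace

namespace FreeGibbs

noncomputable section

/-- The one-particle space `𝔥 = L²(ℝ; ℂ)`. -/
abbrev L2R : Type := Lp ℂ 2 (volume : Measure ℝ)

/-! ### The Schrödinger operator `h = -∂ₓ² + V` -/

/-- `g ∈ L²` is the weak derivative of `f ∈ L²`. -/
def IsWeakDeriv (f g : L2R) : Prop :=
  ∀ φ : ℝ → ℝ, ContDiff ℝ (⊤ : ℕ∞) φ → HasCompactSupport φ →
    ∫ x, deriv φ x • f x = - ∫ x, φ x • g x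

/-- `f` lies in the form domain `{f ∈ H¹(ℝ) : ∫ V |f|² < ∞}` of `-∂ₓ² + V`,
and `f'` is its derivative. -/
def InFormDomain (V : ℝ → ℝ) (f f' : L2R) : Prop :=
  IsWeakDeriv f f' ∧ Integrable (fun x => V x * ‖f x‖ ^ 2)

/-- The graph of the self-adjoint operator `h = -∂ₓ² + V`, the operator of the closed quadratic form
`f ↦ ∫ |f'|² + V |f|²`: `f` is in the domain of `h` and `h f = g` if and only if `f` is in the form
domain and `⟨v', f'⟩ + ∫ V v̄ f = ⟨v, g⟩` for all `v` in the form domain. -/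
def SchrodingerGraph (V : ℝ → ℝ) (f g : L2R) : Prop :=
  ∃ f' : L2R, InFormDomain V f f' ∧
    ∀ v v' : L2R, InFormDomain V v v' →
      ⟪v', f'⟫_ℂ + ∫ x, (V x : ℂ) * (conj (v x) * f x) = ⟪v, g⟫_ℂ

/-- The spectral decomposition `h = ∑ₙ λₙ |uₙ⟩⟨uₙ|` in an orthonormal basis `(uₙ)` of `L²(ℝ)`, as
an equality of unbounded operators: `f ∈ D(h)` and `h f = g` if and only if `g` has the coefficients
`λₙ ⟨uₙ, f⟩`. -/
def IsSpectralDecomposition (V : ℝ → ℝ) (u : HilbertBasis ℕ ℂ L2R) (lam : ℕ → ℝ) : Prop :=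
  ∀ f g : L2R, SchrodingerGraph V f g ↔ ∀ n, ⟪u n, g⟫_ℂ = (lam n : ℂ) * ⟪u n, f⟫_ℂ

/-- The bounded operator `R` on `L²(ℝ)` is the inverse of `h`. -/
def IsInverse (V : ℝ → ℝ) (R : L2R →L[ℂ] L2R) : Prop :=
  ∀ f g : L2R, SchrodingerGraph V f g ↔ R g = f

/-! ### The spaces `𝔥ᵗ` and the Gaussian measures -/

/-- The space `𝔥ᵗ` of the series `u = ∑ₙ αₙ uₙ` with `∑ₙ λₙᵗ |αₙ|² < ∞`; `u` is identified with its
sequence of coefficients `α`. -/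
def SobolevLike (lam : ℕ → ℝ) (t : ℝ) : Set (ℕ → ℂ) :=
  {α | Summable fun n => lam n ^ t * ‖α n‖ ^ 2}

/-- The space `⋂_{t < t₀} 𝔥ᵗ`. As a subtype of `ℕ → ℂ` it carries the σ-algebra generated by the
coefficients `αₙ`, which is also the Borel σ-algebra of its Fréchet topology. -/
abbrev SobolevInter (lam : ℕ → ℝ) (t₀ : ℝ) : Type :=
  ↥(⋂ t ∈ Set.Iio t₀, SobolevLike lam t)

/-- The measure `⨂_{j ≤ K} (λⱼ/π) exp(-λⱼ |zⱼ|²) daⱼ dbⱼ`, `zⱼ = aⱼ + i bⱼ`, on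
`span(u₀, …, u_K) ≃ ℂ^(K+1)`. -/
def gaussianCyl (lam : ℕ → ℝ) (K : ℕ) : Measure (Fin (K + 1) → ℂ) :=
  Measure.pi fun j : Fin (K + 1) =>
    (volume : Measure ℂ).withDensity fun z =>
      ENNReal.ofReal (lam j / Real.pi * Real.exp (-(lam j * ‖z‖ ^ 2)))

/-- The projection of `⋂_{t < t₀} 𝔥ᵗ` on `span(u₀, …, u_K) ≃ ℂ^(K+1)`. -/
def cylProj {lam : ℕ → ℝ} {t₀ : ℝ} (K : ℕ) (α : SobolevInter lam t₀) : Fin (K + 1) → ℂ :=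
  fun j => α.1 j

/-- `μ` is a probability measure with cylindrical projection `gaussianCyl lam K` for all `K`. -/
def IsFreeGibbs {lam : ℕ → ℝ} {t₀ : ℝ} (μ : Measure (SobolevInter lam t₀)) : Prop :=
  IsProbabilityMeasure μ ∧ ∀ K : ℕ, μ.map (cylProj K) = gaussianCyl lam K

/-- The duality pairing `∑ₙ c̄ₙ αₙ` of two coefficient sequences, an absolutely convergent
series for `c ∈ 𝔥⁻ᵗ` and `α ∈ 𝔥ᵗ`. -/
def pairing (c α : ℕ → ℂ) : ℂ := ∑' n, conj (c n) * α n

/-- `μ` is a centered Gaussian measure: every continuous real linear functional `Re ⟨c, ·⟩` on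
`⋂_{t < t₀} 𝔥ᵗ`, that is, `c ∈ 𝔥⁻ᵗ` for some `t < t₀`, has a centered real Gaussian law. -/
def IsCenteredGaussian {lam : ℕ → ℝ} {t₀ : ℝ} (μ : Measure (SobolevInter lam t₀)) : Prop :=
  ∀ t < t₀, ∀ c ∈ SobolevLike lam (-t), ∃ v : ℝ≥0,
    μ.map (fun α => (pairing c α.1).re) = gaussianReal 0 v

/-! ### The `k`-particle space and its operators -/

/-- `L²(ℝᵏ; ℂ)`. -/
abbrev L2Rk (k : ℕ) : Type := Lp ℂ 2 (volume : Measure (Fin k → ℝ))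

theorem measurePreserving_perm {k : ℕ} (σ : Equiv.Perm (Fin k)) :
    MeasurePreserving (fun x : Fin k → ℝ => x ∘ σ) volume volume := by
  have h := volume_measurePreserving_piCongrLeft (fun _ : Fin k => ℝ) σ.symm
  have e : (⇑(MeasurableEquiv.piCongrLeft (fun _ : Fin k => ℝ) σ.symm)
      : (Fin k → ℝ) → (Fin k → ℝ)) = fun x => x ∘ σ := by
    funext x i
    have := MeasurableEquiv.piCongrLeft_apply_apply (β := fun _ : Fin k => ℝ) σ.symm x (σ i)
    simpa using this
  rw [e] at h
  exact h

/-- The bosonic `k`-particle space `𝔥ₖ = L²_sym(ℝᵏ)`. -/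
def SymL2 (k : ℕ) : Submodule ℂ (L2Rk k) where
  carrier := {Φ | ∀ σ : Equiv.Perm (Fin k), (fun x => Φ (x ∘ σ)) =ᵐ[volume] Φ}
  zero_mem' := by
    intro σ
    have h0 := Lp.coeFn_zero (E := ℂ) (p := 2) (μ := (volume : Measure (Fin k → ℝ)))
    exact ((measurePreserving_perm σ).quasiMeasurePreserving.ae_eq h0).trans h0.symm
  add_mem' := by
    intro Φ Ψ hΦ hΨ σ
    have h0 := Lp.coeFn_add Φ Ψ
    have h1 := (measurePreserving_perm σ).quasiMeasurePreserving.ae_eq h0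
    filter_upwards [h0, h1, hΦ σ, hΨ σ] with x a b c d
    simp only [Function.comp_apply, Pi.add_apply] at a b
    rw [a, b, c, d]
  smul_mem' := by
    intro r Φ hΦ σ
    have h0 := Lp.coeFn_smul r Φ
    have h1 := (measurePreserving_perm σ).quasiMeasurePreserving.ae_eq h0
    filter_upwards [h0, h1, hΦ σ] with x a b c
    simp only [Function.comp_apply, Pi.smul_apply] at a b
    rw [a, b, c]

/-- The function `(x₁, …, xₖ) ↦ (k!)^{-1/2} ∑_σ ∏ᵢ φ_{σ(i)}(xᵢ)`. -/
def symTensorFun {k : ℕ} (φ : Fin k → L2R) (x : Fin k → ℝ) : ℂ :=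
  ((Real.sqrt (k.factorial : ℝ))⁻¹ : ℂ) * ∑ σ : Equiv.Perm (Fin k), ∏ i, φ (σ i) (x i)

theorem memLp_tensor {k : ℕ} (φ : Fin k → L2R) :
    MemLp (fun x : Fin k → ℝ => ∏ i, φ i (x i)) 2 volume := by
  have hm : AEStronglyMeasurable (fun x : Fin k → ℝ => ∏ i, φ i (x i)) volume := by
    refine Finset.aestronglyMeasurable_fun_prod _ fun i _ => ?_
    exact ((Lp.stronglyMeasurable (φ i)).comp_measurable (measurable_pi_apply i)).aestronglyMeasurable
  rw [memLp_two_iff_integrable_sq_norm hm]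
  have h : ∀ i, Integrable (fun y : ℝ => ‖φ i y‖ ^ 2) volume := fun i =>
    (memLp_two_iff_integrable_sq_norm (Lp.aestronglyMeasurable _)).1 (Lp.memLp (φ i))
  have := Integrable.fintype_prod (μ := fun _ : Fin k => (volume : Measure ℝ)) h
  rw [← volume_pi] at this
  simpa only [norm_prod, Finset.prod_pow] using this

theorem memLp_symTensorFun {k : ℕ} (φ : Fin k → L2R) : MemLp (symTensorFun φ) 2 volume := by
  have : MemLp (fun x : Fin k → ℝ =>
      ∑ σ : Equiv.Perm (Fin k), ∏ i, φ (σ i) (x i)) 2 volume :=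
    memLp_finsetSum _ fun σ _ => memLp_tensor fun i => φ (σ i)
  exact this.const_mul _

theorem symTensorFun_comp {k : ℕ} (φ : Fin k → L2R) (τ : Equiv.Perm (Fin k)) (x : Fin k → ℝ) :
    symTensorFun φ (x ∘ τ) = symTensorFun φ x := by
  unfold symTensorFun
  congr 1
  refine Fintype.sum_equiv (Equiv.mulRight τ⁻¹) _ _ fun σ => ?_
  refine Fintype.prod_equiv τ _ _ fun i => ?_
  simp

/-- The symmetric tensor product
`φ₁ ⊗_sym ⋯ ⊗_sym φₖ = (k!)^{-1/2} ∑_σ φ_{σ(1)} ⊗ ⋯ ⊗ φ_{σ(k)}` in `𝔥ₖ`. -/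
def symTensor {k : ℕ} (φ : Fin k → L2R) : SymL2 k :=
  ⟨(memLp_symTensorFun φ).toLp, by
    intro τ
    have h0 := (memLp_symTensorFun φ).coeFn_toLp
    have h1 := (measurePreserving_perm τ).quasiMeasurePreserving.ae_eq h0
    filter_upwards [h0, h1] with x a b
    simp only [Function.comp_apply] at b
    rw [a, b, symTensorFun_comp]⟩

/-- `T = A^{⊗k}`, the bounded operator on `𝔥ₖ` with
`T (φ₁ ⊗_sym ⋯ ⊗_sym φₖ) = A φ₁ ⊗_sym ⋯ ⊗_sym A φₖ`. -/
def IsTensorPower (A : L2R →L[ℂ] L2R) (k : ℕ) (T : SymL2 k →L[ℂ] SymL2 k) : Prop :=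
  ∀ φ : Fin k → L2R, T (symTensor φ) = symTensor fun i => A (φ i)

/-- The pairing `⟨φ₁ ⊗_sym ⋯ ⊗_sym φₖ, u^{⊗k}⟩ = (k!)^{-1/2} ∑_σ ∏ᵢ ⟨φ_{σ(i)}, u⟩` for
`u = ∑ₙ αₙ uₙ`. -/
def symPairing (u : HilbertBasis ℕ ℂ L2R) {k : ℕ} (φ : Fin k → L2R) (α : ℕ → ℂ) : ℂ :=
  ((Real.sqrt (k.factorial : ℝ))⁻¹ : ℂ) *
    ∑ σ : Equiv.Perm (Fin k), ∏ i, pairing (fun n => ⟪u n, φ (σ i)⟫_ℂ) α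

/-- `γ = ∫ |u^{⊗k}⟩⟨u^{⊗k}| dμ(u)` as an operator on `𝔥ₖ`. The integral is meant weakly, because
`u` need not be in `L²`: for all symmetric products `Φ`, `Ψ` of elements of `L² ∩ 𝔥⁻ᵗ`, `t < t₀`,
the function `⟨Φ, u^{⊗k}⟩ ⟨u^{⊗k}, Ψ⟩` of `u` is integrable with integral `⟨Φ, γ Ψ⟩`. -/
def IsDensityMatrix (u : HilbertBasis ℕ ℂ L2R) {lam : ℕ → ℝ} {t₀ : ℝ}
    (μ : Measure (SobolevInter lam t₀)) (k : ℕ) (γ : SymL2 k →L[ℂ] SymL2 k) : Prop :=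
  ∀ t < t₀, ∀ φ ψ : Fin k → L2R,
    (∀ i, (fun n => ⟪u n, φ i⟫_ℂ) ∈ SobolevLike lam (-t)) →
    (∀ i, (fun n => ⟪u n, ψ i⟫_ℂ) ∈ SobolevLike lam (-t)) →
      Integrable (fun α : SobolevInter lam t₀ =>
        symPairing u φ α.1 * conj (symPairing u ψ α.1)) μ ∧
      ∫ α : SobolevInter lam t₀, symPairing u φ α.1 * conj (symPairing u ψ α.1) ∂μ =
        ⟪symTensor φ, γ (symTensor ψ)⟫_ℂ

/-- `T` belongs to the Schatten class `𝔖ᵖ(H)`: it has a singular value decomposition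
`T = ∑ᵢ σᵢ |fᵢ⟩⟨eᵢ|` with `σᵢ → 0` and `σ ∈ ℓᵖ`. For `p = ∞` this is the class of compact
operators. -/
def IsSchatten {H : Type*} [NormedAddCommGroup H] [InnerProductSpace ℂ H]
    (p : ℝ≥0∞) (T : H →L[ℂ] H) : Prop :=
  ∃ (ι : Type) (e f : ι → H) (σ : ι → ℝ), Orthonormal ℂ e ∧ Orthonormal ℂ f ∧
    (∀ i, 0 ≤ σ i) ∧ Tendsto σ cofinite (𝓝 0) ∧ Memℓp σ p ∧
    ∀ x, HasSum (fun i => ((σ i : ℂ) * ⟪e i, x⟫_ℂ) • f i) (T x)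

end

end FreeGibbs

/-!
A function of finite energy is approximated in `L²`, up to `ε` times its energy, by its averages on
cells of length `ε^{1/2}` filling an interval outside of which `V ≥ 1/ε`; outside of this interval
`|f|² ≤ ε V |f|²`. Hence the form domain embeds compactly in `L²`, so that `(h + 1)⁻¹` has an
eigenbasis, and, since `O(E^{1/s + 1/2})` cells are needed for `ε = 1 / (2E)`, the number of
eigenvalues below `E` is `O(E^{1/s + 1/2})`. Therefore `∑ₙ λₙ^{-r} < ∞` for all `r > 1/s + 1/2`.

The measure `μ₀` has to be the law of independent complex Gaussian coefficients `αₙ` with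
`𝔼 |αₙ|² = 1 / λₙ`. As `𝔼 ∑ₙ λₙᵗ |αₙ|² = ∑ₙ λₙ^{t - 1}` is finite for `t < 1/2 - 1/s`, it is
concentrated on `⋂ₜ 𝔥ᵗ`, and for `c ∈ 𝔥⁻ᵗ` the functional `⟨c, u⟩` is a limit of Gaussian
variables. The circular symmetry gives `𝔼 (X Ȳ)^k = k! (𝔼 X Ȳ)^k` for two functionals `X = ⟨φ, u⟩`
and `Y = ⟨ψ, u⟩`, and polarization in `φ` and `ψ` turns this into Wick's formula, which consists of
the matrix elements of `k! (h⁻¹)^{⊗k}`.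

The occupation number states are an orthogonal basis of eigenvectors of `(h⁻¹)^{⊗k}` with
eigenvalues `∏ᵢ λ_{nᵢ}⁻¹`, where `n₁ ≤ ⋯ ≤ n_k`, and the sum of the `r`-th powers of these is at
most `(∑ₙ λₙ^{-r})^k`.
-/

namespace FreeGibbs

noncomputable section

/-! ### Weak derivatives on the line -/

section WeakDerivative

theorem exists_tsupport_subset_Ioo {E : Type*} [Zero E] {φ : ℝ → E} (hφ : HasCompactSupport φ) :
    ∃ a : ℝ, 0 < a ∧ tsupport φ ⊆ Set.Ioo (-a) a := by
  obtain ⟨a, ha, hsub⟩ := hφ.isCompact.isBounded.subset_ball_lt 0 0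
  exact ⟨a, ha, by simpa only [Real.ball_eq_Ioo, zero_sub, zero_add] using hsub⟩

theorem intervalIntegrable_of_locallyIntegrable {E : Type*} [NormedAddCommGroup E] {g : ℝ → E}
    (hg : LocallyIntegrable g) (a b : ℝ) : IntervalIntegrable g volume a b :=
  (hg.integrableOn_isCompact isCompact_uIcc).intervalIntegrable

theorem integral_deriv_mul_primitive {g φ : ℝ → ℝ} (hg : LocallyIntegrable g)
    (hφ : ContDiff ℝ 1 φ) (hφc : HasCompactSupport φ) :
    ∫ x, deriv φ x * ∫ y in (0 : ℝ)..x, g y = - ∫ x, φ x * g x := by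
  obtain ⟨a, ha, hsub⟩ := exists_tsupport_subset_Ioo hφc
  have integral_eq {k F : ℝ → ℝ} (hk : tsupport k ⊆ tsupport φ) :
      ∫ x, k x * F x = ∫ x in (-a)..a, k x * F x :=
    (intervalIntegral.integral_eq_integral_of_support_subset fun x hx =>
      Set.Ioo_subset_Ioc_self (hsub (hk (subset_tsupport _ (left_ne_zero_of_mul hx))))).symm
  have hφ_end {x : ℝ} (hx : x ∉ Set.Ioo (-a) a) : φ x = 0 :=
    image_eq_zero_of_notMem_tsupport fun h => hx (hsub h)
  have hG : AbsolutelyContinuousOnInterval (fun x => ∫ y in (0 : ℝ)..x, g y) (-a) a :=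
    (intervalIntegrable_of_locallyIntegrable hg _ _).absolutelyContinuousOnInterval_intervalIntegral
      (Set.mem_uIcc_of_le (by linarith) ha.le)
  have by_parts := hG.integral_mul_deriv_eq_deriv_mul
    (ContDiffOn.absolutelyContinuousOnInterval hφ.contDiffOn)
  rw [integral_eq (closure_minimal support_deriv_subset (isClosed_tsupport φ)),
    integral_eq subset_rfl]
  simp only [mul_comm (deriv φ _)]
  rw [by_parts, hφ_end (x := a) (by simp), hφ_end (x := -a) (by simp), mul_zero, mul_zero,
    sub_zero, zero_sub]
  congr 1
  refine intervalIntegral.integral_congr_ae ?_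
  filter_upwards [LocallyIntegrable.ae_hasDerivAt_integral hg] with x hx _
  rw [(hx 0).deriv, mul_comm]

theorem exists_contDiff_primitive_of_integral_eq_zero {χ : ℝ → ℝ} (hχ : ContDiff ℝ (⊤ : ℕ∞) χ)
    (hχc : HasCompactSupport χ) (hχ0 : ∫ x, χ x = 0) :
    ∃ φ : ℝ → ℝ, ContDiff ℝ (⊤ : ℕ∞) φ ∧ HasCompactSupport φ ∧ deriv φ = χ := by
  obtain ⟨a, -, hsub⟩ := exists_tsupport_subset_Ioo hχc
  have hderiv (x : ℝ) : HasDerivAt (fun x => ∫ y in (-a)..x, χ y) (χ x) x :=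
    intervalIntegral.integral_hasDerivAt_right (hχ.continuous.intervalIntegrable _ _)
      (hχ.continuous.stronglyMeasurableAtFilter _ _) hχ.continuous.continuousAt
  have hderiv_eq : deriv (fun x => ∫ y in (-a)..x, χ y) = χ := funext fun x => (hderiv x).deriv
  refine ⟨fun x => ∫ y in (-a)..x, χ y, ?_, ?_, hderiv_eq⟩
  · rw [contDiff_infty_iff_deriv, hderiv_eq]
    exact ⟨fun x => (hderiv x).differentiableAt, hχ⟩
  · refine HasCompactSupport.intro (isCompact_Icc (a := -a) (b := a)) fun x hx => ?_
    rcases lt_or_ge x (-a) with hxa | hxa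
    · refine intervalIntegral.integral_zero_ae (ae_of_all _ fun y hy => ?_)
      rw [Set.uIoc_of_ge hxa.le] at hy
      exact image_eq_zero_of_notMem_tsupport fun h => (hsub h).1.not_ge hy.2
    · have hax : a ≤ x := le_of_not_ge fun h => hx ⟨hxa, h⟩
      rw [intervalIntegral.integral_eq_integral_of_support_subset, hχ0]
      exact fun y hy => (hsub (subset_tsupport _ hy)).imp_right fun hya => hya.le.trans hax

variable {E : Type*} [NormedAddCommGroup E] [NormedSpace ℝ E] [CompleteSpace E]

theorem integral_deriv_smul_primitive {g : ℝ → E} {φ : ℝ → ℝ} (hg : LocallyIntegrable g)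
    (hφ : ContDiff ℝ 1 φ) (hφc : HasCompactSupport φ) :
    ∫ x, deriv φ x • ∫ y in (0 : ℝ)..x, g y = - ∫ x, φ x • g x := by
  have hgI := intervalIntegrable_of_locallyIntegrable hg
  have hint_left : Integrable fun x => deriv φ x • ∫ y in (0 : ℝ)..x, g y :=
    ((hφ.continuous_deriv le_rfl).smul
      (intervalIntegral.continuous_primitive hgI 0)).integrable_of_hasCompactSupport
      hφc.deriv.smul_right
  have hint_right : Integrable fun x => φ x • g x :=
    hg.integrable_smul_left_of_hasCompactSupport hφ.continuous hφc
  refine (SeparatingDual.eq_iff_forall_dual_eq (R := ℝ)).2 fun T => ?_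
  have hTg : LocallyIntegrable fun x => T (g x) := fun x =>
    (hg x).imp fun _ h => ⟨h.1, T.integrable_comp h.2⟩
  rw [map_neg, ← T.integral_comp_comm hint_left, ← T.integral_comp_comm hint_right]
  simp only [map_smul, smul_eq_mul, ← T.intervalIntegral_comp_comm (hgI 0 _)]
  exact integral_deriv_mul_primitive hTg hφ hφc

/-- The constant is `∫ ρ D` for a normalized bump `ρ`: every test function `ψ` differs from
`(∫ ψ) ρ` by the derivative of a test function. -/
theorem exists_ae_eq_const_of_integral_deriv_smul_eq_zero {D : ℝ → E} (hD : LocallyIntegrable D)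
    (h : ∀ φ : ℝ → ℝ, ContDiff ℝ (⊤ : ℕ∞) φ → HasCompactSupport φ → ∫ x, deriv φ x • D x = 0) :
    ∃ c : E, ∀ᵐ x, D x = c := by
  let ρ : ℝ → ℝ := (default : ContDiffBump (0 : ℝ)).normed volume
  have hρ : ContDiff ℝ (⊤ : ℕ∞) ρ := ContDiffBump.contDiff_normed _
  have hρc : HasCompactSupport ρ := ContDiffBump.hasCompactSupport_normed _
  have hρ1 : ∫ x, ρ x = 1 := ContDiffBump.integral_normed _
  have hint {ψ : ℝ → ℝ} (hψ : ContDiff ℝ (⊤ : ℕ∞) ψ) (hψc : HasCompactSupport ψ) :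
      Integrable ψ ∧ Integrable fun x => ψ x • D x :=
    ⟨hψ.continuous.integrable_of_hasCompactSupport hψc,
      hD.integrable_smul_left_of_hasCompactSupport hψ.continuous hψc⟩
  suffices ∀ᵐ x, D x - (∫ x, ρ x • D x) = 0 from
    ⟨∫ x, ρ x • D x, this.mono fun x hx => sub_eq_zero.1 hx⟩
  refine ae_eq_zero_of_integral_contDiff_smul_eq_zero
    (hD.sub (locallyIntegrable_const _)) fun ψ hψ hψc => ?_
  obtain ⟨φ, hφ, hφc, hφψ⟩ := exists_contDiff_primitive_of_integral_eq_zero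
    (χ := fun x => ψ x - (∫ x, ψ x) * ρ x) (hψ.sub (contDiff_const.mul hρ))
    (hψc.sub hρc.mul_left) (by
      rw [integral_sub (hint hψ hψc).1 ((hint hρ hρc).1.const_mul _), integral_const_mul, hρ1,
        mul_one, sub_self])
  have hφ0 := h φ hφ hφc
  simp only [hφψ, sub_smul, mul_smul] at hφ0
  rw [integral_sub (hint hψ hψc).2 ((hint hρ hρc).2.fun_smul (∫ x, ψ x)), integral_smul] at hφ0
  simp only [smul_sub]
  rwa [integral_sub (hint hψ hψc).2 ((hint hψ hψc).1.smul_const _), integral_smul_const]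

theorem exists_ae_eq_const_add_primitive {f g : ℝ → E} (hf : LocallyIntegrable f)
    (hg : LocallyIntegrable g)
    (h : ∀ φ : ℝ → ℝ, ContDiff ℝ (⊤ : ℕ∞) φ → HasCompactSupport φ →
      ∫ x, deriv φ x • f x = - ∫ x, φ x • g x) :
    ∃ c : E, ∀ᵐ x, f x = c + ∫ y in (0 : ℝ)..x, g y := by
  have hG := intervalIntegral.continuous_primitive (intervalIntegrable_of_locallyIntegrable hg) 0
  obtain ⟨c, hc⟩ := exists_ae_eq_const_of_integral_deriv_smul_eq_zero
    (hf.sub hG.locallyIntegrable) fun φ hφ hφc => by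
      have hφ' : Continuous (deriv φ) := hφ.continuous_deriv (by simp)
      have hint_primitive : Integrable fun x => deriv φ x • ∫ y in (0 : ℝ)..x, g y :=
        (hφ'.smul hG).integrable_of_hasCompactSupport hφc.deriv.smul_right
      simp only [Pi.sub_apply, smul_sub]
      rw [integral_sub (hf.integrable_smul_left_of_hasCompactSupport hφ' hφc.deriv)
        hint_primitive,
        integral_deriv_smul_primitive hg (hφ.of_le (by simp)) hφc, h φ hφ hφc, sub_self]
  exact ⟨c, hc.mono fun x hx => sub_eq_iff_eq_add.1 hx⟩

theorem locallyIntegrable_coeFn (f : L2R) : LocallyIntegrable f :=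
  (Lp.memLp f).locallyIntegrable (by norm_num)

theorem IsWeakDeriv.exists_ae_eq_const_add_primitive {f g : L2R} (h : IsWeakDeriv f g) :
    ∃ c : ℂ, ∀ᵐ x, f x = c + ∫ y in (0 : ℝ)..x, g y :=
  FreeGibbs.exists_ae_eq_const_add_primitive (locallyIntegrable_coeFn f)
    (locallyIntegrable_coeFn g) h

end WeakDerivative

/-! ### Piecewise constant approximation in the form domain -/

section SquareIntegrals

variable {α E : Type*} {m : MeasurableSpace α} {μ : Measure α} [NormedAddCommGroup E]

theorem integrable_norm_sq (f : Lp E 2 μ) : Integrable (fun x => ‖f x‖ ^ 2) μ :=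
  (memLp_two_iff_integrable_sq_norm (Lp.aestronglyMeasurable _)).1 (Lp.memLp f)

theorem norm_sq_eq_integral (f : Lp E 2 μ) : ‖f‖ ^ 2 = ∫ x, ‖f x‖ ^ 2 ∂μ := by
  have hint_nonneg : 0 ≤ ∫ x, ‖f x‖ ^ 2 ∂μ := integral_nonneg fun _ => sq_nonneg _
  have hnorm : ‖f‖ = √(∫ x, ‖f x‖ ^ 2 ∂μ) := by
    rw [Lp.norm_def, (Lp.memLp f).eLpNorm_eq_integral_rpow_norm (by norm_num) (by norm_num),
      ENNReal.toReal_ofReal (by positivity)]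
    simp [Real.sqrt_eq_rpow]
  rw [hnorm, Real.sq_sqrt hint_nonneg]

theorem sq_integral_le [IsFiniteMeasure μ] {h : α → ℝ} (hh : Integrable h μ)
    (hh2 : Integrable (fun x => h x ^ 2) μ) :
    (∫ x, h x ∂μ) ^ 2 ≤ μ.real Set.univ * ∫ x, h x ^ 2 ∂μ := by
  rcases eq_or_ne μ 0 with rfl | hμ
  · simp
  have : NeZero μ := ⟨hμ⟩
  have hmass : 0 < μ.real Set.univ := measureReal_univ_pos
  have jensen := (even_two.convexOn_pow (𝕜 := ℝ)).map_average_le (by fun_prop) isClosed_univ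
    (by simp) hh hh2
  simp only [average_eq, smul_eq_mul] at jensen
  field_simp at jensen
  linarith

end SquareIntegrals

section Poincare

variable {f g : L2R} {a b : ℝ}

theorem integrableOn_Ioc_coeFn (f : L2R) (a b : ℝ) : IntegrableOn f (Set.Ioc a b) :=
  ((locallyIntegrable_coeFn f).integrableOn_isCompact isCompact_Icc).mono_set
    Set.Ioc_subset_Icc_self

theorem IsWeakDeriv.norm_sub_average_le (h : IsWeakDeriv f g) (a b : ℝ) :
    ∀ᵐ x, x ∈ Set.Ioc a b →
      ‖f x - ⨍ y in Set.Ioc a b, f y‖ ≤ ∫ y in Set.Ioc a b, ‖g y‖ := by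
  obtain ⟨c, hc⟩ := h.exists_ae_eq_const_add_primitive
  have hgI := intervalIntegrable_of_locallyIntegrable (locallyIntegrable_coeFn g)
  filter_upwards [hc] with x hx hxI
  suffices (⨍ y in Set.Ioc a b, f y) ∈
      Metric.closedBall (f x) (∫ y in Set.Ioc a b, ‖g y‖) by
    rwa [mem_closedBall_iff_norm'] at this
  have hab : a < b := hxI.1.trans_le hxI.2
  refine (convex_closedBall _ _).set_average_mem Metric.isClosed_closedBall (by simpa using hab)
    (by simp) ?_ (integrableOn_Ioc_coeFn f a b)
  rw [ae_restrict_iff' measurableSet_Ioc]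
  filter_upwards [hc] with y hy hyI
  rw [mem_closedBall_iff_norm', hx, hy, add_sub_add_left_eq_sub,
    intervalIntegral.integral_interval_sub_left (hgI _ _) (hgI _ _)]
  refine intervalIntegral.norm_integral_le_integral_norm_uIoc.trans ?_
  refine setIntegral_mono_set (integrableOn_Ioc_coeFn g a b).norm
    (ae_of_all _ fun _ => norm_nonneg _) (LE.le.eventuallyLE ?_)
  exact Set.Ioc_subset_Ioc (le_min hyI.1.le hxI.1.le) (max_le hyI.2 hxI.2)

theorem IsWeakDeriv.setIntegral_norm_sub_average_sq_le (h : IsWeakDeriv f g) (hab : a ≤ b) :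
    ∫ x in Set.Ioc a b, ‖f x - ⨍ y in Set.Ioc a b, f y‖ ^ 2 ≤
      (b - a) ^ 2 * ∫ y in Set.Ioc a b, ‖g y‖ ^ 2 := by
  have hvol : volume.real (Set.Ioc a b) = b - a := Real.volume_real_Ioc_of_le hab
  have hpointwise : ∀ᵐ x, x ∈ Set.Ioc a b →
      ‖(‖f x - ⨍ y in Set.Ioc a b, f y‖ ^ 2)‖ ≤ (b - a) * ∫ y in Set.Ioc a b, ‖g y‖ ^ 2 := by
    filter_upwards [h.norm_sub_average_le a b] with x hx hxI
    rw [norm_pow, norm_norm]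
    calc ‖f x - ⨍ y in Set.Ioc a b, f y‖ ^ 2 ≤ (∫ y in Set.Ioc a b, ‖g y‖) ^ 2 := by
          gcongr; exact hx hxI
      _ ≤ (b - a) * ∫ y in Set.Ioc a b, ‖g y‖ ^ 2 := by
          simpa [hvol] using sq_integral_le (integrableOn_Ioc_coeFn g a b).norm
            (integrable_norm_sq g).integrableOn
  calc _ ≤ (b - a) * (∫ y in Set.Ioc a b, ‖g y‖ ^ 2) * volume.real (Set.Ioc a b) :=
        (Real.le_norm_self _).trans
          (norm_setIntegral_le_of_norm_le_const_ae' (by simp) hpointwise)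
    _ = _ := by rw [hvol]; ring

end Poincare

section StepApproximation

/-- The indicator function of the cell `(aⱼ, aⱼ₊₁]` as an element of `L²(ℝ)`. -/
def cellIndicator (a : ℕ → ℝ) (j : ℕ) : L2R :=
  indicatorConstLp 2 (measurableSet_Ioc (a := a j) (b := a (j + 1))) (by simp) 1

/-- The operator replacing a function by its average on each of the cells `(aⱼ, aⱼ₊₁]`, `j < M`,
and by zero outside of these cells. -/
def stepAverage (a : ℕ → ℝ) (M : ℕ) : L2R →L[ℂ] L2R :=
  ∑ j : Fin M, ((a (j + 1) - a j : ℝ) : ℂ)⁻¹ •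
    InnerProductSpace.rankOne ℂ (cellIndicator a j) (cellIndicator a j)

variable {a : ℕ → ℝ} {M : ℕ}

theorem range_stepAverage_le (a : ℕ → ℝ) (M : ℕ) :
    (stepAverage a M).range ≤ Submodule.span ℂ (Set.range fun j : Fin M => cellIndicator a j) := by
  rintro _ ⟨f, rfl⟩
  simp only [stepAverage, ContinuousLinearMap.coe_coe, sum_apply,
    smul_apply, InnerProductSpace.rankOne_apply]
  exact Submodule.sum_mem _ fun j _ => Submodule.smul_mem _ _
    (Submodule.smul_mem _ _ (Submodule.subset_span ⟨j, rfl⟩))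

instance finiteDimensional_range_stepAverage (a : ℕ → ℝ) (M : ℕ) :
    FiniteDimensional ℂ (stepAverage a M).range :=
  have := FiniteDimensional.span_of_finite ℂ
    (Set.finite_range fun j : Fin M => cellIndicator a j)
  Submodule.finiteDimensional_of_le (range_stepAverage_le a M)

theorem finrank_range_stepAverage_le (a : ℕ → ℝ) (M : ℕ) :
    Module.finrank ℂ (stepAverage a M).range ≤ M := by
  have := FiniteDimensional.span_of_finite ℂ
    (Set.finite_range fun j : Fin M => cellIndicator a j)
  calc _ ≤ _ := Submodule.finrank_mono (range_stepAverage_le a M)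
    _ ≤ Fintype.card (Fin M) := finrank_range_le_card _
    _ = M := Fintype.card_fin M

theorem coeFn_stepAverage (a : ℕ → ℝ) (M : ℕ) (f : L2R) :
    ∀ᵐ x, stepAverage a M f x = ∑ j : Fin M, (((a (j + 1) - a j : ℝ) : ℂ)⁻¹ *
      ∫ y in Set.Ioc (a j) (a (j + 1)), f y) *
        (Set.Ioc (a j) (a (j + 1))).indicator (fun _ => 1) x := by
  let c (j : Fin M) : ℂ := ((a (j + 1) - a j : ℝ) : ℂ)⁻¹ * ∫ y in Set.Ioc (a j) (a (j + 1)), f y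
  have hsum : stepAverage a M f = ∑ j : Fin M, c j • cellIndicator a j := by
    simp only [stepAverage, sum_apply, smul_apply, InnerProductSpace.rankOne_apply, smul_smul]
    simp only [c, cellIndicator, L2.inner_indicatorConstLp_one]
  have hcell (j : Fin M) : ∀ᵐ x,
      cellIndicator a j x = (Set.Ioc (a j) (a (j + 1))).indicator (fun _ => 1) x :=
    indicatorConstLp_coeFn
  have hsmul (j : Fin M) := Lp.coeFn_smul (c j) (cellIndicator a j)
  rw [hsum]
  filter_upwards [Lp.coeFn_finsetSum Finset.univ fun j => c j • cellIndicator a j,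
    ae_all_iff.2 hcell, ae_all_iff.2 hsmul] with x hx hcellx hsmulx
  simp only [hx, Finset.sum_apply, hsmulx, Pi.smul_apply, hcellx, smul_eq_mul, c]

theorem stepAverage_ae_eq_average (ha : Monotone a) {j : ℕ} (hj : j < M) (f : L2R) :
    ∀ᵐ x, x ∈ Set.Ioc (a j) (a (j + 1)) →
      stepAverage a M f x = ⨍ y in Set.Ioc (a j) (a (j + 1)), f y := by
  filter_upwards [coeFn_stepAverage a M f] with x hx hxj
  rw [hx, Finset.sum_eq_single ⟨j, hj⟩ (fun i _ hij => ?_) (by simp), setAverage_eq,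
    Real.volume_real_Ioc_of_le (ha j.le_succ), Set.indicator_of_mem hxj, mul_one,
    Complex.real_smul, Complex.ofReal_inv]
  have hdisj : Disjoint (Set.Ioc (a i) (a (i + 1))) (Set.Ioc (a j) (a (j + 1))) :=
    ha.pairwise_disjoint_on_Ioc_succ fun h => hij (Fin.ext h)
  rw [Set.indicator_of_notMem fun hxi => Set.disjoint_left.1 hdisj hxi hxj, mul_zero]

theorem stepAverage_ae_eq_zero (ha : Monotone a) (f : L2R) :
    ∀ᵐ x, x ∉ Set.Ioc (a 0) (a M) → stepAverage a M f x = 0 := by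
  filter_upwards [coeFn_stepAverage a M f] with x hx hx_out
  refine hx.trans (Finset.sum_eq_zero fun j _ => ?_)
  rw [Set.indicator_of_notMem fun hxj =>
    hx_out ⟨(ha (Nat.zero_le _)).trans_lt hxj.1, hxj.2.trans (ha j.2)⟩, mul_zero]

theorem setIntegral_Ioc_eq_sum_cells (ha : Monotone a) (M : ℕ) {h : ℝ → ℝ} (hh : Integrable h) :
    ∫ x in Set.Ioc (a 0) (a M), h x =
      ∑ j ∈ Finset.range M, ∫ x in Set.Ioc (a j) (a (j + 1)), h x := by
  rw [← intervalIntegral.integral_of_le (ha M.zero_le),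
    ← intervalIntegral.sum_integral_adjacent_intervals fun _ _ => hh.intervalIntegrable]
  exact Finset.sum_congr rfl fun j _ => intervalIntegral.integral_of_le (ha j.le_succ)

theorem IsWeakDeriv.setIntegral_norm_sub_stepAverage_sq_le {f f' : L2R} (hf : IsWeakDeriv f f')
    (ha : Monotone a) {l : ℝ} (hl : ∀ j < M, a (j + 1) - a j ≤ l) :
    ∫ x in Set.Ioc (a 0) (a M), ‖(f - stepAverage a M f) x‖ ^ 2 ≤ l ^ 2 * ‖f'‖ ^ 2 := by
  have hcell (j : ℕ) (hj : j < M) :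
      ∫ x in Set.Ioc (a j) (a (j + 1)), ‖(f - stepAverage a M f) x‖ ^ 2 ≤
        l ^ 2 * ∫ x in Set.Ioc (a j) (a (j + 1)), ‖f' x‖ ^ 2 := by
    have hlength : 0 ≤ a (j + 1) - a j := sub_nonneg.2 (ha j.le_succ)
    calc _ = ∫ x in Set.Ioc (a j) (a (j + 1)),
            ‖f x - ⨍ y in Set.Ioc (a j) (a (j + 1)), f y‖ ^ 2 := by
          refine setIntegral_congr_ae measurableSet_Ioc ?_
          filter_upwards [Lp.coeFn_sub f (stepAverage a M f), stepAverage_ae_eq_average ha hj f]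
            with x hsub hav hxj
          rw [hsub, Pi.sub_apply, hav hxj]
      _ ≤ _ := hf.setIntegral_norm_sub_average_sq_le (ha j.le_succ)
      _ ≤ _ := by gcongr; exact hl j hj
  calc _ = ∑ j ∈ Finset.range M,
          ∫ x in Set.Ioc (a j) (a (j + 1)), ‖(f - stepAverage a M f) x‖ ^ 2 :=
        setIntegral_Ioc_eq_sum_cells ha M (integrable_norm_sq _)
    _ ≤ ∑ j ∈ Finset.range M, l ^ 2 * ∫ x in Set.Ioc (a j) (a (j + 1)), ‖f' x‖ ^ 2 :=
        Finset.sum_le_sum fun j hj => hcell j (Finset.mem_range.1 hj)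
    _ = l ^ 2 * ∫ x in Set.Ioc (a 0) (a M), ‖f' x‖ ^ 2 := by
        rw [← Finset.mul_sum, setIntegral_Ioc_eq_sum_cells ha M (integrable_norm_sq f')]
    _ ≤ l ^ 2 * ‖f'‖ ^ 2 := by
        rw [norm_sq_eq_integral]
        exact mul_le_mul_of_nonneg_left (setIntegral_le_integral (integrable_norm_sq f')
          (ae_of_all _ fun _ => sq_nonneg _)) (sq_nonneg l)

/-- The value `‖f'‖² + ∫ V |f|²` at `f` of the quadratic form of `-∂ₓ² + V`, where `f'` is the
derivative of `f`. -/
def energy (V : ℝ → ℝ) (f f' : L2R) : ℝ :=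
  ‖f'‖ ^ 2 + ∫ x, V x * ‖f x‖ ^ 2

theorem InFormDomain.norm_sub_stepAverage_sq_le {V : ℝ → ℝ} {f f' : L2R}
    (hf : InFormDomain V f f') (ha : Monotone a) {l ε : ℝ} (hl : ∀ j < M, a (j + 1) - a j ≤ l)
    (hlε : l ^ 2 ≤ ε) (hV0 : ∀ᵐ x, 0 ≤ V x)
    (hV : ∀ᵐ x, x ∉ Set.Ioc (a 0) (a M) → 1 ≤ ε * V x) :
    ‖f - stepAverage a M f‖ ^ 2 ≤ ε * energy V f f' := by
  have hε : 0 ≤ ε := (sq_nonneg _).trans hlε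
  have hint := integrable_norm_sq (f - stepAverage a M f)
  have hinside := hf.1.setIntegral_norm_sub_stepAverage_sq_le ha hl
  have houtside : ∫ x in (Set.Ioc (a 0) (a M))ᶜ, ‖(f - stepAverage a M f) x‖ ^ 2 ≤
      ∫ x in (Set.Ioc (a 0) (a M))ᶜ, ε * (V x * ‖f x‖ ^ 2) := by
    refine setIntegral_mono_on_ae hint.integrableOn (hf.2.const_mul ε).integrableOn
      measurableSet_Ioc.compl ?_
    filter_upwards [Lp.coeFn_sub f (stepAverage a M f), stepAverage_ae_eq_zero ha f, hV]
      with x hsub hzero hVx hx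
    rw [hsub, Pi.sub_apply, hzero hx, sub_zero, ← mul_assoc]
    exact le_mul_of_one_le_left (sq_nonneg _) (hVx hx)
  have hpot : ∫ x in (Set.Ioc (a 0) (a M))ᶜ, ε * (V x * ‖f x‖ ^ 2) ≤
      ε * ∫ x, V x * ‖f x‖ ^ 2 := by
    rw [integral_const_mul]
    exact mul_le_mul_of_nonneg_left (setIntegral_le_integral hf.2
      (hV0.mono fun x hx => mul_nonneg hx (sq_nonneg _))) hε
  calc _ = (∫ x in Set.Ioc (a 0) (a M), ‖(f - stepAverage a M f) x‖ ^ 2) +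
          ∫ x in (Set.Ioc (a 0) (a M))ᶜ, ‖(f - stepAverage a M f) x‖ ^ 2 := by
        rw [norm_sq_eq_integral, integral_add_compl measurableSet_Ioc hint]
    _ ≤ ε * ‖f'‖ ^ 2 + ε * ∫ x, V x * ‖f x‖ ^ 2 := by
        gcongr
        · exact hinside.trans (by gcongr)
        · exact houtside.trans hpot
    _ = _ := by rw [energy, mul_add]

theorem exists_finiteRank_approx {V : ℝ → ℝ} {L ε : ℝ} {M : ℕ} (hL : 0 ≤ L) (hM : 0 < M)
    (hLM : (2 * L / M) ^ 2 ≤ ε) (hV0 : ∀ᵐ x, 0 ≤ V x) (hV : ∀ᵐ x, L ≤ |x| → 1 ≤ ε * V x) :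
    ∃ P : L2R →L[ℂ] L2R, FiniteDimensional ℂ P.range ∧ Module.finrank ℂ P.range ≤ M ∧
      ∀ f f', InFormDomain V f f' → ‖f - P f‖ ^ 2 ≤ ε * energy V f f' := by
  let a : ℕ → ℝ := fun j => -L + j * (2 * L / M)
  have ha : Monotone a := fun i j hij => by simp only [a]; gcongr
  have hstep (j : ℕ) : a (j + 1) - a j = 2 * L / M := by simp only [a]; push_cast; ring
  have ha0 : a 0 = -L := by simp [a]
  have haM : a M = L := by simp only [a]; field_simp; ring
  refine ⟨stepAverage a M, inferInstance, finrank_range_stepAverage_le a M, fun f f' hf =>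
    hf.norm_sub_stepAverage_sq_le ha (fun j _ => (hstep j).le) hLM hV0 ?_⟩
  filter_upwards [hV] with x hVx hx
  rw [ha0, haM] at hx
  refine hVx (le_of_not_gt fun hxL => hx ?_)
  rw [abs_lt] at hxL
  exact ⟨hxL.1, hxL.2.le⟩

end StepApproximation

/-! ### Positivity and counting of the eigenvalues -/

section Eigenvalues

variable {V : ℝ → ℝ}

theorem SchrodingerGraph.exists_energy_eq_inner {f g : L2R} (h : SchrodingerGraph V f g) :
    ∃ f' : L2R, InFormDomain V f f' ∧ (energy V f f' : ℂ) = ⟪f, g⟫_ℂ := by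
  obtain ⟨f', hf, hweak⟩ := h
  refine ⟨f', hf, ?_⟩
  rw [← hweak f f' hf, energy, Complex.ofReal_add, ← integral_complex_ofReal,
    inner_self_eq_norm_sq_to_K]
  simp only [Complex.ofReal_mul, Complex.ofReal_pow, Complex.conj_mul', Complex.coe_algebraMap]

theorem InFormDomain.energy_pos {f f' : L2R} (hf : InFormDomain V f f') (hV : ∀ᵐ x, 0 < V x)
    (hf0 : f ≠ 0) : 0 < energy V f f' := by
  have hnonneg : 0 ≤ᵐ[volume] fun x => V x * ‖f x‖ ^ 2 :=
    hV.mono fun x hx => mul_nonneg hx.le (sq_nonneg _)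
  refine add_pos_of_nonneg_of_pos (sq_nonneg _)
    ((integral_nonneg_of_ae hnonneg).lt_of_ne' fun hzero => hf0 ?_)
  rw [integral_eq_zero_iff_of_nonneg_ae hnonneg hf.2] at hzero
  rw [Lp.eq_zero_iff_ae_eq_zero]
  filter_upwards [hzero, hV] with x hx hVx
  simpa [hVx.ne'] using hx

variable {u : HilbertBasis ℕ ℂ L2R} {lam : ℕ → ℝ}

theorem IsSpectralDecomposition.schrodingerGraph_sum (h : IsSpectralDecomposition V u lam)
    (F : Finset ℕ) (c : ℕ → ℂ) :
    SchrodingerGraph V (∑ n ∈ F, c n • u n) (∑ n ∈ F, (c n * lam n) • u n) := by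
  rw [h]
  intro m
  simp only [inner_sum, inner_smul_right, orthonormal_iff_ite.1 u.orthonormal, mul_ite, mul_one,
    mul_zero, Finset.sum_ite_eq]
  split_ifs <;> ring

theorem IsSpectralDecomposition.exists_energy_sum_eq (h : IsSpectralDecomposition V u lam)
    (F : Finset ℕ) (c : ℕ → ℂ) :
    ∃ f' : L2R, InFormDomain V (∑ n ∈ F, c n • u n) f' ∧
      energy V (∑ n ∈ F, c n • u n) f' = ∑ n ∈ F, lam n * ‖c n‖ ^ 2 := by
  obtain ⟨f', hf, henergy⟩ := (h.schrodingerGraph_sum F c).exists_energy_eq_inner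
  refine ⟨f', hf, Complex.ofReal_injective ?_⟩
  rw [henergy, u.orthonormal.inner_sum, Complex.ofReal_sum]
  refine Finset.sum_congr rfl fun n _ => ?_
  rw [← mul_assoc, Complex.conj_mul', Complex.ofReal_mul, Complex.ofReal_pow, mul_comm]

theorem IsSpectralDecomposition.lam_pos (h : IsSpectralDecomposition V u lam)
    (hV : ∀ᵐ x, 0 < V x) (n : ℕ) : 0 < lam n := by
  obtain ⟨f', hf, henergy⟩ := h.exists_energy_sum_eq {n} fun _ => 1
  simp only [Finset.sum_singleton, one_smul, norm_one, one_pow, mul_one] at henergy hf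
  exact henergy ▸ hf.energy_pos hV (u.orthonormal.ne_zero n)

theorem norm_sq_sum_smul_of_orthonormal {ι 𝕜 E : Type*} [RCLike 𝕜] [NormedAddCommGroup E]
    [InnerProductSpace 𝕜 E] {e : ι → E} (he : Orthonormal 𝕜 e) (c : ι → 𝕜) (F : Finset ι) :
    ‖∑ i ∈ F, c i • e i‖ ^ 2 = ∑ i ∈ F, ‖c i‖ ^ 2 := by
  simpa using he.orthogonalFamily.norm_sum c F

theorem finrank_le_of_norm_sub_lt {𝕜 E : Type*} [DivisionRing 𝕜] [NormedAddCommGroup E]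
    [Module 𝕜 E] (P : E →ₗ[𝕜] E) [FiniteDimensional 𝕜 P.range] {S : Submodule 𝕜 E}
    (h : ∀ f ∈ S, f ≠ 0 → ‖f - P f‖ < ‖f‖) :
    Module.finrank 𝕜 S ≤ Module.finrank 𝕜 P.range := by
  refine LinearMap.finrank_le_finrank_of_injective (f := P.rangeRestrict.domRestrict S) ?_
  rw [← LinearMap.ker_eq_bot, LinearMap.ker_eq_bot']
  refine fun f hf => by_contra fun hf0 => ?_
  have hPf : P f = 0 := congrArg Subtype.val hf
  simpa [hPf] using h f f.2 (by simpa using hf0)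

theorem IsSpectralDecomposition.card_le_finrank_range (h : IsSpectralDecomposition V u lam)
    {P : L2R →L[ℂ] L2R} [FiniteDimensional ℂ P.range] {ε E : ℝ}
    (hP : ∀ f f', InFormDomain V f f' → ‖f - P f‖ ^ 2 ≤ ε * energy V f f') (hε : 0 ≤ ε)
    (hεE : ε * E < 1) {F : Finset ℕ} (hF : ∀ n ∈ F, lam n ≤ E) :
    F.card ≤ Module.finrank ℂ P.range := by
  have hcard : Module.finrank ℂ (Submodule.span ℂ (u '' F)) = F.card := by
    have hli : LinearIndependent ℂ fun n : F => u n :=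
      u.orthonormal.linearIndependent.comp _ Subtype.val_injective
    rw [Set.image_eq_range]
    exact (finrank_span_eq_card hli).trans (Fintype.card_coe F)
  rw [← hcard]
  refine finrank_le_of_norm_sub_lt (P : L2R →ₗ[ℂ] L2R) fun f hfS hf0 => ?_
  obtain ⟨c, rfl⟩ := (Submodule.mem_span_image_finset_iff_exists_fun' ℂ).1 hfS
  obtain ⟨f', hf, henergy⟩ := h.exists_energy_sum_eq F c
  have hnorm := norm_sq_sum_smul_of_orthonormal u.orthonormal c F
  refine lt_of_pow_lt_pow_left₀ 2 (norm_nonneg _) ?_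
  calc _ ≤ ε * ∑ n ∈ F, lam n * ‖c n‖ ^ 2 := henergy ▸ hP _ _ hf
    _ ≤ ε * ∑ n ∈ F, E * ‖c n‖ ^ 2 := by gcongr with n hn; exact hF n hn
    _ = ε * E * ‖∑ n ∈ F, c n • u n‖ ^ 2 := by rw [← Finset.mul_sum, hnorm, mul_assoc]
    _ < _ := mul_lt_of_lt_one_left (pow_pos (norm_pos_iff.2 hf0) 2) hεE

theorem IsSpectralDecomposition.exists_card_le (h : IsSpectralDecomposition V u lam) {s C : ℝ}
    (hs : 0 < s) (hC : 0 < C) (hV : ∀ᵐ x : ℝ, C⁻¹ * |x| ^ s ≤ V x) :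
    ∃ A : ℝ, ∀ E : ℝ, 0 < E → ∀ F : Finset ℕ, (∀ n ∈ F, lam n ≤ E) →
      (F.card : ℝ) ≤ 1 + A * E ^ (1 / s + 1 / 2) := by
  refine ⟨2 * (2 * C) ^ (1 / s) * 2 ^ (1 / 2 : ℝ), fun E hE F hF => ?_⟩
  -- `V ≥ 2E` outside of `[-L, L]`, and cells of length `2L / M ≤ (2E)^{-1/2}` suffice inside.
  let L := (2 * C * E) ^ (1 / s)
  let M := ⌈2 * L * √(2 * E)⌉₊
  have hL : 0 < L := by positivity
  have hLM : (2 * L / M) ^ 2 ≤ (2 * E)⁻¹ := by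
    calc (2 * L / M) ^ 2 ≤ (2 * L / (2 * L * √(2 * E))) ^ 2 := by gcongr; exact Nat.le_ceil _
      _ = (√(2 * E) ^ 2)⁻¹ := by field_simp
      _ = (2 * E)⁻¹ := by rw [Real.sq_sqrt (by positivity)]
  have hV_out : ∀ᵐ x : ℝ, L ≤ |x| → 1 ≤ (2 * E)⁻¹ * V x := by
    filter_upwards [hV] with x hx hxL
    calc 1 = (2 * E)⁻¹ * (C⁻¹ * L ^ s) := by
          rw [← Real.rpow_mul (by positivity), one_div_mul_cancel hs.ne', Real.rpow_one]
          field_simp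
      _ ≤ (2 * E)⁻¹ * (C⁻¹ * |x| ^ s) := by gcongr
      _ ≤ (2 * E)⁻¹ * V x := by gcongr
  obtain ⟨P, hPfin, hPrank, hP⟩ := exists_finiteRank_approx hL.le (Nat.ceil_pos.2 (by positivity))
    hLM (hV.mono fun x hx => le_trans (by positivity) hx) hV_out
  have hcard := h.card_le_finrank_range hP (by positivity) (E := E)
    (by rw [mul_inv, mul_assoc, inv_mul_cancel₀ hE.ne']; norm_num) hF
  calc (F.card : ℝ) ≤ M := by exact_mod_cast hcard.trans hPrank
    _ ≤ 2 * L * √(2 * E) + 1 := (Nat.ceil_lt_add_one (by positivity)).le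
    _ = _ := by
      simp only [L]
      rw [Real.sqrt_eq_rpow, Real.mul_rpow (by positivity) hE.le,
        Real.mul_rpow (by positivity) hE.le, Real.rpow_add hE]
      ring

end Eigenvalues

section Summability

variable {ι : Type*}

theorem summable_comp_of_card_fiber_le {J : ι → ℕ} {x N : ℕ → ℝ} (hx : ∀ j, 0 ≤ x j)
    (hcard : ∀ (j : ℕ) (F : Finset ι), (∀ i ∈ F, J i = j) → (F.card : ℝ) ≤ N j)
    (hsum : Summable fun j => N j * x j) : Summable fun i => x (J i) := by
  have hN (j : ℕ) : 0 ≤ N j := by simpa using hcard j ∅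
  refine summable_of_sum_le (c := ∑' j, N j * x j) (fun i => hx _) fun F => ?_
  calc ∑ i ∈ F, x (J i) = ∑ j ∈ F.image J, ∑ i ∈ F with J i = j, x (J i) :=
        (Finset.sum_fiberwise_of_maps_to (fun i hi => Finset.mem_image_of_mem J hi) _).symm
    _ = ∑ j ∈ F.image J, (({i ∈ F | J i = j} : Finset ι).card : ℝ) * x j := by
        refine Finset.sum_congr rfl fun j _ => ?_
        rw [Finset.sum_congr rfl fun i hi => congrArg x (Finset.mem_filter.1 hi).2,
          Finset.sum_const, nsmul_eq_mul]
    _ ≤ ∑ j ∈ F.image J, N j * x j := by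
        gcongr with j
        · exact hx j
        · exact hcard j _ fun i hi => (Finset.mem_filter.1 hi).2
    _ ≤ ∑' j, N j * x j := hsum.sum_le_tsum _ fun j _ => mul_nonneg (hN j) (hx j)

theorem exists_pow_two_near (x : ℝ) : ∃ j : ℕ, x ≤ 2 ^ j ∧ (1 < x → (2 : ℝ) ^ j ≤ 2 * x) := by
  rcases le_or_gt x 1 with hx | hx
  · exact ⟨0, by simpa using hx, fun h => absurd h hx.not_gt⟩
  · obtain ⟨j, hle, hlt⟩ := exists_nat_pow_near hx.le one_lt_two
    exact ⟨j + 1, hlt.le, fun _ => by rw [pow_succ']; gcongr⟩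

theorem summable_rpow_neg_of_card_le {lam : ι → ℝ} {A a p : ℝ} (ha : 0 ≤ a) (hap : a < p)
    (hlam : ∀ i, 0 < lam i)
    (hcard : ∀ E : ℝ, 0 < E → ∀ F : Finset ι, (∀ i ∈ F, lam i ≤ E) →
      (F.card : ℝ) ≤ 1 + A * E ^ a) :
    Summable fun i => lam i ^ (-p) := by
  have hp : 0 < p := ha.trans_lt hap
  have hfinite : {i | lam i ≤ 1}.Finite := by
    by_contra hinf
    obtain ⟨F, hF, hFcard⟩ := Set.Infinite.exists_subset_card_eq hinf (⌈1 + A⌉₊ + 1)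
    have hle := hcard 1 one_pos F fun i hi => hF hi
    rw [hFcard, Real.one_rpow, mul_one, Nat.cast_add_one] at hle
    linarith [Nat.le_ceil (1 + A)]
  choose J hle_pow hpow_le using fun i => exists_pow_two_near (lam i)
  have hdyadic : Summable fun i => ((2 : ℝ) ^ (-p)) ^ J i := by
    refine summable_comp_of_card_fiber_le (N := fun j => 1 + A * (2 ^ j) ^ a)
      (fun j => by positivity) (fun j F hF => hcard (2 ^ j) (by positivity) F
        fun i hi => (hle_pow i).trans (by rw [hF i hi])) ?_
    have hterm (j : ℕ) : (1 + A * ((2 : ℝ) ^ j) ^ a) * (2 ^ (-p)) ^ j =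
        (2 ^ (-p)) ^ j + A * (2 ^ (a - p)) ^ j := by
      rw [← Real.rpow_pow_comm two_pos.le, sub_eq_add_neg, Real.rpow_add two_pos, mul_pow]
      ring
    simp only [hterm]
    have hgeom {q : ℝ} (hq : q < 0) : Summable fun j : ℕ => ((2 : ℝ) ^ q) ^ j :=
      summable_geometric_of_lt_one (by positivity)
        (Real.rpow_lt_one_of_one_lt_of_neg one_lt_two hq)
    exact (hgeom (neg_neg_of_pos hp)).add ((hgeom (sub_neg.2 hap)).mul_left A)
  refine (hdyadic.mul_left (2 ^ p)).of_norm_bounded_eventually ?_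
  filter_upwards [hfinite.compl_mem_cofinite] with i hi
  rw [Real.norm_of_nonneg (by have := hlam i; positivity)]
  calc lam i ^ (-p) = 2 ^ p * (2 * lam i) ^ (-p) := by
        rw [Real.mul_rpow two_pos.le (hlam i).le, ← mul_assoc, ← Real.rpow_add two_pos,
          add_neg_cancel, Real.rpow_zero, one_mul]
    _ ≤ 2 ^ p * (2 ^ J i) ^ (-p) := by
        gcongr ?_ * ?_
        exact Real.rpow_le_rpow_of_nonpos (by positivity) (hpow_le i (not_le.1 hi)) (by linarith)
    _ = 2 ^ p * (2 ^ (-p)) ^ J i := by rw [Real.rpow_pow_comm two_pos.le]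

end Summability

/-! ### Eigenbases of compact self-adjoint operators -/

section HilbertBasis

variable {E ι : Type*} [NormedAddCommGroup E] [InnerProductSpace ℂ E]

theorem countable_of_orthonormal [TopologicalSpace.SeparableSpace E] {v : ι → E}
    (hv : Orthonormal ℂ v) : Countable ι := by
  refine Pairwise.countable_of_isOpen_disjoint (s := fun i => Metric.ball (v i) (1 / 2))
    (fun i j hij => Metric.ball_disjoint_ball ?_)
    (fun i => Metric.isOpen_ball) (fun i => ⟨v i, Metric.mem_ball_self (by norm_num)⟩)
  have hsq : ‖v i - v j‖ ^ 2 = 2 := by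
    rw [@norm_sub_sq ℂ, hv.1, hv.1, hv.2 hij]
    norm_num
  rw [dist_eq_norm]
  nlinarith [norm_nonneg (v i - v j)]

theorem nonempty_equiv_nat_of_hilbertBasis [TopologicalSpace.SeparableSpace E]
    (hE : ¬ FiniteDimensional ℂ E) (b : HilbertBasis ι ℂ E) : Nonempty (ℕ ≃ ι) := by
  have := countable_of_orthonormal b.orthonormal
  have : Infinite ι := not_finite_iff_infinite.1 fun hfin => by
    have := Fintype.ofFinite ι
    exact hE b.toOrthonormalBasis.toBasis.finiteDimensional_of_finite
  exact ⟨(nonempty_denumerable ι).some.eqv.symm⟩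

theorem orthogonal_span_range_le_orthogonal {K : Submodule ℂ E} (b : HilbertBasis ι ℂ K) :
    (Submodule.span ℂ (Set.range fun i => (b i : E)))ᗮ ≤ Kᗮ := by
  intro x hx
  have hzero : (innerSL ℂ x).comp K.subtypeL = 0 :=
    ContinuousLinearMap.ext_on (Submodule.dense_iff_topologicalClosure_eq_top.2 b.dense_span) <| by
      rintro _ ⟨i, rfl⟩
      exact inner_eq_zero_symm.1
        ((Submodule.mem_orthogonal _ _).1 hx _ (Submodule.subset_span ⟨i, rfl⟩))
  exact (Submodule.mem_orthogonal' _ _).2 fun y hy => DFunLike.congr_fun hzero ⟨y, hy⟩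

theorem isCompactOperator_of_finiteDimensional_range {P : E →L[ℂ] E}
    (hP : FiniteDimensional ℂ P.range) : IsCompactOperator P := by
  have := FiniteDimensional.proper ℂ P.range
  have hrestrict : IsCompactOperator P.rangeRestrict :=
    isCompactOperator_of_locallyCompactSpace_dom P.rangeRestrict
  exact hrestrict.clm_comp P.range.subtypeL

variable [CompleteSpace E] {T : E →L[ℂ] E}

theorem exists_hilbertBasis_eigenspaces (hT : IsCompactOperator T) (hsymm : T.IsSymmetric) :
    ∃ (w : (μ : ℂ) → Set (Module.End.eigenspace (T : Module.End ℂ E) μ))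
      (b : HilbertBasis (Σ μ, w μ) ℂ E), ∀ i, T (b i) = i.1 • b i := by
  let G (μ : ℂ) : Submodule ℂ E := Module.End.eigenspace (T : Module.End ℂ E) μ
  have hcomplete (μ : ℂ) : CompleteSpace (G μ) := by
    have hG : (G μ : Set E) = {x | T x = μ • x} := by
      ext x
      exact Module.End.mem_eigenspace_iff
    have hclosed : IsClosed (G μ : Set E) :=
      hG ▸ isClosed_eq T.continuous (continuous_const_smul μ)
    exact hclosed.completeSpace_coe
  choose w b _ using fun μ => exists_hilbertBasis ℂ (G μ)
  let v (i : Σ μ, w μ) : E := b i.1 i.2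
  have hv : Orthonormal ℂ v :=
    hsymm.orthogonalFamily_eigenspaces.orthonormal_sigma_orthonormal fun μ => (b μ).orthonormal
  have hbot : (Submodule.span ℂ (Set.range v))ᗮ = ⊥ := by
    rw [eq_bot_iff, ← T.orthogonalComplement_iSup_eigenspaces_eq_bot hT hsymm,
      ← Submodule.iInf_orthogonal]
    refine le_iInf fun μ => le_trans (Submodule.orthogonal_le (Submodule.span_mono ?_))
      (orthogonal_span_range_le_orthogonal (b μ))
    rintro _ ⟨i, rfl⟩
    exact ⟨⟨μ, i⟩, rfl⟩
  refine ⟨w, HilbertBasis.mkOfOrthogonalEqBot hv hbot, fun i => ?_⟩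
  rw [HilbertBasis.coe_mkOfOrthogonalEqBot]
  exact Module.End.mem_eigenspace_iff.1 (b i.1 i.2).2

theorem exists_eigenbasis_nat [TopologicalSpace.SeparableSpace E] (hE : ¬ FiniteDimensional ℂ E)
    (hT : IsCompactOperator T) (hsymm : T.IsSymmetric) :
    ∃ (b : HilbertBasis ℕ ℂ E) (κ : ℕ → ℂ), ∀ n, T (b n) = κ n • b n := by
  obtain ⟨w, b, hb⟩ := exists_hilbertBasis_eigenspaces hT hsymm
  obtain ⟨e⟩ := nonempty_equiv_nat_of_hilbertBasis hE b
  have hbot : (Submodule.span ℂ (Set.range (b ∘ e)))ᗮ = ⊥ := by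
    rw [e.surjective.range_comp, ← Submodule.topologicalClosure_eq_top_iff]
    exact b.dense_span
  refine ⟨HilbertBasis.mkOfOrthogonalEqBot (b.orthonormal.comp e e.injective) hbot,
    fun n => (e n).1, fun n => ?_⟩
  rw [HilbertBasis.coe_mkOfOrthogonalEqBot]
  exact hb (e n)

end HilbertBasis

theorem inner_cellIndicator_of_ne {a : ℕ → ℝ} (ha : Monotone a) {i j : ℕ} (hij : i ≠ j) :
    ⟪cellIndicator a i, cellIndicator a j⟫_ℂ = 0 := by
  have hcell : ∀ᵐ x, cellIndicator a j x = (Set.Ioc (a j) (a (j + 1))).indicator (fun _ => 1) x :=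
    indicatorConstLp_coeFn
  have hdisj : Disjoint (Set.Ioc (a i) (a (i + 1))) (Set.Ioc (a j) (a (j + 1))) :=
    ha.pairwise_disjoint_on_Ioc_succ hij
  rw [cellIndicator, L2.inner_indicatorConstLp_one, integral_congr_ae (ae_restrict_of_ae hcell),
    setIntegral_indicator measurableSet_Ioc, hdisj.inter_eq, setIntegral_empty]

theorem not_finiteDimensional_L2R : ¬ FiniteDimensional ℂ L2R := by
  intro hfin
  let v : ℕ → L2R := cellIndicator fun n => (n : ℝ)
  have hv : Orthonormal ℂ v := by
    refine ⟨fun n => ?_, fun i j hij => inner_cellIndicator_of_ne Nat.mono_cast hij⟩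
    simp [v, cellIndicator, norm_indicatorConstLp]
  exact not_finite_iff_infinite.2 inferInstance hv.linearIndependent.finite

/-! ### The form domain as a Hilbert space -/

theorem memLp_ofReal_of_hasCompactSupport {φ : ℝ → ℝ} (hφ : Continuous φ)
    (hφc : HasCompactSupport φ) : MemLp (fun x => (φ x : ℂ)) 2 :=
  (Complex.continuous_ofReal.comp hφ).memLp_of_hasCompactSupport
    (hφc.comp_left Complex.ofReal_zero)

/-- A continuous compactly supported real function as an element of `L²(ℝ; ℂ)`. -/
def ccToL2 (φ : ℝ → ℝ) (hφ : Continuous φ) (hφc : HasCompactSupport φ) : L2R :=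
  (memLp_ofReal_of_hasCompactSupport hφ hφc).toLp

section TestFunctions

variable {φ : ℝ → ℝ}

theorem coeFn_ccToL2 (hφ : Continuous φ) (hφc : HasCompactSupport φ) :
    ∀ᵐ x, ccToL2 φ hφ hφc x = φ x :=
  (memLp_ofReal_of_hasCompactSupport hφ hφc).coeFn_toLp

theorem inner_ccToL2 (hφ : Continuous φ) (hφc : HasCompactSupport φ) (f : L2R) :
    ⟪ccToL2 φ hφ hφc, f⟫_ℂ = ∫ x, φ x • f x := by
  rw [L2.inner_def]
  refine integral_congr_ae ?_
  filter_upwards [coeFn_ccToL2 hφ hφc] with x hx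
  rw [hx, RCLike.inner_apply, Complex.conj_ofReal, Complex.real_smul, mul_comm]

theorem isWeakDeriv_iff_inner {f g : L2R} : IsWeakDeriv f g ↔
    ∀ (φ : ℝ → ℝ) (hφ : ContDiff ℝ (⊤ : ℕ∞) φ) (hφc : HasCompactSupport φ),
      ⟪ccToL2 (deriv φ) (hφ.continuous_deriv (by simp)) hφc.deriv, f⟫_ℂ +
        ⟪ccToL2 φ hφ.continuous hφc, g⟫_ℂ = 0 := by
  simp only [inner_ccToL2]
  exact forall₃_congr fun _ _ _ => eq_neg_iff_add_eq_zero

theorem isWeakDeriv_ccToL2 (hφ : ContDiff ℝ 1 φ) (hφc : HasCompactSupport φ) :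
    IsWeakDeriv (ccToL2 φ hφ.continuous hφc)
      (ccToL2 (deriv φ) (hφ.continuous_deriv le_rfl) hφc.deriv) := by
  intro ψ hψ hψc
  have hφ' : Continuous (deriv φ) := hφ.continuous_deriv le_rfl
  have hψ' : Continuous (deriv ψ) := hψ.continuous_deriv (by simp)
  have hparts : ∫ x, ψ x * deriv φ x = - ∫ x, deriv ψ x * φ x :=
    integral_mul_deriv_eq_deriv_mul_of_integrable
      (fun x _ => ((hψ.differentiable (by simp)) x).hasDerivAt)
      (fun x _ => ((hφ.differentiable (by simp)) x).hasDerivAt)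
      ((hψ.continuous.mul hφ').integrable_of_hasCompactSupport hψc.mul_right)
      ((hψ'.mul hφ.continuous).integrable_of_hasCompactSupport hφc.mul_left)
      ((hψ.continuous.mul hφ.continuous).integrable_of_hasCompactSupport hψc.mul_right)
  have hcast {η χ : ℝ → ℝ} (hχ : Continuous χ) (hχc : HasCompactSupport χ) :
      ∫ x, η x • ccToL2 χ hχ hχc x = ((∫ x, η x * χ x : ℝ) : ℂ) := by
    rw [← integral_complex_ofReal]
    refine integral_congr_ae ?_
    filter_upwards [coeFn_ccToL2 hχ hχc] with x hx
    rw [hx, Complex.real_smul, Complex.ofReal_mul]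
  rw [hcast, hcast, hparts, Complex.ofReal_neg, neg_neg]

theorem inFormDomain_ccToL2 {V : ℝ → ℝ} (hV : LocallyIntegrable V) (hφ : ContDiff ℝ 1 φ)
    (hφc : HasCompactSupport φ) :
    InFormDomain V (ccToL2 φ hφ.continuous hφc)
      (ccToL2 (deriv φ) (hφ.continuous_deriv le_rfl) hφc.deriv) := by
  refine ⟨isWeakDeriv_ccToL2 hφ hφc, ?_⟩
  have hint : Integrable fun x => φ x ^ 2 • V x :=
    hV.integrable_smul_left_of_hasCompactSupport (hφ.continuous.pow 2)
      (hφc.comp_left (g := fun x : ℝ => x ^ 2) (by simp))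
  refine hint.congr ?_
  filter_upwards [coeFn_ccToL2 hφ.continuous hφc] with x hx
  rw [hx, Complex.norm_real, Real.norm_eq_abs, sq_abs, smul_eq_mul, mul_comm]

end TestFunctions

section WeakDerivative

variable {f g f' g' : L2R}

theorem isWeakDeriv_zero : IsWeakDeriv 0 0 := by
  simp [isWeakDeriv_iff_inner]

theorem IsWeakDeriv.add (hf : IsWeakDeriv f f') (hg : IsWeakDeriv g g') :
    IsWeakDeriv (f + g) (f' + g') := by
  rw [isWeakDeriv_iff_inner] at hf hg ⊢
  intro φ hφ hφc
  simp only [inner_add_right]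
  linear_combination hf φ hφ hφc + hg φ hφ hφc

theorem IsWeakDeriv.smul (c : ℂ) (hf : IsWeakDeriv f f') : IsWeakDeriv (c • f) (c • f') := by
  rw [isWeakDeriv_iff_inner] at hf ⊢
  intro φ hφ hφc
  simp only [inner_smul_right]
  linear_combination c * hf φ hφ hφc

theorem isClosed_isWeakDeriv : IsClosed {x : L2R × L2R | IsWeakDeriv x.1 x.2} := by
  simp only [isWeakDeriv_iff_inner, Set.ofPred_forall]
  refine isClosed_iInter fun φ => isClosed_iInter fun hφ => isClosed_iInter fun hφc => ?_
  exact isClosed_eq (by fun_prop) continuous_const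

end WeakDerivative

theorem isClosed_ae_eq_mul (m : ℝ → ℂ) :
    IsClosed {x : L2R × L2R | ∀ᵐ y, x.2 y = m y * x.1 y} := by
  refine isClosed_of_closure_subset fun x hx => ?_
  obtain ⟨a, ha, hax⟩ := mem_closure_iff_seq_limit.1 hx
  have hfst : Tendsto (fun n => (a n).1) atTop (𝓝 x.1) := (continuous_fst.tendsto _).comp hax
  have hsnd : Tendsto (fun n => (a n).2) atTop (𝓝 x.2) := (continuous_snd.tendsto _).comp hax
  obtain ⟨k, hk, hfst_ae⟩ := (tendstoInMeasure_of_tendsto_Lp hfst).exists_seq_tendsto_ae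
  obtain ⟨l, hl, hsnd_ae⟩ := (tendstoInMeasure_of_tendsto_Lp
    (hsnd.comp hk.tendsto_atTop)).exists_seq_tendsto_ae
  filter_upwards [hfst_ae, hsnd_ae, ae_all_iff.2 fun n => ha n] with y hfsty hsndy hay
  refine tendsto_nhds_unique hsndy (((hfsty.comp hl.tendsto_atTop).const_mul (m y)).congr
    fun n => ?_)
  simp only [Function.comp_apply, hay]

/-- The form domain of `-∂ₓ² + V` with the inner product `⟨u, v⟩ + ⟨u', v'⟩ + ∫ V ū v`, realised as
the subspace of the triples `(f, f', √V f)` in `L²(ℝ)³`. -/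
def formSpace (V : ℝ → ℝ) : Submodule ℂ (PiLp 2 fun _ : Fin 3 => L2R) where
  carrier := {x | IsWeakDeriv (x 0) (x 1) ∧ ∀ᵐ y, x 2 y = (√(V y) : ℂ) * x 0 y}
  zero_mem' := by
    refine ⟨isWeakDeriv_zero, ?_⟩
    filter_upwards with y
    simp
  add_mem' := by
    rintro x y ⟨hx, hxV⟩ ⟨hy, hyV⟩
    refine ⟨hx.add hy, ?_⟩
    filter_upwards [hxV, hyV, Lp.coeFn_add (x 2) (y 2), Lp.coeFn_add (x 0) (y 0)]
      with t hxt hyt hadd₂ hadd₀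
    simp only [PiLp.add_apply, hadd₂, hadd₀, Pi.add_apply, hxt, hyt, mul_add]
  smul_mem' := by
    rintro c x ⟨hx, hxV⟩
    refine ⟨hx.smul c, ?_⟩
    filter_upwards [hxV, Lp.coeFn_smul c (x 2), Lp.coeFn_smul c (x 0)] with t hxt hsmul₂ hsmul₀
    simp only [PiLp.smul_apply, hsmul₂, hsmul₀, Pi.smul_apply, smul_eq_mul, hxt, mul_left_comm]

theorem isClosed_formSpace (V : ℝ → ℝ) :
    IsClosed (formSpace V : Set (PiLp 2 fun _ : Fin 3 => L2R)) := by
  have hproj (i j : Fin 3) : Continuous fun x : PiLp 2 fun _ : Fin 3 => L2R => (x i, x j) :=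
    (PiLp.continuous_apply 2 _ i).prodMk (PiLp.continuous_apply 2 _ j)
  exact (isClosed_isWeakDeriv.preimage (hproj 0 1)).inter
    ((isClosed_ae_eq_mul _).preimage (hproj 0 2))

instance (V : ℝ → ℝ) : CompleteSpace (formSpace V) := (isClosed_formSpace V).completeSpace_coe

/-- The embedding of the form domain in `L²`. -/
def formEmbedding (V : ℝ → ℝ) : formSpace V →L[ℂ] L2R :=
  (PiLp.proj 2 (fun _ : Fin 3 => L2R) 0 : _ →L[ℂ] L2R).comp (formSpace V).subtypeL

theorem formEmbedding_apply {V : ℝ → ℝ} (x : formSpace V) : formEmbedding V x = x.1 0 := rfl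

section FormSpace

variable {V : ℝ → ℝ}

theorem norm_sqrt_mul_sq {v : ℝ} (hv : 0 ≤ v) (z : ℂ) : ‖(√v : ℂ) * z‖ ^ 2 = v * ‖z‖ ^ 2 := by
  rw [norm_mul, mul_pow, Complex.norm_real, Real.norm_of_nonneg (Real.sqrt_nonneg _),
    Real.sq_sqrt hv]

theorem formSpace_inFormDomain (hV : ∀ᵐ x, 0 ≤ V x) (x : formSpace V) :
    InFormDomain V (x.1 0) (x.1 1) := by
  refine ⟨x.2.1, (integrable_norm_sq (x.1 2)).congr ?_⟩
  filter_upwards [x.2.2, hV] with y hy hVy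
  rw [hy, norm_sqrt_mul_sq hVy]

theorem InFormDomain.exists_formSpace (hVm : AEStronglyMeasurable V) (hV : ∀ᵐ x, 0 ≤ V x)
    {f f' : L2R} (h : InFormDomain V f f') : ∃ x : formSpace V, x.1 0 = f ∧ x.1 1 = f' := by
  have hmeas : AEStronglyMeasurable fun y => (√(V y) : ℂ) * f y :=
    (Complex.continuous_ofReal.comp_aestronglyMeasurable
      (Real.continuous_sqrt.comp_aestronglyMeasurable hVm)).mul (Lp.aestronglyMeasurable f)
  have hmemLp : MemLp (fun y => (√(V y) : ℂ) * f y) 2 := by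
    rw [memLp_two_iff_integrable_sq_norm hmeas]
    refine h.2.congr ?_
    filter_upwards [hV] with y hVy
    rw [norm_sqrt_mul_sq hVy]
  exact ⟨⟨WithLp.toLp 2 ![f, f', hmemLp.toLp], h.1, hmemLp.coeFn_toLp⟩, rfl, rfl⟩

theorem formSpace_inner (hV : ∀ᵐ x, 0 ≤ V x) (x y : formSpace V) :
    ⟪x, y⟫_ℂ = ⟪x.1 0, y.1 0⟫_ℂ +
      (⟪x.1 1, y.1 1⟫_ℂ + ∫ t, (V t : ℂ) * (conj (x.1 0 t) * y.1 0 t)) := by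
  rw [Submodule.coe_inner, PiLp.inner_apply, Fin.sum_univ_three, add_assoc]
  congr 2
  rw [L2.inner_def]
  refine integral_congr_ae ?_
  filter_upwards [x.2.2, y.2.2, hV] with t hxt hyt hVt
  have hsqrt : ((√(V t) : ℝ) : ℂ) * (√(V t) : ℝ) = V t := by
    rw [← Complex.ofReal_mul, Real.mul_self_sqrt hVt]
  rw [hxt, hyt, RCLike.inner_apply, map_mul, Complex.conj_ofReal]
  linear_combination (conj (x.1 0 t) * y.1 0 t) * hsqrt

theorem formSpace_norm_sq (hV : ∀ᵐ x, 0 ≤ V x) (x : formSpace V) :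
    ‖x‖ ^ 2 = ‖x.1 0‖ ^ 2 + energy V (x.1 0) (x.1 1) := by
  have hpot : ‖x.1 2‖ ^ 2 = ∫ t, V t * ‖x.1 0 t‖ ^ 2 := by
    rw [norm_sq_eq_integral]
    refine integral_congr_ae ?_
    filter_upwards [x.2.2, hV] with t hxt hVt
    rw [hxt, norm_sqrt_mul_sq hVt]
  rw [Submodule.coe_norm, PiLp.norm_sq_eq_of_L2, Fin.sum_univ_three, hpot, add_assoc, energy]

end FormSpace

/-! ### The resolvent and the spectral decomposition -/

/-- The operator `(h + 1)⁻¹`, where `h = -∂ₓ² + V`. -/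
def resolvent (V : ℝ → ℝ) : L2R →L[ℂ] L2R :=
  (formEmbedding V).comp (ContinuousLinearMap.adjoint (formEmbedding V))

section Resolvent

variable {V : ℝ → ℝ}

theorem isSymmetric_resolvent : (resolvent V).IsSymmetric :=
  (ContinuousLinearMap.isPositive_self_comp_adjoint (formEmbedding V)).isSymmetric

theorem inner_adjoint_formEmbedding (v : formSpace V) (g : L2R) :
    ⟪v, ContinuousLinearMap.adjoint (formEmbedding V) g⟫_ℂ = ⟪v.1 0, g⟫_ℂ := by
  rw [ContinuousLinearMap.adjoint_inner_right, formEmbedding_apply]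

theorem schrodingerGraph_iff_resolvent (hVm : AEStronglyMeasurable V) (hV : ∀ᵐ x, 0 ≤ V x)
    {f g : L2R} : SchrodingerGraph V f g ↔ resolvent V (f + g) = f := by
  constructor
  · rintro ⟨f', hf, hweak⟩
    obtain ⟨x, rfl, rfl⟩ := hf.exists_formSpace hVm hV
    have hx : ContinuousLinearMap.adjoint (formEmbedding V) (x.1 0 + g) = x := by
      refine ext_inner_left ℂ fun v => ?_
      rw [inner_adjoint_formEmbedding, formSpace_inner hV,
        hweak _ _ (formSpace_inFormDomain hV v), inner_add_right]
    rw [resolvent, ContinuousLinearMap.comp_apply, hx, formEmbedding_apply]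
  · intro hfg
    set x := ContinuousLinearMap.adjoint (formEmbedding V) (f + g) with hx
    have hxf : x.1 0 = f := hfg
    refine ⟨x.1 1, hxf ▸ formSpace_inFormDomain hV x, fun v v' hv => ?_⟩
    obtain ⟨y, rfl, rfl⟩ := hv.exists_formSpace hVm hV
    have hxy := inner_adjoint_formEmbedding y (f + g)
    rw [← hx, formSpace_inner hV, inner_add_right, hxf] at hxy
    exact add_left_cancel hxy

theorem eq_zero_of_resolvent_eq_zero (hVloc : LocallyIntegrable V) (hV : ∀ᵐ x, 0 ≤ V x)
    {g : L2R} (hg : resolvent V g = 0) : g = 0 := by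
  have hadj : ContinuousLinearMap.adjoint (formEmbedding V) g = 0 := by
    have hker : g ∈ (resolvent V).ker := hg
    rwa [resolvent, ContinuousLinearMap.ker_self_comp_adjoint] at hker
  rw [Lp.eq_zero_iff_ae_eq_zero]
  refine ae_eq_zero_of_integral_contDiff_smul_eq_zero (locallyIntegrable_coeFn g)
    fun φ hφ hφc => ?_
  obtain ⟨x, hx, -⟩ := (inFormDomain_ccToL2 hVloc (hφ.of_le (by simp)) hφc).exists_formSpace
    hVloc.aestronglyMeasurable hV
  rw [← inner_ccToL2 hφ.continuous hφc, ← hx, ← inner_adjoint_formEmbedding, hadj,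
    inner_zero_right]

theorem isCompactOperator_formEmbedding (hV : ∀ᵐ x, 0 ≤ V x)
    (hconf : ∀ B : ℝ, ∃ L : ℝ, ∀ᵐ x, L ≤ |x| → B ≤ V x) :
    IsCompactOperator (formEmbedding V) := by
  have happrox (n : ℕ) : ∃ P : L2R →L[ℂ] L2R, FiniteDimensional ℂ P.range ∧
      ∀ f f', InFormDomain V f f' → ‖f - P f‖ ^ 2 ≤ (1 / ((n : ℝ) + 1)) ^ 2 * energy V f f' := by
    obtain ⟨L, hL⟩ := hconf (((n : ℝ) + 1) ^ 2)
    obtain ⟨M, hM⟩ := exists_nat_gt (2 * |L| * (n + 1))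
    have hM0 : (0 : ℝ) < M := lt_of_le_of_lt (by positivity) hM
    have hcell : 2 * |L| / M ≤ 1 / ((n : ℝ) + 1) := by
      rw [div_le_div_iff₀ hM0 (by positivity)]
      linarith
    obtain ⟨P, hfin, -, hP⟩ := exists_finiteRank_approx (V := V) (abs_nonneg L)
      (by exact_mod_cast hM0) (pow_le_pow_left₀ (by positivity) hcell 2) hV <| by
        filter_upwards [hL] with x hx hLx
        rw [one_div, inv_pow, inv_mul_eq_div, one_le_div (by positivity)]
        exact hx ((le_abs_self L).trans hLx)
    exact ⟨P, hfin, hP⟩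
  choose P hfin hP using happrox
  refine isCompactOperator_of_tendsto (l := atTop) (F := fun n => (P n).comp (formEmbedding V))
    ?_ (Eventually.of_forall fun n =>
      (isCompactOperator_of_finiteDimensional_range (hfin n)).comp_clm (formEmbedding V))
  refine (tendsto_iff_norm_sub_tendsto_zero (E := formSpace V →L[ℂ] L2R)).2 <|
    squeeze_zero (fun _ => norm_nonneg (E := formSpace V →L[ℂ] L2R) _)
      (fun n => ?_) tendsto_one_div_add_atTop_nhds_zero_nat
  refine ContinuousLinearMap.opNorm_le_bound _ (by positivity) fun x => ?_
  rw [sub_apply, norm_sub_rev]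
  refine le_of_sq_le_sq ?_ (by positivity)
  calc _ ≤ _ := hP n _ _ (formSpace_inFormDomain hV x)
    _ ≤ (1 / ((n : ℝ) + 1)) ^ 2 * ‖x‖ ^ 2 := by
      refine mul_le_mul_of_nonneg_left ?_ (by positivity)
      rw [formSpace_norm_sq hV]
      linarith [sq_nonneg ‖x.1 0‖]
    _ = _ := (mul_pow _ _ _).symm

theorem exists_isSpectralDecomposition (hVloc : LocallyIntegrable V) (hV : ∀ᵐ x, 0 ≤ V x)
    (hconf : ∀ B : ℝ, ∃ L : ℝ, ∀ᵐ x, L ≤ |x| → B ≤ V x) :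
    ∃ (u : HilbertBasis ℕ ℂ L2R) (lam : ℕ → ℝ), IsSpectralDecomposition V u lam := by
  have : Fact ((2 : ℝ≥0∞) ≠ ∞) := ⟨by simp⟩
  have hcompact : IsCompactOperator (resolvent V) :=
    (isCompactOperator_formEmbedding hV hconf).comp_clm _
  obtain ⟨u, κ, hκ⟩ := exists_eigenbasis_nat not_finiteDimensional_L2R hcompact
    isSymmetric_resolvent
  have hcoeff (f : L2R) (n : ℕ) : ⟪u n, resolvent V f⟫_ℂ = conj (κ n) * ⟪u n, f⟫_ℂ := by
    rw [← inner_smul_left, ← hκ]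
    exact (isSymmetric_resolvent (u n) f).symm
  have hreal (n : ℕ) : conj (κ n) = κ n := by
    simpa [hκ, inner_smul_right, inner_self_eq_norm_sq_to_K, u.orthonormal.1 n]
      using (hcoeff (u n) n).symm
  have hne (n : ℕ) : κ n ≠ 0 := fun hzero =>
    u.orthonormal.ne_zero n
      (eq_zero_of_resolvent_eq_zero hVloc hV (by rw [hκ, hzero, zero_smul]))
  refine ⟨u, fun n => (1 / κ n - 1).re, fun f g => ?_⟩
  rw [schrodingerGraph_iff_resolvent hVloc.aestronglyMeasurable hV, ← u.repr.injective.eq_iff,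
    lp.ext_iff, funext_iff]
  refine forall_congr' fun n => ?_
  have hre : (((1 / κ n - 1).re : ℝ) : ℂ) = 1 / κ n - 1 :=
    Complex.conj_eq_iff_re.1 (by simp [hreal n])
  rw [u.repr_apply_apply, u.repr_apply_apply, hcoeff, hreal, inner_add_right, hre]
  have := hne n
  field_simp
  constructor <;> intro h <;> linear_combination h

theorem exists_forall_le_of_rpow_le {s C : ℝ} (hs : 0 < s) (hC : 0 < C)
    (hV : ∀ᵐ x : ℝ, C⁻¹ * |x| ^ s ≤ V x) (B : ℝ) : ∃ L : ℝ, ∀ᵐ x, L ≤ |x| → B ≤ V x := by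
  obtain ⟨L, hL⟩ := (((tendsto_rpow_atTop hs).const_mul_atTop (inv_pos.2 hC)).eventually
    (eventually_ge_atTop B)).exists_forall_of_atTop
  exact ⟨L, hV.mono fun x hx hLx => (hL _ hLx).trans hx⟩

end Resolvent

/-! ### Complex Gaussian variables -/

/-- The law `(l/π) exp(-l |z|²) da db`, `z = a + i b`, of a circular complex Gaussian variable with
`𝔼 |z|² = 1 / l`. -/
def complexGaussian (l : ℝ) : Measure ℂ :=
  (volume : Measure ℂ).withDensity fun z =>
    ENNReal.ofReal (l / Real.pi * Real.exp (-(l * ‖z‖ ^ 2)))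

section ComplexGaussian

variable {l : ℝ}

theorem integral_complexGaussian (hl : 0 < l) (f : ℂ → ℂ) :
    ∫ z, f z ∂complexGaussian l =
      ∫ z, ((l / Real.pi * Real.exp (-(l * ‖z‖ ^ 2)) : ℝ) : ℂ) * f z := by
  rw [complexGaussian, integral_withDensity_eq_integral_toReal_smul (by fun_prop) (by simp)]
  congr 1 with z
  rw [ENNReal.toReal_ofReal (by positivity), Complex.real_smul]

theorem integral_norm_pow_mul_exp_neg (hl : 0 < l) (q : ℕ) :
    ∫ z : ℂ, ‖z‖ ^ q * Real.exp (-(l * ‖z‖ ^ 2)) =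
      Real.pi * l ^ (-((q : ℝ) + 2) / 2) * Real.Gamma (((q : ℝ) + 2) / 2) := by
  have hq : (-2 : ℝ) < q := by linarith [Nat.cast_nonneg (α := ℝ) q]
  have h := Complex.integral_rpow_mul_exp_neg_mul_rpow (p := 2) one_le_two hq hl
  simp only [Real.rpow_natCast, Real.rpow_ofNat, neg_mul] at h
  rw [h]
  ring

theorem integrable_norm_pow_mul_exp_neg (hl : 0 < l) (q : ℕ) :
    Integrable fun z : ℂ => ‖z‖ ^ q * Real.exp (-(l * ‖z‖ ^ 2)) := by
  refine not_imp_comm.1 integral_undef ?_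
  rw [integral_norm_pow_mul_exp_neg hl]
  have := Real.Gamma_pos_of_pos (s := ((q : ℝ) + 2) / 2) (by positivity)
  positivity

theorem integral_density_mul_norm_sq_pow (hl : 0 < l) (a : ℕ) :
    ∫ z : ℂ, l / Real.pi * Real.exp (-(l * ‖z‖ ^ 2)) * (‖z‖ ^ 2) ^ a = a.factorial / l ^ a := by
  have hexponent : (-(((2 * a : ℕ) : ℝ) + 2) / 2) = -((a + 1 : ℕ) : ℝ) := by push_cast; ring
  have hargument : (((2 * a : ℕ) : ℝ) + 2) / 2 = a + 1 := by push_cast; ring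
  calc ∫ z : ℂ, l / Real.pi * Real.exp (-(l * ‖z‖ ^ 2)) * (‖z‖ ^ 2) ^ a
      = l / Real.pi * ∫ z : ℂ, ‖z‖ ^ (2 * a) * Real.exp (-(l * ‖z‖ ^ 2)) := by
        rw [← integral_const_mul]
        congr 1 with z
        ring
    _ = a.factorial / l ^ a := by
        rw [integral_norm_pow_mul_exp_neg hl, hexponent, hargument, Real.Gamma_nat_eq_factorial,
          Real.rpow_neg hl.le, Real.rpow_natCast, pow_succ]
        field_simp

theorem isProbabilityMeasure_complexGaussian (hl : 0 < l) :
    IsProbabilityMeasure (complexGaussian l) := by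
  have hmass := integral_density_mul_norm_sq_pow hl 0
  have hint := (integrable_norm_pow_mul_exp_neg hl 0).const_mul (l / Real.pi)
  simp only [pow_zero, mul_one, one_mul, Nat.factorial_zero, Nat.cast_one, div_one] at hmass hint
  constructor
  rw [complexGaussian, withDensity_apply _ MeasurableSet.univ, Measure.restrict_univ,
    ← ofReal_integral_eq_lintegral_ofReal hint (ae_of_all _ fun z => by positivity), hmass,
    ENNReal.ofReal_one]

theorem integrable_complexGaussian_of_norm_le_pow (hl : 0 < l) {f : ℂ → ℂ} (hf : Measurable f)
    {q : ℕ} (hq : ∀ z, ‖f z‖ ≤ ‖z‖ ^ q) : Integrable f (complexGaussian l) := by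
  rw [complexGaussian, integrable_withDensity_iff_integrable_smul' (by fun_prop) (by simp)]
  refine ((integrable_norm_pow_mul_exp_neg hl q).const_mul (l / Real.pi)).mono'
    (by fun_prop) (ae_of_all _ fun z => ?_)
  rw [norm_smul, ENNReal.toReal_ofReal (by positivity), Real.norm_of_nonneg (by positivity)]
  calc l / Real.pi * Real.exp (-(l * ‖z‖ ^ 2)) * ‖f z‖
      ≤ l / Real.pi * Real.exp (-(l * ‖z‖ ^ 2)) * ‖z‖ ^ q := by gcongr; exact hq z
    _ = l / Real.pi * (‖z‖ ^ q * Real.exp (-(l * ‖z‖ ^ 2))) := by ring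

theorem integrable_pow_mul_conj_pow_complexGaussian (hl : 0 < l) (a b : ℕ) :
    Integrable (fun z => z ^ a * conj z ^ b) (complexGaussian l) :=
  integrable_complexGaussian_of_norm_le_pow hl (by fun_prop) (q := a + b) fun z => by
    simp [pow_add]

theorem integral_pow_mul_conj_pow_self_complexGaussian (hl : 0 < l) (a : ℕ) :
    ∫ z, z ^ a * conj z ^ a ∂complexGaussian l = a.factorial / (l : ℂ) ^ a := by
  calc ∫ z, z ^ a * conj z ^ a ∂complexGaussian l
      = ∫ z : ℂ, ((l / Real.pi * Real.exp (-(l * ‖z‖ ^ 2)) * (‖z‖ ^ 2) ^ a : ℝ) : ℂ) := by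
        rw [integral_complexGaussian hl]
        congr 1 with z
        rw [← mul_pow, Complex.mul_conj']
        push_cast
        ring
    _ = a.factorial / (l : ℂ) ^ a := by
        rw [integral_complex_ofReal, integral_density_mul_norm_sq_pow hl]
        push_cast
        rfl

theorem exists_circle_pow_mul_conj_pow_eq_neg_one {a b : ℕ} (hab : a ≠ b) :
    ∃ c : Circle, (c : ℂ) ^ a * conj (c : ℂ) ^ b = -1 := by
  have hsub : (a : ℂ) - b ≠ 0 := sub_ne_zero.2 (by exact_mod_cast hab)
  refine ⟨Circle.exp (Real.pi / ((a : ℝ) - b)), ?_⟩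
  rw [Circle.coe_exp, ← Complex.exp_conj, ← Complex.exp_nat_mul, ← Complex.exp_nat_mul,
    ← Complex.exp_add, ← Complex.exp_pi_mul_I]
  congr 1
  simp only [map_mul, Complex.conj_ofReal, Complex.conj_I]
  push_cast
  field_simp
  ring

theorem integral_pow_mul_conj_pow_of_ne_complexGaussian (hl : 0 < l) {a b : ℕ} (hab : a ≠ b) :
    ∫ z, z ^ a * conj z ^ b ∂complexGaussian l = 0 := by
  obtain ⟨c, hc⟩ := exists_circle_pow_mul_conj_pow_eq_neg_one hab
  rw [integral_complexGaussian hl]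
  set F : ℂ → ℂ := fun z =>
    ((l / Real.pi * Real.exp (-(l * ‖z‖ ^ 2)) : ℝ) : ℂ) * (z ^ a * conj z ^ b) with hF
  have hneg (z : ℂ) : F (rotation c z) = -F z := by
    simp only [hF, rotation_apply, norm_mul, Circle.norm_coe, one_mul, mul_pow, map_mul]
    linear_combination ((l / Real.pi * Real.exp (-(l * ‖z‖ ^ 2)) : ℝ) : ℂ) *
      (z ^ a * conj z ^ b) * hc
  have hinv : ∫ z, F (rotation c z) = ∫ z, F z :=
    (rotation c).measurePreserving.integral_comp
      (rotation c).toHomeomorph.measurableEmbedding F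
  rwa [funext hneg, integral_neg, neg_eq_self] at hinv

theorem integral_exp_re_complexGaussian (hl : 0 < l) (c : ℂ) (ξ : ℝ) :
    ∫ z, Complex.exp (ξ * (conj c * z).re * Complex.I) ∂complexGaussian l =
      Complex.exp (-(ξ ^ 2 * ‖c‖ ^ 2 / (4 * l))) := by
  have hπ : (Real.pi : ℂ) ≠ 0 := by exact_mod_cast Real.pi_ne_zero
  have hl' : (l : ℂ) ≠ 0 := by exact_mod_cast hl.ne'
  have hintegrand (z : ℂ) : ((l / Real.pi * Real.exp (-(l * ‖z‖ ^ 2)) : ℝ) : ℂ) *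
      Complex.exp (ξ * (conj c * z).re * Complex.I) =
        l / Real.pi * Complex.exp (-l * ‖z‖ ^ 2 + ξ * Complex.I * (⟪c, z⟫_ℝ : ℝ)) := by
    rw [Complex.exp_add, Complex.inner, mul_comm z]
    push_cast
    ring_nf
  have hfourier : ∫ z : ℂ, Complex.exp (-l * ‖z‖ ^ 2 + ξ * Complex.I * (⟪c, z⟫_ℝ : ℝ)) =
      Real.pi / l * Complex.exp ((ξ * Complex.I) ^ 2 * ‖c‖ ^ 2 / (4 * l)) := by
    rw [GaussianFourier.integral_cexp_neg_mul_sq_norm_add (by simpa using hl),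
      Complex.finrank_real_complex]
    norm_num
  rw [integral_complexGaussian hl]
  simp_rw [hintegrand]
  rw [integral_const_mul, hfourier, mul_pow, Complex.I_sq]
  field_simp

end ComplexGaussian

/-- All mixed moments of `X` and the conjugate of `Y` agree with those of a circular jointly
Gaussian pair with covariance `𝔼 (X Ȳ) = S`. -/
def HasCircularMoments {Ω : Type*} [MeasurableSpace Ω] (X Y : Ω → ℂ) (S : ℂ) (μ : Measure Ω) :
    Prop :=
  ∀ a b : ℕ, Integrable (fun ω => X ω ^ a * conj (Y ω) ^ b) μ ∧
    ∫ ω, X ω ^ a * conj (Y ω) ^ b ∂μ = if a = b then a.factorial * S ^ a else 0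

theorem hasCircularMoments_const_mul_complexGaussian {l : ℝ} (hl : 0 < l) (x y : ℂ) :
    HasCircularMoments (fun z => x * z) (fun z => y * z) (x * conj y / l) (complexGaussian l) := by
  intro a b
  have hfactor (z : ℂ) : (x * z) ^ a * conj (y * z) ^ b =
      x ^ a * conj y ^ b * (z ^ a * conj z ^ b) := by
    rw [map_mul]
    ring
  simp_rw [hfactor, integral_const_mul]
  refine ⟨(integrable_pow_mul_conj_pow_complexGaussian hl a b).const_mul _, ?_⟩
  split_ifs with hab
  · subst hab
    rw [integral_pow_mul_conj_pow_self_complexGaussian hl]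
    ring
  · rw [integral_pow_mul_conj_pow_of_ne_complexGaussian hl hab, mul_zero]

theorem hasCircularMoments_zero {Ω : Type*} [MeasurableSpace Ω] (μ : Measure Ω)
    [IsProbabilityMeasure μ] : HasCircularMoments (fun _ => 0) (fun _ => 0) 0 μ := by
  intro a b
  refine ⟨integrable_const _, ?_⟩
  rw [integral_const]
  rcases a with - | a <;> rcases b with - | b <;> simp

theorem sum_choose_mul_choose_mul_factorial (a : ℕ) (S S' : ℂ) :
    ∑ i ∈ Finset.range (a + 1), (a.choose i * a.choose i : ℂ) *
      ((i.factorial * S ^ i) * ((a - i).factorial * S' ^ (a - i))) =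
      a.factorial * (S + S') ^ a := by
  rw [add_pow, Finset.mul_sum]
  refine Finset.sum_congr rfl fun i hi => ?_
  have hchoose : (a.choose i : ℂ) * i.factorial * (a - i).factorial = a.factorial := by
    exact_mod_cast Nat.choose_mul_factorial_mul_factorial (Finset.mem_range_succ_iff.1 hi)
  linear_combination (a.choose i : ℂ) * S ^ i * S' ^ (a - i) * hchoose

theorem HasCircularMoments.add_prod {α β : Type*} [MeasurableSpace α] [MeasurableSpace β]
    {μ : Measure α} {ν : Measure β} [SFinite μ] [SFinite ν]
    {X Y : α → ℂ} {X' Y' : β → ℂ} {S S' : ℂ}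
    (h : HasCircularMoments X Y S μ) (h' : HasCircularMoments X' Y' S' ν) :
    HasCircularMoments (fun z : α × β => X z.1 + X' z.2) (fun z => Y z.1 + Y' z.2) (S + S')
      (μ.prod ν) := by
  intro a b
  let F (i j : ℕ) (z : α × β) : ℂ := (a.choose i * b.choose j : ℂ) *
    ((X z.1 ^ i * conj (Y z.1) ^ j) * (X' z.2 ^ (a - i) * conj (Y' z.2) ^ (b - j)))
  have hbinomial (z : α × β) : (X z.1 + X' z.2) ^ a * conj (Y z.1 + Y' z.2) ^ b =
      ∑ i ∈ Finset.range (a + 1), ∑ j ∈ Finset.range (b + 1), F i j z := by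
    rw [map_add, add_pow, add_pow, Finset.sum_mul_sum]
    exact Finset.sum_congr rfl fun i _ => Finset.sum_congr rfl fun j _ => by ring
  have hint (i j : ℕ) : Integrable (F i j) (μ.prod ν) :=
    ((h i j).1.mul_prod (h' (a - i) (b - j)).1).const_mul _
  have hterm (i j : ℕ) : ∫ z, F i j z ∂μ.prod ν = (a.choose i * b.choose j : ℂ) *
      ((if i = j then i.factorial * S ^ i else 0) *
        if a - i = b - j then (a - i).factorial * S' ^ (a - i) else 0) := by
    rw [integral_const_mul, integral_prod_mul (fun z => X z ^ i * conj (Y z) ^ j)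
      (fun z => X' z ^ (a - i) * conj (Y' z) ^ (b - j)), (h i j).2, (h' _ _).2]
  simp_rw [hbinomial]
  refine ⟨integrable_finsetSum _ fun i _ => integrable_finsetSum _ fun j _ => hint i j, ?_⟩
  rw [integral_finsetSum _ fun i _ => integrable_finsetSum _ fun j _ => hint i j]
  simp_rw [integral_finsetSum _ fun j _ => hint _ j, hterm]
  split_ifs with hab
  · subst hab
    rw [← sum_choose_mul_choose_mul_factorial]
    refine Finset.sum_congr rfl fun i hi => ?_
    rw [Finset.sum_eq_single_of_mem i hi fun j _ hji => by simp [hji.symm], if_pos rfl, if_pos rfl]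
  · refine Finset.sum_eq_zero fun i hi => Finset.sum_eq_zero fun j hj => ?_
    have : ¬(i = j ∧ a - i = b - j) := by
      rw [Finset.mem_range] at hi hj
      omega
    grind

theorem HasCircularMoments.comp {α β : Type*} [MeasurableSpace α] [MeasurableSpace β]
    {μ : Measure α} {ν : Measure β} {X Y : β → ℂ} {S : ℂ} (h : HasCircularMoments X Y S ν)
    {f : α → β} (hf : MeasurePreserving f μ ν) :
    HasCircularMoments (fun ω => X (f ω)) (fun ω => Y (f ω)) S μ := by
  intro a b
  refine ⟨hf.integrable_comp_of_integrable (h a b).1, ?_⟩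
  rw [← (h a b).2, ← hf.map_eq, integral_map hf.aemeasurable]
  rw [hf.map_eq]
  exact (h a b).1.aestronglyMeasurable

theorem hasCircularMoments_sum_pi_complexGaussian {n : ℕ} {l : Fin n → ℝ} (hl : ∀ i, 0 < l i)
    (x y : Fin n → ℂ) :
    HasCircularMoments (fun z => ∑ i, x i * z i) (fun z => ∑ i, y i * z i)
      (∑ i, x i * conj (y i) / l i) (Measure.pi fun i => complexGaussian (l i)) := by
  have hprob (i : Fin n) := isProbabilityMeasure_complexGaussian (hl i)
  induction n with
  | zero =>
    simp only [Finset.univ_eq_empty, Finset.sum_empty]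
    exact hasCircularMoments_zero _
  | succ n ih =>
    have hhead := hasCircularMoments_const_mul_complexGaussian (hl 0) (x 0) (y 0)
    have htail := ih (fun i => hl i.succ) (fun i => x i.succ) (fun i => y i.succ)
      fun i => hprob i.succ
    simp only [Fin.sum_univ_succ]
    have hsum := (hhead.add_prod htail).comp
      (measurePreserving_piFinSuccAbove (fun i => complexGaussian (l i)) 0)
    simpa [MeasurableEquiv.piFinSuccAbove, Fin.tail] using hsum

/-! ### The infinite-dimensional Gaussian measure -/

theorem map_fin_infinitePi {X : ℕ → Type*} [∀ n, MeasurableSpace (X n)]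
    (μ : ∀ n, Measure (X n)) [∀ n, IsProbabilityMeasure (μ n)] (K : ℕ) :
    (Measure.infinitePi μ).map (fun (α : ∀ n, X n) (j : Fin K) => α j) =
      Measure.pi fun j : Fin K => μ j := by
  have hindep : iIndepFun (fun n (α : ∀ n, X n) => α n) (Measure.infinitePi μ) :=
    iIndepFun_infinitePi (X := fun _ => id) fun _ => measurable_id
  have hmap := (iIndepFun_iff_map_fun_eq_pi_map fun j => (measurable_pi_apply _).aemeasurable).1
    (hindep.precomp (Fin.val_injective (n := K)))
  rw [hmap]
  congr with j : 1
  exact Measure.infinitePi_map_eval μ j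

theorem eq_infinitePi_of_map_fin {X : ℕ → Type*} [∀ n, MeasurableSpace (X n)]
    (μ : ∀ n, Measure (X n)) [∀ n, IsProbabilityMeasure (μ n)] {ν : Measure (∀ n, X n)}
    (hν : ∀ K, ν.map (fun (α : ∀ n, X n) (j : Fin (K + 1)) => α j) =
      Measure.pi fun j : Fin (K + 1) => μ j) :
    ν = Measure.infinitePi μ := by
  have hlimit : IsProjectiveLimit ν fun I : Finset ℕ => Measure.pi fun i : I => μ i := by
    intro I
    have hlt (i : I) : (i : ℕ) < I.sup id + 1 := Nat.lt_succ_of_le (Finset.le_sup (f := id) i.2)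
    have hfactor : I.restrict =
        (fun (z : ∀ j : Fin (I.sup id + 1), X j) (i : I) => z ⟨i, hlt i⟩) ∘
          fun (α : ∀ n, X n) (j : Fin (I.sup id + 1)) => α j := rfl
    change ν.map I.restrict = Measure.pi fun i : I => μ i
    rw [← Measure.infinitePi_map_restrict μ, hfactor,
      ← Measure.map_map (by fun_prop) (by fun_prop), ← Measure.map_map (by fun_prop) (by fun_prop),
      hν, map_fin_infinitePi]
  exact hlimit.unique (Measure.isProjectiveLimit_infinitePi μ)

section SobolevSpaces

variable {lam : ℕ → ℝ} {t₀ : ℝ}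

theorem exists_pos_lower_bound_of_summable_rpow (hlam : ∀ n, 0 < lam n) {q : ℝ} (hq : q < 0)
    (hsum : Summable fun n => lam n ^ q) : ∃ δ : ℝ, 0 < δ ∧ ∀ n, δ ≤ lam n := by
  have hnonneg (n : ℕ) : 0 ≤ lam n ^ q := (Real.rpow_pos_of_pos (hlam n) q).le
  set B := 1 + ∑' n, lam n ^ q
  have hB : 0 < B := by linarith [(tsum_nonneg hnonneg : 0 ≤ ∑' n, lam n ^ q)]
  refine ⟨B ^ q⁻¹, by positivity, fun n => ?_⟩
  have hle : lam n ^ q ≤ B := by linarith [hsum.le_tsum n fun m _ => hnonneg m]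
  have hroot := Real.rpow_le_rpow_of_nonpos (Real.rpow_pos_of_pos (hlam n) q) hle
    (inv_nonpos.2 hq.le)
  rwa [← Real.rpow_mul (hlam n).le, mul_inv_cancel₀ hq.ne, Real.rpow_one] at hroot

theorem sobolevLike_anti {δ : ℝ} (hδ : 0 < δ) (hle : ∀ n, δ ≤ lam n) :
    Antitone (SobolevLike lam) := by
  intro t' t ht α hα
  have hlam (n : ℕ) : 0 < lam n := hδ.trans_le (hle n)
  refine Summable.of_nonneg_of_le (fun n => ?_) (fun n => ?_) (hα.mul_left (δ ^ (t' - t)))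
  · have := hlam n
    positivity
  calc lam n ^ t' * ‖α n‖ ^ 2
      = lam n ^ (t' - t) * (lam n ^ t * ‖α n‖ ^ 2) := by
        rw [← mul_assoc, ← Real.rpow_add (hlam n), sub_add_cancel]
    _ ≤ δ ^ (t' - t) * (lam n ^ t * ‖α n‖ ^ 2) := by
        have := hlam n
        exact mul_le_mul_of_nonneg_right
          (Real.rpow_le_rpow_of_nonpos hδ (hle n) (by linarith)) (by positivity)

theorem mem_sobolevLike_iff_tsum_ne_top (hlam : ∀ n, 0 < lam n) {t : ℝ} {α : ℕ → ℂ} :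
    α ∈ SobolevLike lam t ↔ ∑' n, ENNReal.ofReal (lam n ^ t * ‖α n‖ ^ 2) ≠ ∞ := by
  have hnonneg (n : ℕ) : 0 ≤ lam n ^ t * ‖α n‖ ^ 2 := by
    have := hlam n
    positivity
  refine ⟨fun h => ENNReal.ofReal_tsum_of_nonneg hnonneg h ▸ ENNReal.ofReal_ne_top, fun h => ?_⟩
  exact (ENNReal.summable_toReal h).congr fun n => ENNReal.toReal_ofReal (hnonneg n)

theorem measurableSet_sobolevLike (hlam : ∀ n, 0 < lam n) (t : ℝ) :
    MeasurableSet (SobolevLike lam t) := by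
  have hpreimage : SobolevLike lam t =
      (fun α : ℕ → ℂ => ∑' n, ENNReal.ofReal (lam n ^ t * ‖α n‖ ^ 2)) ⁻¹' {∞}ᶜ :=
    Set.ext fun _ => mem_sobolevLike_iff_tsum_ne_top hlam
  have hmeas : Measurable fun α : ℕ → ℂ => ∑' n, ENNReal.ofReal (lam n ^ t * ‖α n‖ ^ 2) := by
    fun_prop
  rw [hpreimage]
  exact hmeas (measurableSet_singleton _).compl

theorem sobolevInter_eq_iInter_nat {δ : ℝ} (hδ : 0 < δ) (hle : ∀ n, δ ≤ lam n) :
    (⋂ t ∈ Set.Iio t₀, SobolevLike lam t) =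
      ⋂ j : ℕ, SobolevLike lam (t₀ - 1 / ((j : ℝ) + 1)) := by
  refine Set.Subset.antisymm (Set.subset_iInter fun j => ?_) (Set.subset_iInter₂ fun t ht => ?_)
  · exact Set.biInter_subset_of_mem (sub_lt_self t₀ (by positivity))
  · obtain ⟨j, hj⟩ := exists_nat_one_div_lt (K := ℝ) (sub_pos.2 (Set.mem_Iio.1 ht))
    exact (Set.iInter_subset _ j).trans (sobolevLike_anti hδ hle (by linarith))

theorem measurableSet_sobolevInter {δ : ℝ} (hδ : 0 < δ) (hle : ∀ n, δ ≤ lam n) :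
    MeasurableSet (⋂ t ∈ Set.Iio t₀, SobolevLike lam t) := by
  rw [sobolevInter_eq_iInter_nat hδ hle]
  exact MeasurableSet.iInter fun j => measurableSet_sobolevLike (fun n => hδ.trans_le (hle n)) _

theorem lintegral_mul_norm_sq_complexGaussian {l : ℝ} (hl : 0 < l) {r : ℝ} (hr : 0 ≤ r) :
    ∫⁻ z, ENNReal.ofReal (r * ‖z‖ ^ 2) ∂complexGaussian l = ENNReal.ofReal (r / l) := by
  have hint : Integrable fun z : ℂ =>
      r * (l / Real.pi * Real.exp (-(l * ‖z‖ ^ 2)) * (‖z‖ ^ 2) ^ 1) :=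
    (((integrable_norm_pow_mul_exp_neg hl 2).const_mul (l / Real.pi)).const_mul r).congr
      (ae_of_all _ fun z => by ring)
  calc ∫⁻ z, ENNReal.ofReal (r * ‖z‖ ^ 2) ∂complexGaussian l
      = ∫⁻ z : ℂ, ENNReal.ofReal
          (r * (l / Real.pi * Real.exp (-(l * ‖z‖ ^ 2)) * (‖z‖ ^ 2) ^ 1)) := by
        rw [complexGaussian, lintegral_withDensity_eq_lintegral_mul _ (by fun_prop) (by fun_prop)]
        congr 1 with z
        rw [Pi.mul_apply, ← ENNReal.ofReal_mul (by positivity)]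
        ring_nf
    _ = ENNReal.ofReal (r / l) := by
        rw [← ofReal_integral_eq_lintegral_ofReal hint (ae_of_all _ fun z => by positivity),
          integral_const_mul, integral_density_mul_norm_sq_pow hl]
        simp [div_eq_mul_inv]

theorem ae_mem_sobolevLike (hlam : ∀ n, 0 < lam n)
    [∀ n, IsProbabilityMeasure (complexGaussian (lam n))] {t : ℝ}
    (hsum : Summable fun n => lam n ^ (t - 1)) :
    ∀ᵐ α ∂(Measure.infinitePi fun n => complexGaussian (lam n)), α ∈ SobolevLike lam t := by
  have hterm (n : ℕ) : ∫⁻ α, ENNReal.ofReal (lam n ^ t * ‖α n‖ ^ 2)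
      ∂(Measure.infinitePi fun n => complexGaussian (lam n)) =
        ENNReal.ofReal (lam n ^ (t - 1)) := by
    have := hlam n
    rw [(measurePreserving_eval_infinitePi (fun n => complexGaussian (lam n)) n).lintegral_comp
        (f := fun z => ENNReal.ofReal (lam n ^ t * ‖z‖ ^ 2)) (by fun_prop),
      lintegral_mul_norm_sq_complexGaussian (hlam n) (by positivity),
      Real.rpow_sub_one (hlam n).ne']
  have hfinite : ∫⁻ α, ∑' n, ENNReal.ofReal (lam n ^ t * ‖α n‖ ^ 2)
      ∂(Measure.infinitePi fun n => complexGaussian (lam n)) ≠ ∞ := by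
    rw [lintegral_tsum fun n => Measurable.aemeasurable (by fun_prop)]
    simp_rw [hterm]
    rw [← ENNReal.ofReal_tsum_of_nonneg (fun n => (Real.rpow_pos_of_pos (hlam n) _).le) hsum]
    exact ENNReal.ofReal_ne_top
  filter_upwards [ae_lt_top (by fun_prop) hfinite] with α hα
  exact (mem_sobolevLike_iff_tsum_ne_top hlam).2 hα.ne

theorem measurable_cylProj (K : ℕ) : Measurable (cylProj K : SobolevInter lam t₀ → _) :=
  measurable_pi_iff.2 fun j => (measurable_pi_apply (j : ℕ)).comp measurable_subtype_coe

theorem isFreeGibbs_iff_map_val_eq_infinitePi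
    [∀ n, IsProbabilityMeasure (complexGaussian (lam n))] {ν : Measure (SobolevInter lam t₀)} :
    IsFreeGibbs ν ↔ ν.map Subtype.val = Measure.infinitePi fun n => complexGaussian (lam n) := by
  have hmap (K : ℕ) : ν.map (cylProj K) =
      (ν.map Subtype.val).map fun (α : ℕ → ℂ) (j : Fin (K + 1)) => α j := by
    rw [Measure.map_map (by fun_prop) measurable_subtype_coe]
    rfl
  refine ⟨fun hν => ?_, fun hν => ⟨?_, fun K => ?_⟩⟩
  · exact eq_infinitePi_of_map_fin _ fun K => (hmap K).symm.trans (hν.2 K)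
  · have : IsProbabilityMeasure (ν.map Subtype.val) := hν ▸ inferInstance
    exact Measure.isProbabilityMeasure_of_map Subtype.val
  · rw [hmap, hν]
    exact map_fin_infinitePi _ _

theorem exists_unique_isFreeGibbs {δ : ℝ} (hδ : 0 < δ) (hle : ∀ n, δ ≤ lam n)
    (hsum : ∀ t < t₀, Summable fun n => lam n ^ (t - 1)) :
    ∃! μ : Measure (SobolevInter lam t₀), IsFreeGibbs μ := by
  have hlam (n : ℕ) : 0 < lam n := hδ.trans_le (hle n)
  have hprob (n : ℕ) := isProbabilityMeasure_complexGaussian (hlam n)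
  set P := Measure.infinitePi fun n => complexGaussian (lam n) with hP
  have hemb : MeasurableEmbedding (Subtype.val : SobolevInter lam t₀ → ℕ → ℂ) :=
    MeasurableEmbedding.subtype_coe (measurableSet_sobolevInter hδ hle)
  have hsupport : ∀ᵐ α ∂P, α ∈ ⋂ t ∈ Set.Iio t₀, SobolevLike lam t := by
    rw [sobolevInter_eq_iInter_nat hδ hle]
    simp only [Set.mem_iInter]
    exact ae_all_iff.2 fun j => ae_mem_sobolevLike hlam (hsum _ (sub_lt_self t₀ (by positivity)))
  refine ⟨P.comap Subtype.val, isFreeGibbs_iff_map_val_eq_infinitePi.2 ?_, fun ν hν => ?_⟩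
  · rw [hemb.map_comap, Subtype.range_coe]
    exact Measure.restrict_eq_self_of_ae_mem hsupport
  · rw [hP, ← isFreeGibbs_iff_map_val_eq_infinitePi.1 hν, hemb.comap_map]

end SobolevSpaces

/-! ### Gaussian linear functionals and their moments -/

theorem HasCircularMoments.of_tendsto {Ω : Type*} [MeasurableSpace Ω] {μ : Measure Ω}
    {X Y : ℕ → Ω → ℂ} {X' Y' : Ω → ℂ} {S : ℕ → ℂ} {S' : ℂ} {G H : Ω → ℝ}
    (h : ∀ K, HasCircularMoments (X K) (Y K) (S K) μ) (hS : Tendsto S atTop (𝓝 S'))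
    (hX : ∀ ω, Tendsto (fun K => X K ω) atTop (𝓝 (X' ω)))
    (hY : ∀ ω, Tendsto (fun K => Y K ω) atTop (𝓝 (Y' ω)))
    (hXG : ∀ K ω, ‖X K ω‖ ≤ G ω) (hYH : ∀ K ω, ‖Y K ω‖ ≤ H ω)
    (hG : ∀ a : ℕ, Integrable (fun ω => G ω ^ (2 * a)) μ)
    (hH : ∀ a : ℕ, Integrable (fun ω => H ω ^ (2 * a)) μ) :
    HasCircularMoments X' Y' S' μ := by
  intro a b
  have hbound (K : ℕ) (ω : Ω) :
      ‖X K ω ^ a * conj (Y K ω) ^ b‖ ≤ G ω ^ (2 * a) + H ω ^ (2 * b) := by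
    rw [norm_mul, norm_pow, norm_pow, Complex.norm_conj, mul_comm 2, pow_mul, mul_comm 2, pow_mul]
    have hXa := pow_le_pow_left₀ (norm_nonneg _) (hXG K ω) a
    have hYb := pow_le_pow_left₀ (norm_nonneg _) (hYH K ω) b
    have hXa₀ : 0 ≤ ‖X K ω‖ ^ a := by positivity
    have hYb₀ : 0 ≤ ‖Y K ω‖ ^ b := by positivity
    nlinarith [two_mul_le_add_sq (‖X K ω‖ ^ a) (‖Y K ω‖ ^ b)]
  have hlim (ω : Ω) : Tendsto (fun K => X K ω ^ a * conj (Y K ω) ^ b) atTop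
      (𝓝 (X' ω ^ a * conj (Y' ω) ^ b)) :=
    ((hX ω).pow a).mul (((Complex.continuous_conj.tendsto _).comp (hY ω)).pow b)
  have hmeas (K : ℕ) := (h K a b).1.aestronglyMeasurable
  have hdom := (hG a).add (hH b)
  refine ⟨hdom.mono' (aestronglyMeasurable_of_tendsto_ae atTop hmeas (ae_of_all _ hlim))
    (ae_of_all _ fun ω => le_of_tendsto' (hlim ω).norm fun K => hbound K ω), ?_⟩
  refine tendsto_nhds_unique (tendsto_integral_of_dominated_convergence _ hmeas hdom
    (fun K => ae_of_all _ (hbound K)) (ae_of_all _ hlim)) ?_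
  simp_rw [(h _ a b).2]
  split_ifs
  · exact (hS.pow a).const_mul _
  · exact tendsto_const_nhds

theorem memLp_tsum {Ω E : Type*} [MeasurableSpace Ω] [NormedAddCommGroup E] {μ : Measure Ω}
    {p : ℝ≥0∞} (hp : 1 ≤ p) {f : ℕ → Ω → E} (hf : ∀ n, AEStronglyMeasurable (f n) μ)
    (hsum : ∀ᵐ ω ∂μ, Summable fun n => f n ω) (hnorm : ∑' n, eLpNorm (f n) p μ ≠ ∞) :
    MemLp (fun ω => ∑' n, f n ω) p μ := by
  have hmeas (N : ℕ) : AEStronglyMeasurable (∑ n ∈ Finset.range N, f n) μ :=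
    Finset.aestronglyMeasurable_sum _ fun n _ => hf n
  have hlim : ∀ᵐ ω ∂μ, Tendsto (fun N => (∑ n ∈ Finset.range N, f n) ω) atTop
      (𝓝 (∑' n, f n ω)) := by
    filter_upwards [hsum] with ω hω
    simpa only [Finset.sum_apply] using hω.hasSum.tendsto_sum_nat
  have hbound (N : ℕ) : eLpNorm (∑ n ∈ Finset.range N, f n) p μ ≤ ∑' n, eLpNorm (f n) p μ :=
    (eLpNorm_sum_le (fun n _ => hf n) hp).trans (ENNReal.sum_le_tsum _)
  refine ⟨aestronglyMeasurable_of_tendsto_ae atTop hmeas hlim, ?_⟩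
  calc eLpNorm (fun ω => ∑' n, f n ω) p μ
      ≤ liminf (fun N => eLpNorm (∑ n ∈ Finset.range N, f n) p μ) atTop :=
        Lp.eLpNorm_lim_le_liminf_eLpNorm hmeas _ hlim
    _ ≤ ∑' n, eLpNorm (f n) p μ := liminf_le_of_frequently_le' (Frequently.of_forall hbound)
    _ < ∞ := hnorm.lt_top

theorem eLpNorm_id_complexGaussian {l : ℝ} (hl : 0 < l) {k : ℕ} (hk : k ≠ 0) :
    eLpNorm id ((2 * k : ℕ) : ℝ≥0∞) (complexGaussian l) =
      ENNReal.ofReal ((k.factorial : ℝ) ^ (2 * k : ℝ)⁻¹ * l ^ (-(1 / 2) : ℝ)) := by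
  have hp₀ : ((2 * k : ℕ) : ℝ≥0∞) ≠ 0 := by exact_mod_cast (by omega : 2 * k ≠ 0)
  have hk₀ : (k : ℝ) ≠ 0 := by exact_mod_cast hk
  have hnorm (z : ℂ) : z ^ k * conj z ^ k = ((‖z‖ ^ (2 * k) : ℝ) : ℂ) := by
    rw [← mul_pow, Complex.mul_conj', pow_mul]
    push_cast
    rfl
  have hint := integrable_pow_mul_conj_pow_complexGaussian hl k k
  have hmoment := integral_pow_mul_conj_pow_self_complexGaussian hl k
  simp_rw [hnorm] at hint hmoment
  rw [integral_complex_ofReal] at hmoment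
  have hmoment' : ∫ z, ‖z‖ ^ (2 * k) ∂complexGaussian l = k.factorial / l ^ k := by
    exact_mod_cast hmoment
  have hmem : MemLp id ((2 * k : ℕ) : ℝ≥0∞) (complexGaussian l) := by
    rw [← integrable_norm_rpow_iff (by fun_prop) hp₀ (ENNReal.natCast_ne_top _)]
    simpa only [ENNReal.toReal_natCast, Real.rpow_natCast, id, RCLike.re_to_complex,
      Complex.ofReal_re] using hint.re
  rw [hmem.eLpNorm_eq_integral_rpow_norm hp₀ (ENNReal.natCast_ne_top _)]
  simp only [ENNReal.toReal_natCast, Real.rpow_natCast, id, hmoment']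
  rw [Real.div_rpow (by positivity) (by positivity), ← Real.rpow_natCast l, ← Real.rpow_mul hl.le,
    Real.rpow_neg hl.le, ← div_eq_mul_inv]
  congr 3
  · push_cast; rfl
  · push_cast; field_simp

section Pairing

variable {lam : ℕ → ℝ} {t₀ t : ℝ} {c d : ℕ → ℂ}

theorem summable_norm_mul_norm (hlam : ∀ n, 0 < lam n) (hc : c ∈ SobolevLike lam (-t))
    {α : ℕ → ℂ} (hα : α ∈ SobolevLike lam t) : Summable fun n => ‖c n‖ * ‖α n‖ := by
  refine Summable.of_nonneg_of_le (fun n => by positivity) (fun n => ?_) (hc.add hα)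
  have hpos := Real.rpow_pos_of_pos (hlam n) t
  rw [Real.rpow_neg (hlam n).le]
  set r := Real.sqrt (lam n ^ t)
  have hr₀ : 0 < r := Real.sqrt_pos.2 hpos
  have hr₂ : r ^ 2 = lam n ^ t := Real.sq_sqrt hpos.le
  calc ‖c n‖ * ‖α n‖ = (r⁻¹ * ‖c n‖) * (r * ‖α n‖) := by field_simp
    _ ≤ (r⁻¹ * ‖c n‖) ^ 2 + (r * ‖α n‖) ^ 2 := by
        nlinarith [two_mul_le_add_sq (r⁻¹ * ‖c n‖) (r * ‖α n‖), sq_nonneg (r⁻¹ * ‖c n‖),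
          sq_nonneg (r * ‖α n‖)]
    _ = (lam n ^ t)⁻¹ * ‖c n‖ ^ 2 + lam n ^ t * ‖α n‖ ^ 2 := by
        rw [mul_pow, mul_pow, inv_pow, hr₂]

theorem summable_norm_mul_rpow_neg_half (hlam : ∀ n, 0 < lam n) (hc : c ∈ SobolevLike lam (-t))
    (hsum : Summable fun n => lam n ^ (t - 1)) :
    Summable fun n => ‖c n‖ * lam n ^ (-(1 / 2) : ℝ) := by
  have hnorm (n : ℕ) : ‖((lam n ^ (-(1 / 2) : ℝ) : ℝ) : ℂ)‖ = lam n ^ (-(1 / 2) : ℝ) :=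
    Complex.norm_of_nonneg (Real.rpow_pos_of_pos (hlam n) _).le
  have hmem : (fun n => ((lam n ^ (-(1 / 2) : ℝ) : ℝ) : ℂ)) ∈ SobolevLike lam t := by
    refine hsum.congr fun n => ?_
    rw [hnorm, ← Real.rpow_natCast, ← Real.rpow_mul (hlam n).le, ← Real.rpow_add (hlam n)]
    norm_num
    ring_nf
  simpa only [hnorm] using summable_norm_mul_norm hlam hc hmem

theorem summable_norm_sq_div (hlam : ∀ n, 0 < lam n) (hc : c ∈ SobolevLike lam (-t))
    (hsum : Summable fun n => lam n ^ (t - 1)) : Summable fun n => ‖c n‖ ^ 2 / lam n := by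
  have hsummable := summable_norm_mul_rpow_neg_half hlam hc hsum
  have hnonneg (n : ℕ) : 0 ≤ ‖c n‖ * lam n ^ (-(1 / 2) : ℝ) :=
    mul_nonneg (norm_nonneg _) (Real.rpow_nonneg (hlam n).le _)
  have hdiag : Function.Injective fun n : ℕ => (n, n) := fun _ _ h => congrArg Prod.fst h
  refine ((hsummable.mul_of_nonneg hsummable hnonneg hnonneg).comp_injective hdiag).congr
    fun n => ?_
  simp only [Function.comp_apply]
  rw [mul_mul_mul_comm, ← Real.rpow_add (hlam n), ← sq, ← neg_add, add_halves, Real.rpow_neg_one,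
    div_eq_mul_inv]

theorem SobolevInter.mem (α : SobolevInter lam t₀) (ht : t < t₀) : α.1 ∈ SobolevLike lam t :=
  Set.mem_iInter₂.1 α.2 t ht

/-- The partial sum `∑_{n ≤ K} c̄ₙ αₙ` of the duality pairing, a function of the projection of `α`
on `span(u₀, …, u_K)`. -/
def truncatedPairing (c : ℕ → ℂ) (K : ℕ) (α : ℕ → ℂ) : ℂ :=
  ∑ n ∈ Finset.range (K + 1), conj (c n) * α n

theorem truncatedPairing_eq_sum_cylProj (K : ℕ) (α : SobolevInter lam t₀) :
    truncatedPairing c K α.1 = ∑ j : Fin (K + 1), conj (c j) * cylProj K α j :=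
  Finset.sum_range _

theorem measurable_truncatedPairing (c : ℕ → ℂ) (K : ℕ) : Measurable (truncatedPairing c K) := by
  unfold truncatedPairing
  fun_prop

theorem tendsto_truncatedPairing (hlam : ∀ n, 0 < lam n) (ht : t < t₀)
    (hc : c ∈ SobolevLike lam (-t)) (α : SobolevInter lam t₀) :
    Tendsto (fun K => truncatedPairing c K α.1) atTop (𝓝 (pairing c α.1)) := by
  have hsummable : Summable fun n => conj (c n) * α.1 n :=
    Summable.of_norm (by simpa using summable_norm_mul_norm hlam hc (α.mem ht))
  exact hsummable.hasSum.tendsto_sum_nat.comp (tendsto_add_atTop_nat 1)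

theorem norm_truncatedPairing_le (hlam : ∀ n, 0 < lam n) (ht : t < t₀)
    (hc : c ∈ SobolevLike lam (-t)) (K : ℕ) (α : SobolevInter lam t₀) :
    ‖truncatedPairing c K α.1‖ ≤ ∑' n, ‖c n‖ * ‖α.1 n‖ := by
  calc ‖truncatedPairing c K α.1‖
      ≤ ∑ n ∈ Finset.range (K + 1), ‖conj (c n) * α.1 n‖ := norm_sum_le _ _
    _ = ∑ n ∈ Finset.range (K + 1), ‖c n‖ * ‖α.1 n‖ := by simp
    _ ≤ ∑' n, ‖c n‖ * ‖α.1 n‖ :=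
        (summable_norm_mul_norm hlam hc (α.mem ht)).sum_le_tsum _ fun n _ => by positivity

theorem measurable_pairing (hlam : ∀ n, 0 < lam n) (ht : t < t₀)
    (hc : c ∈ SobolevLike lam (-t)) :
    Measurable fun α : SobolevInter lam t₀ => pairing c α.1 :=
  measurable_of_tendsto_metrizable
    (fun K => (measurable_truncatedPairing c K).comp measurable_subtype_coe)
    (tendsto_pi_nhds.2 (tendsto_truncatedPairing hlam ht hc))

variable {μ : Measure (SobolevInter lam t₀)}

theorem IsFreeGibbs.measurePreserving_cylProj (hμ : IsFreeGibbs μ) (K : ℕ) :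
    MeasurePreserving (cylProj K) μ
      (Measure.pi fun j : Fin (K + 1) => complexGaussian (lam j)) :=
  ⟨measurable_cylProj K, hμ.2 K⟩

theorem IsFreeGibbs.measurePreserving_coeff (hμ : IsFreeGibbs μ) (hlam : ∀ n, 0 < lam n) (n : ℕ) :
    MeasurePreserving (fun α => α.1 n) μ (complexGaussian (lam n)) := by
  have hprob (j : Fin (n + 1)) := isProbabilityMeasure_complexGaussian (hlam j)
  exact (measurePreserving_eval _ (Fin.last n)).comp (hμ.measurePreserving_cylProj n)

theorem IsFreeGibbs.integral_exp_re_truncatedPairing (hμ : IsFreeGibbs μ) (hlam : ∀ n, 0 < lam n)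
    (c : ℕ → ℂ) (K : ℕ) (ξ : ℝ) :
    ∫ α, Complex.exp (ξ * (truncatedPairing c K α.1).re * Complex.I) ∂μ =
      Complex.exp (-((∑ n ∈ Finset.range (K + 1), ‖c n‖ ^ 2 / lam n : ℝ) * ξ ^ 2 / 4)) := by
  have hprob (n : ℕ) := isProbabilityMeasure_complexGaussian (hlam n)
  have hexp (z : Fin (K + 1) → ℂ) :
      Complex.exp (ξ * (∑ j : Fin (K + 1), conj (c j) * z j).re * Complex.I) =
        ∏ j : Fin (K + 1), Complex.exp (ξ * (conj (c j) * z j).re * Complex.I) := by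
    rw [← Complex.exp_sum, Complex.re_sum, Complex.ofReal_sum, Finset.mul_sum, Finset.sum_mul]
  simp_rw [truncatedPairing_eq_sum_cylProj]
  rw [← integral_map (f := fun z => Complex.exp
      (ξ * (∑ j : Fin (K + 1), conj (c j) * z j).re * Complex.I))
    (measurable_cylProj K).aemeasurable (Continuous.aestronglyMeasurable (by fun_prop)),
    (hμ.measurePreserving_cylProj K).map_eq]
  simp_rw [hexp]
  rw [integral_fintype_prod_eq_prod
    (fun (j : Fin (K + 1)) z => Complex.exp (ξ * (conj (c j) * z).re * Complex.I))]
  simp_rw [integral_exp_re_complexGaussian (hlam _)]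
  rw [← Complex.exp_sum, Finset.sum_range]
  push_cast
  rw [Finset.sum_mul, Finset.sum_div, ← Finset.sum_neg_distrib]
  congr 1
  refine Finset.sum_congr rfl fun j _ => ?_
  have : (lam j : ℂ) ≠ 0 := by exact_mod_cast (hlam j).ne'
  field_simp

theorem IsFreeGibbs.integral_exp_re_pairing (hμ : IsFreeGibbs μ) (hlam : ∀ n, 0 < lam n)
    (ht : t < t₀) (hc : c ∈ SobolevLike lam (-t)) (hsum : Summable fun n => lam n ^ (t - 1))
    (ξ : ℝ) :
    ∫ α, Complex.exp (ξ * (pairing c α.1).re * Complex.I) ∂μ =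
      Complex.exp (-((∑' n, ‖c n‖ ^ 2 / lam n : ℝ) * ξ ^ 2 / 4)) := by
  have := hμ.1
  have hcontinuous : Continuous fun z : ℂ => Complex.exp (ξ * z.re * Complex.I) := by fun_prop
  have hlim : Tendsto
      (fun K => ∫ α, Complex.exp (ξ * (truncatedPairing c K α.1).re * Complex.I) ∂μ) atTop
      (𝓝 (∫ α, Complex.exp (ξ * (pairing c α.1).re * Complex.I) ∂μ)) := by
    refine tendsto_integral_of_dominated_convergence (fun _ => 1) (fun K => ?_)
      (integrable_const _) (fun K => ae_of_all _ fun α => ?_) (ae_of_all _ fun α => ?_)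
    · exact (hcontinuous.measurable.comp
        ((measurable_truncatedPairing c K).comp measurable_subtype_coe)).aestronglyMeasurable
    · rw [← Complex.ofReal_mul, Complex.norm_exp_ofReal_mul_I]
    · exact (hcontinuous.tendsto _).comp (tendsto_truncatedPairing hlam ht hc α)
  simp_rw [hμ.integral_exp_re_truncatedPairing hlam] at hlim
  refine tendsto_nhds_unique hlim ?_
  have hcontinuous' : Continuous fun x : ℝ => Complex.exp (-(x * ξ ^ 2 / 4)) := by fun_prop
  exact (hcontinuous'.tendsto _).comp
    ((summable_norm_sq_div hlam hc hsum).hasSum.tendsto_sum_nat.comp (tendsto_add_atTop_nat 1))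

theorem IsFreeGibbs.isCenteredGaussian (hμ : IsFreeGibbs μ) (hlam : ∀ n, 0 < lam n)
    (hsum : ∀ t < t₀, Summable fun n => lam n ^ (t - 1)) : IsCenteredGaussian μ := by
  intro t ht c hc
  have := hμ.1
  have hmeas : Measurable fun α : SobolevInter lam t₀ => (pairing c α.1).re :=
    Complex.measurable_re.comp (measurable_pairing hlam ht hc)
  have := Measure.isProbabilityMeasure_map (μ := μ) hmeas.aemeasurable
  obtain ⟨v, hv⟩ : ∃ v : ℝ≥0, ∑' n, ‖c n‖ ^ 2 / lam n = 2 * (v : ℝ) :=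
    ⟨⟨(∑' n, ‖c n‖ ^ 2 / lam n) / 2, div_nonneg
      (tsum_nonneg fun n => div_nonneg (sq_nonneg _) (hlam n).le) zero_le_two⟩,
      (mul_div_cancel₀ _ two_ne_zero).symm⟩
  refine ⟨v, Measure.ext_of_charFun (funext fun ξ => ?_)⟩
  rw [charFun_gaussianReal, charFun_apply_real, integral_map hmeas.aemeasurable (by fun_prop),
    hμ.integral_exp_re_pairing hlam ht hc (hsum t ht), hv]
  congr 1
  push_cast
  ring

theorem IsFreeGibbs.integrable_tsum_norm_pow (hμ : IsFreeGibbs μ) (hlam : ∀ n, 0 < lam n)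
    (ht : t < t₀) (hc : c ∈ SobolevLike lam (-t)) (hsum : Summable fun n => lam n ^ (t - 1))
    (k : ℕ) :
    Integrable (fun α : SobolevInter lam t₀ => (∑' n, ‖c n‖ * ‖α.1 n‖) ^ (2 * k)) μ := by
  have := hμ.1
  rcases eq_or_ne k 0 with rfl | hk
  · simp
  have hcoeff := hμ.measurePreserving_coeff hlam
  have hterm (n : ℕ) : eLpNorm (fun α : SobolevInter lam t₀ => ‖c n‖ * ‖α.1 n‖)
      ((2 * k : ℕ) : ℝ≥0∞) μ = ENNReal.ofReal ((k.factorial : ℝ) ^ (2 * k : ℝ)⁻¹ *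
        (‖c n‖ * lam n ^ (-(1 / 2) : ℝ))) := by
    have hlaw : eLpNorm (fun α : SobolevInter lam t₀ => α.1 n) ((2 * k : ℕ) : ℝ≥0∞) μ =
        eLpNorm id ((2 * k : ℕ) : ℝ≥0∞) (complexGaussian (lam n)) :=
      eLpNorm_comp_measurePreserving (g := (id : ℂ → ℂ)) (by fun_prop) (hcoeff n)
    have hscale := eLpNorm_const_smul ‖c n‖ (fun α : SobolevInter lam t₀ => ‖α.1 n‖)
      ((2 * k : ℕ) : ℝ≥0∞) μ
    rw [eLpNorm_norm, hlaw, eLpNorm_id_complexGaussian (hlam n) hk, enorm_norm, ← ofReal_norm,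
      ← ENNReal.ofReal_mul (norm_nonneg _), mul_left_comm] at hscale
    exact hscale
  have hmem : MemLp (fun α : SobolevInter lam t₀ => ∑' n, ‖c n‖ * ‖α.1 n‖)
      ((2 * k : ℕ) : ℝ≥0∞) μ := by
    refine memLp_tsum (by exact_mod_cast (by omega : 1 ≤ 2 * k))
      (fun n => ((hcoeff n).measurable.norm.const_mul _).aestronglyMeasurable)
      (ae_of_all _ fun α => summable_norm_mul_norm hlam hc (α.mem ht)) ?_
    simp_rw [hterm]
    exact ((summable_norm_mul_rpow_neg_half hlam hc hsum).mul_left _).tsum_ofReal_ne_top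
  refine (hmem.integrable_norm_pow (by omega)).congr (ae_of_all _ fun α => ?_)
  exact congrArg (· ^ (2 * k)) (Real.norm_of_nonneg (tsum_nonneg fun n => by positivity))

theorem IsFreeGibbs.hasCircularMoments_truncatedPairing (hμ : IsFreeGibbs μ)
    (hlam : ∀ n, 0 < lam n) (c d : ℕ → ℂ) (K : ℕ) :
    HasCircularMoments (fun α : SobolevInter lam t₀ => truncatedPairing c K α.1)
      (fun α => truncatedPairing d K α.1)
      (∑ n ∈ Finset.range (K + 1), conj (c n) * d n / lam n) μ := by
  have hmoments := (hasCircularMoments_sum_pi_complexGaussian (fun j : Fin (K + 1) => hlam j)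
    (fun j => conj (c j)) (fun j => conj (d j))).comp (hμ.measurePreserving_cylProj K)
  simpa only [truncatedPairing_eq_sum_cylProj, Finset.sum_range, Complex.conj_conj] using hmoments

theorem IsFreeGibbs.hasCircularMoments_pairing (hμ : IsFreeGibbs μ) (hlam : ∀ n, 0 < lam n)
    (ht : t < t₀) (hsum : Summable fun n => lam n ^ (t - 1))
    (hc : c ∈ SobolevLike lam (-t)) (hd : d ∈ SobolevLike lam (-t)) {S : ℂ}
    (hS : HasSum (fun n => conj (c n) * d n / lam n) S) :
    HasCircularMoments (fun α : SobolevInter lam t₀ => pairing c α.1)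
      (fun α => pairing d α.1) S μ :=
  HasCircularMoments.of_tendsto (hμ.hasCircularMoments_truncatedPairing hlam c d)
    (hS.tendsto_sum_nat.comp (tendsto_add_atTop_nat 1))
    (tendsto_truncatedPairing hlam ht hc) (tendsto_truncatedPairing hlam ht hd)
    (norm_truncatedPairing_le hlam ht hc) (norm_truncatedPairing_le hlam ht hd)
    (hμ.integrable_tsum_norm_pow hlam ht hc hsum) (hμ.integrable_tsum_norm_pow hlam ht hd hsum)

end Pairing

/-! ### Polarization and Wick's formula -/

section Polarization

variable {ι R : Type*} [Fintype ι] [DecidableEq ι] [CommRing R]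

theorem sum_powerset_compl_image_neg_one_pow_card (f : ι → ι) :
    ∑ U ∈ ((Finset.univ.image f)ᶜ).powerset, (-1 : R) ^ U.card =
      if Function.Bijective f then 1 else 0 := by
  have hsum := congrArg (Int.cast : ℤ → R)
    (Finset.sum_powerset_neg_one_pow_card (x := (Finset.univ.image f)ᶜ))
  push_cast at hsum
  have hsurj : Finset.univ.image f = Finset.univ ↔ Function.Bijective f := by
    rw [← Finite.surjective_iff_bijective, ← Finset.coe_inj, Finset.coe_image, Finset.coe_univ,
      Set.image_univ, Set.range_eq_univ]
  simp only [hsum, Finset.compl_eq_empty_iff, hsurj]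

/-- Ryser's formula for the permanent. -/
theorem sum_neg_one_pow_mul_prod_sum_compl (C : ι → ι → R) :
    ∑ U : Finset ι, (-1) ^ U.card * ∏ i, ∑ j ∈ Uᶜ, C i j =
      ∑ σ : Equiv.Perm ι, ∏ i, C i (σ i) := by
  have hexpand (U : Finset ι) : (-1) ^ U.card * ∏ i, ∑ j ∈ Uᶜ, C i j =
      ∑ f : ι → ι, if U ∈ ((Finset.univ.image f)ᶜ).powerset then
        (-1) ^ U.card * ∏ i, C i (f i) else 0 := by
    rw [Finset.prod_univ_sum, Finset.mul_sum, ← Finset.sum_filter]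
    refine Finset.sum_congr (Finset.ext fun f => ?_) fun _ _ => rfl
    simp only [Fintype.mem_piFinset, Finset.mem_compl, Finset.mem_filter, Finset.mem_univ,
      true_and, Finset.mem_powerset, Finset.subset_iff, Finset.mem_image, not_exists]
    exact ⟨fun h x hx i hi => h i (hi ▸ hx), fun h i hi => h hi i rfl⟩
  have hcancel (f : ι → ι) : (∑ U : Finset ι, if U ∈ ((Finset.univ.image f)ᶜ).powerset then
      (-1) ^ U.card * ∏ i, C i (f i) else 0) =
      if Function.Bijective f then ∏ i, C i (f i) else 0 := by
    rw [Finset.sum_ite_mem, Finset.univ_inter, ← Finset.sum_mul,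
      sum_powerset_compl_image_neg_one_pow_card, ite_mul, one_mul, zero_mul]
  simp_rw [hexpand]
  rw [Finset.sum_comm]
  simp_rw [hcancel]
  rw [← Finset.sum_filter]
  exact Finset.sum_bij' (fun f hf => Equiv.ofBijective f (Finset.mem_filter.1 hf).2)
    (fun σ _ => σ) (by simp) (by simp) (by simp) (by simp) (by simp)

theorem sum_perm_prod_comp (x : ι → R) :
    ∑ σ : Equiv.Perm ι, ∏ i, x (σ i) = (Fintype.card ι).factorial * ∏ i, x i := by
  simp only [Equiv.prod_comp, Finset.sum_const, Finset.card_univ, Fintype.card_perm,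
    nsmul_eq_mul]

theorem sum_neg_one_pow_mul_sum_compl_pow (x : ι → R) :
    ∑ U : Finset ι, (-1) ^ U.card * (∑ j ∈ Uᶜ, x j) ^ Fintype.card ι =
      (Fintype.card ι).factorial * ∏ i, x i := by
  rw [← sum_perm_prod_comp, ← sum_neg_one_pow_mul_prod_sum_compl fun _ j => x j]
  simp only [Finset.prod_const, Finset.card_univ]

theorem sum_sum_neg_one_pow_mul_sum_sum_compl_pow (C : ι → ι → R) :
    ∑ U : Finset ι, ∑ W : Finset ι, (-1) ^ U.card * (-1) ^ W.card *
      (∑ i ∈ Uᶜ, ∑ j ∈ Wᶜ, C i j) ^ Fintype.card ι =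
      (Fintype.card ι).factorial * ∑ σ : Equiv.Perm ι, ∏ i, C i (σ i) := by
  have hrow (W : Finset ι) := sum_neg_one_pow_mul_sum_compl_pow fun i => ∑ j ∈ Wᶜ, C i j
  calc ∑ U : Finset ι, ∑ W : Finset ι, (-1) ^ U.card * (-1) ^ W.card *
        (∑ i ∈ Uᶜ, ∑ j ∈ Wᶜ, C i j) ^ Fintype.card ι
      = ∑ W : Finset ι, (-1) ^ W.card * ∑ U : Finset ι, (-1) ^ U.card *
          (∑ i ∈ Uᶜ, ∑ j ∈ Wᶜ, C i j) ^ Fintype.card ι := by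
        rw [Finset.sum_comm]
        simp only [Finset.mul_sum, mul_assoc, mul_left_comm]
    _ = (Fintype.card ι).factorial * ∑ W : Finset ι, (-1) ^ W.card * ∏ i, ∑ j ∈ Wᶜ, C i j := by
        simp only [hrow, Finset.mul_sum, mul_left_comm]
    _ = _ := by rw [sum_neg_one_pow_mul_prod_sum_compl]

end Polarization

theorem HasCircularMoments.integral_prod_mul_conj_prod {Ω ι : Type*} [MeasurableSpace Ω]
    {μ : Measure Ω} [Fintype ι] [DecidableEq ι] {X Y : ι → Ω → ℂ} {C : ι → ι → ℂ}
    (h : ∀ U W : Finset ι, HasCircularMoments (fun ω => ∑ i ∈ U, X i ω)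
      (fun ω => ∑ j ∈ W, Y j ω) (∑ i ∈ U, ∑ j ∈ W, C i j) μ) :
    Integrable (fun ω => (∏ i, X i ω) * conj (∏ i, Y i ω)) μ ∧
      ∫ ω, (∏ i, X i ω) * conj (∏ i, Y i ω) ∂μ = ∑ σ : Equiv.Perm ι, ∏ i, C i (σ i) := by
  set m : ℕ := Fintype.card ι with hm
  have hfac : ((m.factorial : ℂ) * m.factorial) ≠ 0 := by
    exact_mod_cast mul_ne_zero m.factorial_ne_zero m.factorial_ne_zero
  have hpolar (ω : Ω) : (m.factorial * m.factorial : ℂ) * ((∏ i, X i ω) * conj (∏ i, Y i ω)) =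
      ∑ U : Finset ι, ∑ W : Finset ι, ((-1) ^ U.card * (-1) ^ W.card) *
        ((∑ i ∈ Uᶜ, X i ω) ^ m * conj (∑ j ∈ Wᶜ, Y j ω) ^ m) := by
    have hX := sum_neg_one_pow_mul_sum_compl_pow fun i => X i ω
    have hY := congrArg conj (sum_neg_one_pow_mul_sum_compl_pow fun i => Y i ω)
    simp only [map_sum, map_mul, map_pow, map_neg, map_one, map_natCast, map_prod] at hY ⊢
    rw [mul_mul_mul_comm, ← hX, ← hY, Finset.sum_mul_sum]
    simp only [mul_mul_mul_comm, hm]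
  have hint (U W : Finset ι) := (h Uᶜ Wᶜ m m).1.const_mul ((-1) ^ U.card * (-1) ^ W.card)
  have hint' (U : Finset ι) := integrable_finsetSum Finset.univ fun W _ => hint U W
  have hprod : Integrable (fun ω => (m.factorial * m.factorial : ℂ) *
      ((∏ i, X i ω) * conj (∏ i, Y i ω))) μ := by
    simp_rw [hpolar]
    exact integrable_finsetSum _ fun U _ => hint' U
  refine ⟨(integrable_const_mul_iff (IsUnit.mk0 _ hfac) _).1 hprod, mul_left_cancel₀ hfac ?_⟩
  rw [← integral_const_mul]
  simp_rw [hpolar]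
  rw [integral_finsetSum _ fun U _ => hint' U]
  simp_rw [integral_finsetSum _ fun W _ => hint _ W, integral_const_mul, (h _ _ m m).2, if_pos]
  rw [mul_assoc, ← sum_sum_neg_one_pow_mul_sum_sum_compl_pow C]
  simp only [Finset.mul_sum, mul_left_comm, hm]

section Wick

variable {lam : ℕ → ℝ} {t₀ t : ℝ} {ι : Type*}

theorem SobolevLike.sum_mem (hlam : ∀ n, 0 < lam n) (F : Finset ι) {c : ι → ℕ → ℂ}
    (hc : ∀ i, c i ∈ SobolevLike lam t) : (fun n => ∑ i ∈ F, c i n) ∈ SobolevLike lam t := by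
  have hsum : Summable fun n => (F.card : ℝ) * ∑ i ∈ F, lam n ^ t * ‖c i n‖ ^ 2 :=
    (summable_sum fun i _ => hc i).mul_left _
  refine Summable.of_nonneg_of_le (fun n => by have := hlam n; positivity) (fun n => ?_) hsum
  have := hlam n
  rw [← Finset.mul_sum, mul_left_comm]
  gcongr
  exact (pow_le_pow_left₀ (norm_nonneg _) (norm_sum_le F _) 2).trans sq_sum_le_card_mul_sum_sq

theorem pairing_sum (hlam : ∀ n, 0 < lam n) (F : Finset ι) {c : ι → ℕ → ℂ}
    (hc : ∀ i, c i ∈ SobolevLike lam (-t)) {α : ℕ → ℂ} (hα : α ∈ SobolevLike lam t) :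
    pairing (fun n => ∑ i ∈ F, c i n) α = ∑ i ∈ F, pairing (c i) α := by
  have hsummable (i : ι) : Summable fun n => conj (c i n) * α n :=
    Summable.of_norm (by simpa using summable_norm_mul_norm hlam (hc i) hα)
  unfold pairing
  rw [← Summable.tsum_finsetSum fun i _ => hsummable i]
  simp only [map_sum, Finset.sum_mul]

theorem IsFreeGibbs.integral_prod_pairing_mul_conj [Fintype ι] [DecidableEq ι]
    {μ : Measure (SobolevInter lam t₀)} (hμ : IsFreeGibbs μ) (hlam : ∀ n, 0 < lam n)
    (ht : t < t₀) (hsum : Summable fun n => lam n ^ (t - 1)) {c d : ι → ℕ → ℂ}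
    (hc : ∀ i, c i ∈ SobolevLike lam (-t)) (hd : ∀ i, d i ∈ SobolevLike lam (-t))
    {C : ι → ι → ℂ} (hC : ∀ i j, HasSum (fun n => conj (c i n) * d j n / lam n) (C i j)) :
    Integrable (fun α : SobolevInter lam t₀ =>
        (∏ i, pairing (c i) α.1) * conj (∏ i, pairing (d i) α.1)) μ ∧
      ∫ α : SobolevInter lam t₀, (∏ i, pairing (c i) α.1) * conj (∏ i, pairing (d i) α.1) ∂μ =
        ∑ σ : Equiv.Perm ι, ∏ i, C i (σ i) := by
  refine HasCircularMoments.integral_prod_mul_conj_prod fun U W => ?_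
  have hS : HasSum (fun n => conj (∑ i ∈ U, c i n) * (∑ j ∈ W, d j n) / lam n)
      (∑ i ∈ U, ∑ j ∈ W, C i j) := by
    simpa only [map_sum, Finset.sum_mul_sum, Finset.sum_div] using
      hasSum_sum fun i _ => hasSum_sum fun j _ => hC i j
  simpa only [pairing_sum hlam _ hc (SobolevInter.mem _ ht),
    pairing_sum hlam _ hd (SobolevInter.mem _ ht)] using
    hμ.hasCircularMoments_pairing hlam ht hsum (SobolevLike.sum_mem hlam U hc)
      (SobolevLike.sum_mem hlam W hd) hS

end Wick

/-! ### Total families and diagonal operators in Hilbert spaces -/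

section HilbertSpace

variable {𝕜 : Type*} [RCLike 𝕜] {ι H : Type*} [NormedAddCommGroup H] [InnerProductSpace 𝕜 H]

variable (𝕜) in
/-- The family `v` is total: only the zero vector is orthogonal to all `v i`. -/
def IsTotal (v : ι → H) : Prop := ∀ x, (∀ i, ⟪v i, x⟫_𝕜 = 0) → x = 0

theorem isTotal_hilbertBasis (b : HilbertBasis ι 𝕜 H) : IsTotal 𝕜 b := fun x hx =>
  b.repr.map_eq_zero_iff.1 <| by
    ext i
    rw [b.repr_apply_apply, hx]
    rfl

theorem IsTotal.ext {v : ι → H} (hv : IsTotal 𝕜 v) {x y : H}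
    (h : ∀ i, ⟪v i, x⟫_𝕜 = ⟪v i, y⟫_𝕜) : x = y :=
  sub_eq_zero.1 <| hv _ fun i => by rw [inner_sub_right, h, sub_self]

theorem IsTotal.clm_ext [CompleteSpace H] {v : ι → H} (hv : IsTotal 𝕜 v) {S T : H →L[𝕜] H}
    (h : ∀ i j, ⟪v i, S (v j)⟫_𝕜 = ⟪v i, T (v j)⟫_𝕜) : S = T := by
  have hadjoint (i : ι) : S.adjoint (v i) = T.adjoint (v i) := hv.ext fun j => by
    simpa only [ContinuousLinearMap.adjoint_inner_right, inner_conj_symm] using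
      congrArg (starRingEnd 𝕜) (h i j)
  ext x
  exact hv.ext fun i => by
    rw [← ContinuousLinearMap.adjoint_inner_left, hadjoint, ContinuousLinearMap.adjoint_inner_left]

theorem IsTotal.span_orthogonal_eq_bot {v : ι → H} (hv : IsTotal 𝕜 v) :
    (Submodule.span 𝕜 (Set.range v))ᗮ = ⊥ :=
  (Submodule.eq_bot_iff _).2 fun x hx => hv x fun i =>
    (Submodule.mem_orthogonal _ x).1 hx _ (Submodule.subset_span ⟨i, rfl⟩)

theorem exists_hilbertBasis_smul_eq [CompleteSpace H] {v : ι → H} (hv : IsTotal 𝕜 v)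
    (hne : ∀ i, v i ≠ 0) (horth : Pairwise fun i j => ⟪v i, v j⟫_𝕜 = 0) :
    ∃ b : HilbertBasis ι 𝕜 H, ∀ i, ∃ c : 𝕜, c ≠ 0 ∧ b i = c • v i := by
  let e (i : ι) : H := (‖v i‖⁻¹ : 𝕜) • v i
  have hnorm (i : ι) : (‖v i‖⁻¹ : 𝕜) ≠ 0 := by simpa using hne i
  have he : Orthonormal 𝕜 e := by
    refine ⟨fun i => norm_smul_inv_norm (hne i), fun i j hij => ?_⟩
    simp only [e, inner_smul_left, inner_smul_right, horth hij, mul_zero]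
  have htotal : IsTotal 𝕜 e := fun x hx => hv x fun i =>
    (mul_eq_zero.1 ((inner_smul_left _ _ _).symm.trans (hx i))).resolve_left
      ((map_ne_zero _).2 (hnorm i))
  refine ⟨.mkOfOrthogonalEqBot he htotal.span_orthogonal_eq_bot, fun i => ⟨_, hnorm i, ?_⟩⟩
  rw [HilbertBasis.coe_mkOfOrthogonalEqBot]

/-- `T` multiplies the coefficients with respect to the family `v` by `a`. For a total orthogonal
family this says that `T (v i) = a i • v i` for all `i`, but the weak form needs no such
assumption. -/
def IsDiagonal (v : ι → H) (a : ι → 𝕜) (T : H →L[𝕜] H) : Prop :=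
  ∀ x i, ⟪v i, T x⟫_𝕜 = a i * ⟪v i, x⟫_𝕜

theorem exists_isDiagonal (b : HilbertBasis ι 𝕜 H) {a : ι → 𝕜} {B : ℝ} (hB : 0 ≤ B)
    (ha : ∀ i, ‖a i‖ ≤ B) : ∃ T : H →L[𝕜] H, IsDiagonal b a T := by
  let M := lp.mapCLM 2 (fun i => a i • ContinuousLinearMap.id 𝕜 𝕜) hB fun i =>
    ContinuousLinearMap.opNorm_le_bound _ hB fun z => by
      simpa [norm_smul] using mul_le_mul_of_nonneg_right (ha i) (norm_nonneg z)
  refine ⟨(b.repr.symm : _ →L[𝕜] H).comp (M.comp (b.repr : H →L[𝕜] _)), fun x i => ?_⟩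
  rw [← b.repr_apply_apply, ← b.repr_apply_apply]
  simp [M]

theorem isDiagonal_congr {v w : ι → H} (h : ∀ i, ∃ c : 𝕜, c ≠ 0 ∧ w i = c • v i) {a : ι → 𝕜}
    {T : H →L[𝕜] H} : IsDiagonal w a T ↔ IsDiagonal v a T := by
  refine forall₂_congr fun x i => ?_
  obtain ⟨c, hc, hw⟩ := h i
  rw [hw, inner_smul_left, inner_smul_left, mul_left_comm, mul_right_inj' ((map_ne_zero _).2 hc)]

end HilbertSpace

theorem tendsto_zero_of_summable_rpow {ι : Type*} {a : ι → ℝ} (ha : ∀ i, 0 ≤ a i) {r : ℝ}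
    (hr : 0 < r) (hsum : Summable fun i => a i ^ r) : Tendsto a cofinite (𝓝 0) := by
  have hroot := hsum.tendsto_cofinite_zero.rpow_const (p := r⁻¹) (Or.inr (by positivity))
  rw [Real.zero_rpow (by positivity)] at hroot
  refine hroot.congr fun i => ?_
  rw [← Real.rpow_mul (ha i), mul_inv_cancel₀ hr.ne', Real.rpow_one]

theorem IsDiagonal.isSchatten {ι : Type} {H : Type*} [NormedAddCommGroup H]
    [InnerProductSpace ℂ H] {b : HilbertBasis ι ℂ H} {a : ι → ℝ} {T : H →L[ℂ] H}
    (hT : IsDiagonal b (fun i => (a i : ℂ)) T) (ha : ∀ i, 0 ≤ a i) {r : ℝ} (hr : 0 < r)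
    (hsum : Summable fun i => a i ^ r) {p : ℝ≥0∞} (hp : ENNReal.ofReal r ≤ p) :
    IsSchatten p T := by
  have hmem : Memℓp a (ENNReal.ofReal r) := memℓp_gen <| by
    simpa only [ENNReal.toReal_ofReal hr.le, Real.norm_of_nonneg (ha _)] using hsum
  refine ⟨ι, b, b, a, b.orthonormal, b.orthonormal, ha, tendsto_zero_of_summable_rpow ha hr hsum,
    hmem.of_exponent_ge hp, fun x => ?_⟩
  simpa only [b.repr_apply_apply, hT x] using b.hasSum_repr (T x)

/-! ### Tensor products -/

theorem multilinear_eq_zero_of_hilbertBasis {κ 𝕜 E F : Type*} [Finite κ] [RCLike 𝕜]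
    [NormedAddCommGroup E] [InnerProductSpace 𝕜 E] [NormedAddCommGroup F] [NormedSpace 𝕜 F]
    {ι : Type*} (u : HilbertBasis ι 𝕜 E) (L : ContinuousMultilinearMap 𝕜 (fun _ : κ => E) F)
    (h : ∀ m : κ → ι, (L fun i => u (m i)) = 0) : L = 0 := by
  classical
  have := Fintype.ofFinite κ
  suffices hfree : ∀ (S : Finset κ) (φ : κ → E), (∀ i ∉ S, φ i ∈ Set.range u) → L φ = 0 by
    ext φ
    exact hfree Finset.univ φ fun i hi => absurd (Finset.mem_univ i) hi
  intro S
  induction S using Finset.induction_on with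
  | empty =>
    intro φ hφ
    choose m hm using fun i => hφ i (Finset.notMem_empty i)
    rw [← funext hm, h]
  | insert i S _ ih =>
    intro φ hφ
    have hslot : L.toContinuousLinearMap φ i = 0 :=
      ContinuousLinearMap.ext_on
        (Submodule.dense_iff_topologicalClosure_eq_top.2 u.dense_span) <| by
      rintro _ ⟨n, rfl⟩
      refine ih _ fun j hj => ?_
      by_cases hij : j = i
      · subst hij
        exact ⟨n, by simp⟩
      · rw [Function.update_of_ne hij]
        exact hφ j (by simp [hij, hj])
    simpa using DFunLike.congr_fun hslot (φ i)

theorem ae_eq_zero_of_setIntegral_closedBall_eq_zero {α E : Type*} [PseudoMetricSpace α]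
    [MeasurableSpace α] [BorelSpace α] [SecondCountableTopology α] {μ : Measure α}
    [IsUnifLocDoublingMeasure μ] [IsLocallyFiniteMeasure μ] [NormedAddCommGroup E]
    [NormedSpace ℝ E] [CompleteSpace E] {f : α → E} (hf : LocallyIntegrable f μ)
    (h : ∀ x r, 0 ≤ r → ∫ y in Metric.closedBall x r, f y ∂μ = 0) : f =ᵐ[μ] 0 := by
  filter_upwards [IsUnifLocDoublingMeasure.ae_tendsto_average (μ := μ) hf 1] with x hx
  have haverage := hx (l := 𝓝[>] (0 : ℝ)) (fun _ => x) id tendsto_id <| by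
    filter_upwards [self_mem_nhdsWithin] with r hr
    exact Metric.mem_closedBall_self (by simpa using le_of_lt hr)
  refine tendsto_nhds_unique haverage (tendsto_const_nhds.congr' ?_)
  filter_upwards [self_mem_nhdsWithin] with r hr
  rw [setAverage_eq, id_eq, h x r (le_of_lt hr), smul_zero, Pi.zero_apply]

section Tensor

variable {k : ℕ}

/-- The tensor product `φ₁ ⊗ ⋯ ⊗ φₖ`. -/
def tensor (φ : Fin k → L2R) : L2Rk k := (memLp_tensor φ).toLp

theorem coeFn_tensor (φ : Fin k → L2R) : ∀ᵐ x : Fin k → ℝ, tensor φ x = ∏ i, φ i (x i) :=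
  (memLp_tensor φ).coeFn_toLp

theorem inner_tensor (φ ψ : Fin k → L2R) : ⟪tensor φ, tensor ψ⟫_ℂ = ∏ i, ⟪φ i, ψ i⟫_ℂ := by
  simp only [L2.inner_def]
  rw [← integral_fintype_prod_volume_eq_prod (fun i x => ⟪φ i x, ψ i x⟫_ℂ)]
  refine integral_congr_ae ?_
  filter_upwards [coeFn_tensor φ, coeFn_tensor ψ] with x hφ hψ
  simp only [hφ, hψ, RCLike.inner_apply, map_prod, Finset.prod_mul_distrib]

theorem norm_tensor (φ : Fin k → L2R) : ‖tensor φ‖ = ∏ i, ‖φ i‖ := by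
  have hsq : ‖tensor φ‖ ^ 2 = (∏ i, ‖φ i‖) ^ 2 := by
    have hinner := inner_tensor φ φ
    simp only [inner_self_eq_norm_sq_to_K, Complex.coe_algebraMap] at hinner
    rw [← Finset.prod_pow]
    exact_mod_cast hinner
  exact (pow_left_inj₀ (norm_nonneg _) (Finset.prod_nonneg fun i _ => norm_nonneg _)
    two_ne_zero).1 hsq

theorem ae_comp_eval (i : Fin k) {P : ℝ → Prop} (h : ∀ᵐ y, P y) : ∀ᵐ x : Fin k → ℝ, P (x i) :=
  (Measure.quasiMeasurePreserving_eval (fun _ : Fin k => (volume : Measure ℝ)) i).ae h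

theorem coeFn_tensor_update [DecidableEq (Fin k)] (φ : Fin k → L2R) (i : Fin k) (f : L2R) :
    ∀ᵐ x : Fin k → ℝ, tensor (Function.update φ i f) x =
      f (x i) * ∏ j ∈ Finset.univ.erase i, φ j (x j) := by
  filter_upwards [coeFn_tensor (Function.update φ i f)] with x hx
  rw [hx, ← Finset.mul_prod_erase _ _ (Finset.mem_univ i), Function.update_self]
  congr 1
  refine Finset.prod_congr rfl fun j hj => ?_
  rw [Function.update_of_ne (Finset.ne_of_mem_erase hj)]

theorem tensor_update_add [DecidableEq (Fin k)] (φ : Fin k → L2R) (i : Fin k) (f g : L2R) :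
    tensor (Function.update φ i (f + g)) =
      tensor (Function.update φ i f) + tensor (Function.update φ i g) := by
  refine Lp.ext ?_
  filter_upwards [coeFn_tensor_update φ i (f + g), coeFn_tensor_update φ i f,
    coeFn_tensor_update φ i g, ae_comp_eval i (Lp.coeFn_add f g),
    Lp.coeFn_add (tensor (Function.update φ i f)) (tensor (Function.update φ i g))]
    with x hadd hf hg hfg hsum
  rw [hadd, hsum, Pi.add_apply, hf, hg, hfg, Pi.add_apply, add_mul]

theorem tensor_update_smul [DecidableEq (Fin k)] (φ : Fin k → L2R) (i : Fin k) (c : ℂ) (f : L2R) :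
    tensor (Function.update φ i (c • f)) = c • tensor (Function.update φ i f) := by
  refine Lp.ext ?_
  filter_upwards [coeFn_tensor_update φ i (c • f), coeFn_tensor_update φ i f,
    ae_comp_eval i (Lp.coeFn_smul c f), Lp.coeFn_smul c (tensor (Function.update φ i f))]
    with x hcf hf hfi hsmul
  rw [hcf, hsmul, Pi.smul_apply, hf, hfi, Pi.smul_apply, smul_eq_mul, smul_eq_mul, mul_assoc]

variable (k) in
/-- `(φ₁, …, φₖ) ↦ φ₁ ⊗ ⋯ ⊗ φₖ` as a continuous multilinear map. -/
def tensorMultilinear : ContinuousMultilinearMap ℂ (fun _ : Fin k => L2R) (L2Rk k) :=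
  MultilinearMap.mkContinuous
    { toFun := tensor
      map_update_add' := tensor_update_add
      map_update_smul' := tensor_update_smul } 1
    fun φ => by rw [one_mul]; exact (norm_tensor φ).le

/-- The indicator function of the closed ball of center `x` and radius `r`. -/
def ballIndicator (x r : ℝ) : L2R :=
  indicatorConstLp 2 (Metric.isClosed_closedBall (x := x) (ε := r)).measurableSet
    measure_closedBall_lt_top.ne 1

theorem tensor_ballIndicator_ae_eq (x : Fin k → ℝ) {r : ℝ} (hr : 0 ≤ r) :
    tensor (fun i => ballIndicator (x i) r) =ᵐ[volume] (Metric.closedBall x r).indicator 1 := by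
  have hfactor : ∀ᵐ y : Fin k → ℝ, ∀ i, ballIndicator (x i) r (y i) =
      (Metric.closedBall (x i) r).indicator 1 (y i) :=
    ae_all_iff.2 fun i => ae_comp_eval i indicatorConstLp_coeFn
  filter_upwards [coeFn_tensor fun i => ballIndicator (x i) r, hfactor] with y htensor hy
  simp only [htensor, hy]
  rw [closedBall_pi x hr, ← Finset.coe_univ, Set.indicator_pi_one_apply]

theorem isTotal_tensor : IsTotal ℂ (tensor : (Fin k → L2R) → L2Rk k) := by
  intro Φ h
  rw [Lp.eq_zero_iff_ae_eq_zero]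
  refine ae_eq_zero_of_setIntegral_closedBall_eq_zero
    ((Lp.memLp Φ).locallyIntegrable (by norm_num)) fun x r hr => ?_
  rw [← integral_indicator Metric.isClosed_closedBall.measurableSet,
    ← h fun i => ballIndicator (x i) r, L2.inner_def]
  refine integral_congr_ae ?_
  filter_upwards [tensor_ballIndicator_ae_eq x hr] with y hy
  rw [hy, RCLike.inner_apply]
  by_cases hmem : y ∈ Metric.closedBall x r <;> simp [hmem]

theorem isTotal_tensor_hilbertBasis {ι : Type*} (u : HilbertBasis ι ℂ L2R) :
    IsTotal ℂ fun m : Fin k → ι => tensor fun i => u (m i) := by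
  intro Φ h
  have hzero : (innerSL ℂ Φ).compContinuousMultilinearMap (tensorMultilinear k) = 0 :=
    multilinear_eq_zero_of_hilbertBasis u _ fun m => inner_eq_zero_symm.1 (h m)
  exact isTotal_tensor Φ fun φ => inner_eq_zero_symm.1 (DFunLike.congr_fun hzero φ)

end Tensor

/-! ### The bosonic space -/

theorem inv_sqrt_factorial_mul_factorial (k : ℕ) :
    ((Real.sqrt (k.factorial : ℝ))⁻¹ : ℂ) * k.factorial = Real.sqrt (k.factorial : ℝ) := by
  rw [inv_mul_eq_div, ← Complex.ofReal_natCast, ← Complex.ofReal_div, Real.div_sqrt]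

theorem ofReal_sqrt_factorial_ne_zero (k : ℕ) : (Real.sqrt (k.factorial : ℝ) : ℂ) ≠ 0 :=
  Complex.ofReal_ne_zero.2 (Real.sqrt_pos.2 (by positivity)).ne'

section SymL2

variable {k : ℕ}

theorem mem_symL2_iff {Φ : L2Rk k} : Φ ∈ SymL2 k ↔ ∀ σ : Equiv.Perm (Fin k),
    Lp.compMeasurePreservingₗᵢ ℂ _ (measurePreserving_perm σ) Φ = Φ :=
  forall_congr' fun σ =>
    have hcomp := Lp.coeFn_compMeasurePreserving Φ (measurePreserving_perm σ)
    ⟨fun hΦ => Lp.ext (hcomp.trans hΦ), fun hΦ => hcomp.symm.trans (Lp.ext_iff.1 hΦ)⟩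

theorem isClosed_symL2 (k : ℕ) : IsClosed (SymL2 k : Set (L2Rk k)) := by
  have : (SymL2 k : Set (L2Rk k)) = ⋂ σ : Equiv.Perm (Fin k),
      {Φ | Lp.compMeasurePreservingₗᵢ ℂ _ (measurePreserving_perm σ) Φ = Φ} := by
    ext Φ
    simp only [SetLike.mem_coe, mem_symL2_iff, Set.mem_iInter, Set.mem_ofPred_eq]
  rw [this]
  exact isClosed_iInter fun σ => isClosed_eq (LinearIsometry.continuous _) continuous_id

instance (k : ℕ) : CompleteSpace (SymL2 k) := (isClosed_symL2 k).completeSpace_coe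

theorem compMeasurePreserving_tensor_comp (φ : Fin k → L2R) (σ : Equiv.Perm (Fin k)) :
    Lp.compMeasurePreservingₗᵢ ℂ _ (measurePreserving_perm σ) (tensor fun i => φ (σ i)) =
      tensor φ := by
  have hmp := measurePreserving_perm σ
  refine Lp.ext ?_
  filter_upwards [Lp.coeFn_compMeasurePreserving (tensor fun i => φ (σ i)) hmp,
    hmp.quasiMeasurePreserving.ae (coeFn_tensor fun i => φ (σ i)), coeFn_tensor φ]
    with x hcomp hσ hφ
  refine hcomp.trans ?_
  rw [Function.comp_apply, hσ, hφ]
  exact Equiv.prod_comp σ fun i => φ i (x i)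

theorem inner_tensor_comp_perm (Φ : SymL2 k) (φ : Fin k → L2R) (σ : Equiv.Perm (Fin k)) :
    ⟪(Φ : L2Rk k), tensor fun i => φ (σ i)⟫_ℂ = ⟪(Φ : L2Rk k), tensor φ⟫_ℂ := by
  rw [← LinearIsometry.inner_map_map
    (Lp.compMeasurePreservingₗᵢ ℂ _ (measurePreserving_perm σ)), mem_symL2_iff.1 Φ.2,
    compMeasurePreserving_tensor_comp]

theorem coe_symTensor (φ : Fin k → L2R) :
    (symTensor φ : L2Rk k) = ((Real.sqrt (k.factorial : ℝ))⁻¹ : ℂ) •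
      ∑ σ : Equiv.Perm (Fin k), tensor fun i => φ (σ i) := by
  have hperm : ∀ᵐ x, ∀ σ : Equiv.Perm (Fin k), tensor (fun i => φ (σ i)) x = ∏ i, φ (σ i) (x i) :=
    ae_all_iff.2 fun σ => coeFn_tensor _
  refine Lp.ext ?_
  filter_upwards [(memLp_symTensorFun φ).coeFn_toLp, hperm,
    Lp.coeFn_smul ((Real.sqrt (k.factorial : ℝ))⁻¹ : ℂ)
      (∑ σ : Equiv.Perm (Fin k), tensor fun i => φ (σ i)),
    Lp.coeFn_finsetSum Finset.univ fun σ : Equiv.Perm (Fin k) => tensor fun i => φ (σ i)]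
    with x hsymTensor htensor hsmul hsum
  rw [hsmul, Pi.smul_apply, hsum, Finset.sum_apply]
  simp only [htensor]
  exact hsymTensor

theorem inner_symTensor_right (Φ : SymL2 k) (φ : Fin k → L2R) :
    ⟪Φ, symTensor φ⟫_ℂ = Real.sqrt (k.factorial : ℝ) * ⟪(Φ : L2Rk k), tensor φ⟫_ℂ := by
  rw [Submodule.coe_inner, coe_symTensor, inner_smul_right, inner_sum]
  simp only [inner_tensor_comp_perm]
  rw [Finset.sum_const, Finset.card_univ, Fintype.card_perm, Fintype.card_fin, nsmul_eq_mul,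
    ← mul_assoc, inv_sqrt_factorial_mul_factorial]

theorem inner_symTensor (φ ψ : Fin k → L2R) :
    ⟪symTensor φ, symTensor ψ⟫_ℂ = ∑ σ : Equiv.Perm (Fin k), ∏ i, ⟪φ i, ψ (σ i)⟫_ℂ := by
  rw [inner_symTensor_right, coe_symTensor, inner_smul_left, sum_inner, map_inv₀,
    Complex.conj_ofReal, mul_inv_cancel_left₀ (ofReal_sqrt_factorial_ne_zero k)]
  simp only [inner_tensor]
  refine Fintype.sum_equiv (Equiv.inv _) _ _ fun σ => Fintype.prod_equiv σ _ _ fun i => ?_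
  simp

end SymL2

section OccupationState

variable {ι : Type*} [LinearOrder ι] (u : HilbertBasis ι ℂ L2R) (k : ℕ)

/-- The occupation number states of the bosonic space, up to normalization: the symmetric products
of `k` elements of the basis `u`. The multiset of these elements is encoded by its increasing
enumeration. -/
def occupationState (m : {m : Fin k → ι // Monotone m}) : SymL2 k := symTensor fun i => u (m.1 i)

theorem inner_symTensor_hilbertBasis (m m' : Fin k → ι) :
    ⟪symTensor fun i => u (m i), symTensor fun i => u (m' i)⟫_ℂ =
      (Finset.univ.filter fun σ : Equiv.Perm (Fin k) => m = m' ∘ σ).card := by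
  rw [inner_symTensor, Finset.card_filter, Nat.cast_sum]
  refine Finset.sum_congr rfl fun σ _ => ?_
  simp only [orthonormal_iff_ite.1 u.orthonormal, funext_iff, Function.comp_apply]
  rw [Finset.prod_ite_zero]
  simp

theorem occupationState_ne_zero (m : {m : Fin k → ι // Monotone m}) :
    occupationState u k m ≠ 0 := by
  intro hzero
  have hcard := (inner_symTensor_hilbertBasis u k m.1 m.1).symm.trans (inner_self_eq_zero.2 hzero)
  rw [Nat.cast_eq_zero, Finset.card_eq_zero, Finset.filter_eq_empty_iff] at hcard
  exact hcard (Finset.mem_univ 1) rfl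

theorem pairwise_inner_occupationState_eq_zero :
    Pairwise fun m m' => ⟪occupationState u k m, occupationState u k m'⟫_ℂ = 0 := by
  refine fun m m' hne => (inner_symTensor_hilbertBasis u k m.1 m'.1).trans ?_
  rw [Finset.card_eq_zero.2, Nat.cast_zero]
  refine Finset.filter_eq_empty_iff.2 fun σ _ hσ => hne (Subtype.ext (hσ.trans ?_))
  simpa using Tuple.unique_monotone (f := m'.1) (σ := σ) (τ := 1) (hσ ▸ m.2) (by simpa using m'.2)

theorem isTotal_occupationState : IsTotal ℂ (occupationState u k) := by
  intro Φ hΦ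
  have hmono (m : Fin k → ι) (hm : Monotone m) :
      ⟪(Φ : L2Rk k), tensor fun i => u (m i)⟫_ℂ = 0 :=
    (mul_eq_zero.1 ((inner_symTensor_right Φ _).symm.trans
      (inner_eq_zero_symm.1 (hΦ ⟨m, hm⟩)))).resolve_left (ofReal_sqrt_factorial_ne_zero k)
  refine Subtype.ext (isTotal_tensor_hilbertBasis u _ fun m => inner_eq_zero_symm.1 ?_)
  rw [← inner_tensor_comp_perm Φ (fun i => u (m i)) (Tuple.sort m)]
  exact hmono (m ∘ Tuple.sort m) (Tuple.monotone_sort m)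

theorem exists_hilbertBasis_occupationState :
    ∃ b : HilbertBasis {m : Fin k → ι // Monotone m} ℂ (SymL2 k),
      ∀ m, ∃ c : ℂ, c ≠ 0 ∧ b m = c • occupationState u k m :=
  exists_hilbertBasis_smul_eq (isTotal_occupationState u k) (occupationState_ne_zero u k)
    (pairwise_inner_occupationState_eq_zero u k)

end OccupationState

/-! ### Tensor powers of diagonal operators -/

section TensorPower

variable {ι : Type*} [LinearOrder ι] {u : HilbertBasis ι ℂ L2R} {a : ι → ℂ} {R : L2R →L[ℂ] L2R}
  {k : ℕ}

theorem IsDiagonal.isTensorPower {T : SymL2 k →L[ℂ] SymL2 k} (hR : IsDiagonal u a R)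
    (hT : IsDiagonal (occupationState u k) (fun m => ∏ i, a (m.1 i)) T) : IsTensorPower R k T := by
  refine fun φ => (isTotal_occupationState u k).ext fun m => (hT _ m).trans ?_
  unfold occupationState
  rw [inner_symTensor, inner_symTensor, Finset.mul_sum]
  simp only [hR _ _, Finset.prod_mul_distrib]

theorem exists_isDiagonal_occupationState {B : ℝ} (hB : 0 ≤ B) (ha : ∀ n, ‖a n‖ ≤ B) :
    ∃ T : SymL2 k →L[ℂ] SymL2 k,
      IsDiagonal (occupationState u k) (fun m => ∏ i, a (m.1 i)) T := by
  obtain ⟨b, hb⟩ := exists_hilbertBasis_occupationState u k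
  have hbound (m : {m : Fin k → ι // Monotone m}) : ‖∏ i, a (m.1 i)‖ ≤ B ^ k := by
    rw [norm_prod]
    simpa using Finset.prod_le_prod (s := Finset.univ) (fun i _ => norm_nonneg (a (m.1 i)))
      fun i _ => ha (m.1 i)
  obtain ⟨T, hT⟩ := exists_isDiagonal b (pow_nonneg hB k) hbound
  exact ⟨T, (isDiagonal_congr hb).1 hT⟩

end TensorPower

theorem summable_prod_comp {ι κ : Type*} [Fintype κ] {f : ι → ℝ} (hf₀ : ∀ n, 0 ≤ f n)
    (hf : Summable f) : Summable fun m : κ → ι => ∏ i, f (m i) := by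
  classical
  refine summable_of_sum_le (c := (∑' n, f n) ^ Fintype.card κ)
    (fun m => Finset.prod_nonneg fun i _ => hf₀ _) fun F => ?_
  let S : Finset ι := F.biUnion fun m => Finset.univ.image m
  have hF : F ⊆ Fintype.piFinset fun _ : κ => S := fun m hm =>
    Fintype.mem_piFinset.2 fun i =>
      Finset.mem_biUnion.2 ⟨m, hm, Finset.mem_image_of_mem m (Finset.mem_univ i)⟩
  calc ∑ m ∈ F, ∏ i, f (m i) ≤ ∑ m ∈ Fintype.piFinset fun _ : κ => S, ∏ i, f (m i) :=
        Finset.sum_le_sum_of_subset_of_nonneg hF fun m _ _ => Finset.prod_nonneg fun i _ => hf₀ _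
    _ = (∑ n ∈ S, f n) ^ Fintype.card κ := by
        rw [← Finset.prod_univ_sum, Finset.prod_const, Finset.card_univ]
    _ ≤ (∑' n, f n) ^ Fintype.card κ :=
        pow_le_pow_left₀ (Finset.sum_nonneg fun n _ => hf₀ n)
          (hf.sum_le_tsum S fun n _ => hf₀ n) _

theorem isSchatten_of_isDiagonal_occupationState {ι : Type} [LinearOrder ι]
    {u : HilbertBasis ι ℂ L2R} {k : ℕ} {a : ι → ℝ} {T : SymL2 k →L[ℂ] SymL2 k}
    (hT : IsDiagonal (occupationState u k) (fun m => ∏ i, (a (m.1 i) : ℂ)) T) (ha : ∀ n, 0 ≤ a n)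
    {r : ℝ} (hr : 0 < r) (hsum : Summable fun n => a n ^ r) {p : ℝ≥0∞}
    (hp : ENNReal.ofReal r ≤ p) : IsSchatten p T := by
  obtain ⟨b, hb⟩ := exists_hilbertBasis_occupationState u k
  simp only [← Complex.ofReal_prod] at hT
  refine ((isDiagonal_congr hb).2 hT).isSchatten (fun m => Finset.prod_nonneg fun i _ => ha _) hr
    ?_ hp
  simp only [← Real.finsetProd_rpow _ _ fun _ _ => ha _]
  exact (summable_prod_comp (fun n => Real.rpow_nonneg (ha n) r) hsum).comp_injective
    Subtype.val_injective

theorem IsSchatten.smul {H : Type*} [NormedAddCommGroup H] [InnerProductSpace ℂ H] {p : ℝ≥0∞}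
    {T : H →L[ℂ] H} (hT : IsSchatten p T) {c : ℝ} (hc : 0 ≤ c) : IsSchatten p ((c : ℂ) • T) := by
  obtain ⟨ι, e, f, σ, he, hf, hσ, htendsto, hmem, hT⟩ := hT
  refine ⟨ι, e, f, fun i => c * σ i, he, hf, fun i => mul_nonneg hc (hσ i), ?_,
    hmem.const_mul c, fun x => ?_⟩
  · simpa using htendsto.const_mul c
  · simpa [smul_smul, mul_assoc] using (hT x).const_smul (c : ℂ)

/-! ### The density matrices of the free Gibbs measure -/

theorem IsSpectralDecomposition.isInverse {V : ℝ → ℝ} {u : HilbertBasis ℕ ℂ L2R} {lam : ℕ → ℝ}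
    (h : IsSpectralDecomposition V u lam) (hlam : ∀ n, lam n ≠ 0) {R : L2R →L[ℂ] L2R}
    (hR : IsDiagonal u (fun n => (lam n : ℂ)⁻¹) R) : IsInverse V R := by
  intro f g
  have hne (n : ℕ) : (lam n : ℂ) ≠ 0 := Complex.ofReal_ne_zero.2 (hlam n)
  rw [h f g]
  constructor
  · intro hfg
    refine (isTotal_hilbertBasis u).ext fun n => ?_
    rw [hR, hfg, inv_mul_cancel_left₀ (hne n)]
  · rintro rfl n
    rw [hR, mul_inv_cancel_left₀ (hne n)]

section DensityMatrix

variable {u : HilbertBasis ℕ ℂ L2R} {lam : ℕ → ℝ} {t₀ : ℝ} {μ : Measure (SobolevInter lam t₀)}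
  {k : ℕ}

theorem hilbertBasis_mem_sobolevLike (u : HilbertBasis ℕ ℂ L2R) (lam : ℕ → ℝ) (t : ℝ) (j : ℕ) :
    (fun n => ⟪u n, u j⟫_ℂ) ∈ SobolevLike lam t := by
  refine summable_of_ne_finset_zero (s := {j}) fun n hn => ?_
  rw [Finset.mem_singleton] at hn
  beta_reduce
  rw [u.orthonormal.2 hn, norm_zero, zero_pow two_ne_zero, mul_zero]

theorem IsDensityMatrix.unique {γ γ' : SymL2 k →L[ℂ] SymL2 k} (h : IsDensityMatrix u μ k γ)
    (h' : IsDensityMatrix u μ k γ') : γ = γ' := by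
  refine (isTotal_occupationState u k).clm_ext fun m m' => ?_
  have hmem (m : Fin k → ℕ) (i : Fin k) :
      (fun n => ⟪u n, u (m i)⟫_ℂ) ∈ SobolevLike lam (-(t₀ - 1)) :=
    hilbertBasis_mem_sobolevLike u lam _ _
  exact (h _ (sub_one_lt t₀) _ _ (hmem m.1) (hmem m'.1)).2.symm.trans
    (h' _ (sub_one_lt t₀) _ _ (hmem m.1) (hmem m'.1)).2

theorem symPairing_eq_sqrt_factorial_mul_prod (u : HilbertBasis ℕ ℂ L2R) (φ : Fin k → L2R)
    (α : ℕ → ℂ) :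
    symPairing u φ α =
      Real.sqrt (k.factorial : ℝ) * ∏ i, pairing (fun n => ⟪u n, φ i⟫_ℂ) α := by
  rw [symPairing, sum_perm_prod_comp fun i => pairing (fun n => ⟪u n, φ i⟫_ℂ) α, ← mul_assoc,
    Fintype.card_fin, inv_sqrt_factorial_mul_factorial]

theorem IsFreeGibbs.integral_symPairing (hμ : IsFreeGibbs μ) (hlam : ∀ n, 0 < lam n) {t : ℝ}
    (ht : t < t₀) (hsum : Summable fun n => lam n ^ (t - 1)) {R : L2R →L[ℂ] L2R}
    (hR : IsDiagonal u (fun n => (lam n : ℂ)⁻¹) R) {φ ψ : Fin k → L2R}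
    (hφ : ∀ i, (fun n => ⟪u n, φ i⟫_ℂ) ∈ SobolevLike lam (-t))
    (hψ : ∀ i, (fun n => ⟪u n, ψ i⟫_ℂ) ∈ SobolevLike lam (-t)) :
    Integrable (fun α : SobolevInter lam t₀ =>
        symPairing u φ α.1 * conj (symPairing u ψ α.1)) μ ∧
      ∫ α : SobolevInter lam t₀, symPairing u φ α.1 * conj (symPairing u ψ α.1) ∂μ =
        k.factorial * ∑ σ : Equiv.Perm (Fin k), ∏ i, ⟪φ i, R (ψ (σ i))⟫_ℂ := by
  have hcovariance (i j : Fin k) :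
      HasSum (fun n => conj ⟪u n, φ i⟫_ℂ * ⟪u n, ψ j⟫_ℂ / lam n) ⟪φ i, R (ψ j)⟫_ℂ := by
    refine (u.hasSum_inner_mul_inner (φ i) (R (ψ j))).congr_fun fun n => ?_
    rw [hR, inner_conj_symm]
    ring
  obtain ⟨hint, hintegral⟩ := hμ.integral_prod_pairing_mul_conj hlam ht hsum hφ hψ hcovariance
  have hsq : (Real.sqrt (k.factorial : ℝ) : ℂ) * Real.sqrt (k.factorial : ℝ) = k.factorial := by
    rw [← Complex.ofReal_mul, Real.mul_self_sqrt (Nat.cast_nonneg _), Complex.ofReal_natCast]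
  simp_rw [symPairing_eq_sqrt_factorial_mul_prod, map_mul, Complex.conj_ofReal, mul_mul_mul_comm,
    hsq]
  exact ⟨hint.const_mul _, by rw [integral_const_mul, hintegral]⟩

theorem IsFreeGibbs.isDensityMatrix (hμ : IsFreeGibbs μ) (hlam : ∀ n, 0 < lam n)
    (hsum : ∀ t < t₀, Summable fun n => lam n ^ (t - 1)) {R : L2R →L[ℂ] L2R}
    (hR : IsDiagonal u (fun n => (lam n : ℂ)⁻¹) R) {T : SymL2 k →L[ℂ] SymL2 k}
    (hT : IsTensorPower R k T) : IsDensityMatrix u μ k ((k.factorial : ℂ) • T) := by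
  intro t ht φ ψ hφ hψ
  obtain ⟨hint, hintegral⟩ := hμ.integral_symPairing hlam ht (hsum t ht) hR hφ hψ
  refine ⟨hint, hintegral.trans ?_⟩
  rw [← inner_symTensor φ fun i => R (ψ i), ← hT]
  exact (inner_smul_right (𝕜 := ℂ) (symTensor φ) (T (symTensor ψ)) (k.factorial : ℂ)).symm

end DensityMatrix

section Confining

variable {V : ℝ → ℝ} {s C : ℝ} {u : HilbertBasis ℕ ℂ L2R} {lam : ℕ → ℝ}

theorem ae_pos_of_rpow_le (hC : 0 < C) (hV : ∀ᵐ x : ℝ, C⁻¹ * |x| ^ s ≤ V x) :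
    ∀ᵐ x, 0 < V x := by
  filter_upwards [hV, Measure.ae_ne volume 0] with x hx hne
  exact (mul_pos (inv_pos.2 hC) (Real.rpow_pos_of_pos (abs_pos.2 hne) s)).trans_le hx

theorem IsSpectralDecomposition.summable_rpow_neg (h : IsSpectralDecomposition V u lam)
    (hs : 0 < s) (hC : 0 < C) (hV : ∀ᵐ x : ℝ, C⁻¹ * |x| ^ s ≤ V x) {r : ℝ}
    (hr : 1 / s + 1 / 2 < r) : Summable fun n => lam n ^ (-r) := by
  obtain ⟨A, hA⟩ := h.exists_card_le hs hC hV
  exact summable_rpow_neg_of_card_le (by positivity) hr (h.lam_pos (ae_pos_of_rpow_le hC hV)) hA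

end Confining

theorem isSchatten_factorial_smul {u : HilbertBasis ℕ ℂ L2R} {lam : ℕ → ℝ} {k : ℕ}
    {T : SymL2 k →L[ℂ] SymL2 k} (hlam : ∀ n, 0 < lam n)
    (hT : IsDiagonal (occupationState u k) (fun m => ∏ i, (lam (m.1 i) : ℂ)⁻¹) T) {q : ℝ}
    (hq : 0 ≤ q) (hsum : ∀ r, q < r → Summable fun n => lam n ^ (-r)) {p : ℝ≥0∞}
    (hp : ENNReal.ofReal q < p) : IsSchatten p ((k.factorial : ℂ) • T) := by
  obtain ⟨r, _, hqr, hrp⟩ := ENNReal.lt_iff_exists_real_btwn.1 hp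
  have hlt : q < r := (ENNReal.ofReal_lt_ofReal_iff_of_nonneg hq).1 hqr
  simp only [← Complex.ofReal_inv] at hT
  have hT' : IsSchatten p T := isSchatten_of_isDiagonal_occupationState hT
    (fun n => (inv_pos.2 (hlam n)).le) (hq.trans_lt hlt)
    ((hsum r hlt).congr fun n => by rw [Real.rpow_neg (hlam n).le, Real.inv_rpow (hlam n).le])
    hrp.le
  simpa using hT'.smul (Nat.cast_nonneg k.factorial)

end

end FreeGibbs

theorem mainTheorem2_general (V : ℝ → ℝ) (s C : ℝ) (hs : 0 < s) (hC : 0 < C)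
    (hVloc : MeasureTheory.LocallyIntegrable V MeasureTheory.volume)
    (hV : ∀ᵐ x : ℝ, C⁻¹ * |x| ^ s ≤ V x) :
    (∃ (u : HilbertBasis ℕ ℂ FreeGibbs.L2R) (lam : ℕ → ℝ),
      FreeGibbs.IsSpectralDecomposition V u lam) ∧
    ∀ (u : HilbertBasis ℕ ℂ FreeGibbs.L2R) (lam : ℕ → ℝ),
      FreeGibbs.IsSpectralDecomposition V u lam →
      (∀ n, 0 < lam n) ∧
      ∃ μ₀ : MeasureTheory.Measure (FreeGibbs.SobolevInter lam (1 / 2 - 1 / s)),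
        FreeGibbs.IsFreeGibbs μ₀ ∧
        (∀ ν : MeasureTheory.Measure (FreeGibbs.SobolevInter lam (1 / 2 - 1 / s)),
          FreeGibbs.IsFreeGibbs ν → ν = μ₀) ∧
        FreeGibbs.IsCenteredGaussian μ₀ ∧
        ∃ R : FreeGibbs.L2R →L[ℂ] FreeGibbs.L2R, FreeGibbs.IsInverse V R ∧
          ∀ k : ℕ, ∃ γ T : FreeGibbs.SymL2 k →L[ℂ] FreeGibbs.SymL2 k,
            FreeGibbs.IsDensityMatrix u μ₀ k γ ∧
            (∀ γ' : FreeGibbs.SymL2 k →L[ℂ] FreeGibbs.SymL2 k,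
              FreeGibbs.IsDensityMatrix u μ₀ k γ' → γ' = γ) ∧
            FreeGibbs.IsTensorPower R k T ∧
            γ = (k.factorial : ℂ) • T ∧
            ∀ p : ENNReal, ENNReal.ofReal (1 / s + 1 / 2) < p → FreeGibbs.IsSchatten p γ := by
  have hpos := FreeGibbs.ae_pos_of_rpow_le hC hV
  refine ⟨FreeGibbs.exists_isSpectralDecomposition hVloc (hpos.mono fun _ => le_of_lt)
    (FreeGibbs.exists_forall_le_of_rpow_le hs hC hV), fun u lam h => ?_⟩
  have hlam := h.lam_pos hpos
  have hsum (r : ℝ) (hr : 1 / s + 1 / 2 < r) : Summable fun n => lam n ^ (-r) :=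
    h.summable_rpow_neg hs hC hV hr
  have hsum' (t : ℝ) (ht : t < 1 / 2 - 1 / s) : Summable fun n => lam n ^ (t - 1) := by
    simpa using hsum (1 - t) (by linarith)
  have hexponent : 0 < 1 / s + 1 / 2 := by positivity
  obtain ⟨δ, hδ, hle⟩ := FreeGibbs.exists_pos_lower_bound_of_summable_rpow hlam
    (q := -(1 / s + 1 / 2 + 1)) (by linarith) (hsum _ (lt_add_one _))
  obtain ⟨μ₀, hμ₀, hunique⟩ := FreeGibbs.exists_unique_isFreeGibbs hδ hle hsum'
  have hinv (n : ℕ) : ‖(lam n : ℂ)⁻¹‖ ≤ δ⁻¹ := by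
    simpa [abs_of_pos (hlam n)] using inv_anti₀ hδ (hle n)
  obtain ⟨R, hR⟩ := FreeGibbs.exists_isDiagonal u (inv_pos.2 hδ).le hinv
  refine ⟨hlam, μ₀, hμ₀, hunique, hμ₀.isCenteredGaussian hlam hsum', R,
    h.isInverse (fun n => (hlam n).ne') hR, fun k => ?_⟩
  obtain ⟨T, hT⟩ :=
    FreeGibbs.exists_isDiagonal_occupationState (u := u) (k := k) (inv_pos.2 hδ).le hinv
  have hγ := hμ₀.isDensityMatrix hlam hsum' hR (hR.isTensorPower hT)
  exact ⟨_, T, hγ, fun γ' hγ' => hγ'.unique hγ, hR.isTensorPower hT, rfl, fun p hp =>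
    FreeGibbs.isSchatten_factorial_smul hlam hT hexponent.le hsum hp⟩

theorem mainTheorem2 (V : ℝ → ℝ) (s C : ℝ) (hs : 1 < s) (hC : 0 < C)
    (hVloc : MeasureTheory.LocallyIntegrable V MeasureTheory.volume)
    (hV : ∀ᵐ x : ℝ, C⁻¹ * |x| ^ s ≤ V x) :
    (∃ (u : HilbertBasis ℕ ℂ FreeGibbs.L2R) (lam : ℕ → ℝ),
      FreeGibbs.IsSpectralDecomposition V u lam) ∧
    ∀ (u : HilbertBasis ℕ ℂ FreeGibbs.L2R) (lam : ℕ → ℝ),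
      FreeGibbs.IsSpectralDecomposition V u lam →
      (∀ n, 0 < lam n) ∧
      ∃ μ₀ : MeasureTheory.Measure (FreeGibbs.SobolevInter lam (1 / 2 - 1 / s)),
        FreeGibbs.IsFreeGibbs μ₀ ∧
        (∀ ν : MeasureTheory.Measure (FreeGibbs.SobolevInter lam (1 / 2 - 1 / s)),
          FreeGibbs.IsFreeGibbs ν → ν = μ₀) ∧
        FreeGibbs.IsCenteredGaussian μ₀ ∧
        ∃ R : FreeGibbs.L2R →L[ℂ] FreeGibbs.L2R, FreeGibbs.IsInverse V R ∧
          ∀ k : ℕ, ∃ γ T : FreeGibbs.SymL2 k →L[ℂ] FreeGibbs.SymL2 k,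
            FreeGibbs.IsDensityMatrix u μ₀ k γ ∧
            (∀ γ' : FreeGibbs.SymL2 k →L[ℂ] FreeGibbs.SymL2 k,
              FreeGibbs.IsDensityMatrix u μ₀ k γ' → γ' = γ) ∧
            FreeGibbs.IsTensorPower R k T ∧
            γ = (k.factorial : ℂ) • T ∧
            ∀ p : ENNReal, ENNReal.ofReal (1 / s + 1 / 2) < p → FreeGibbs.IsSchatten p γ :=
  mainTheorem2_general V s C (zero_lt_one.trans hs) hC hVloc hV
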